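/- Let $b,c$ be positive integers and let $\mathcal F=\mathbb Q(x_1,x_2)$ be the field of rational functions in two commuting independent variables. Define $x_m\in\mathcal F$ for all $m\in\mathbb Z$ by the exchange relations $$x_{m-1}x_{m+1}=\begin{cases}x_m^b+1,& m\text{ odd},\\ x_m^c+1,& m\text{ even}.\end{cases}$$ The cluster algebra $\mathcal A=\mathcal A(b,c)$ is the subring of $\mathcal F$ generated by all $x_m$, $m\in\mathbb Z$. The clusters are the sets $\{x_m,x_{m+1}\}$, and the cluster monomials are the elements $x_m^{d_1}x_{m+1}^{d_2}$ with $m\in\mathbb Z$ and integers $d_1,d_2\ge 0$. A non-zero element of $\mathcal A$ is positive if, for every $m\in\mathbb Z$, it is a Laurent polynomial in $x_m,x_{m+1}$ all of whose (non-zero) coefficients are positive integers; a positive element is indecomposable if it is not the sum of two positive elements. An element $x\in\mathcal A$ is greedy at $(a_1,a_2)\in\mathbb Z^2$ (with respect to the cluster $\{x_1,x_2\}$) if $$x=x_1^{-a_1}x_2^{-a_2}\sum_{p,q\ge 0}c(p,q)\,x_1^{bp}x_2^{cq}$$ with $c(p,q)\in\mathbb Z$, only finitely many of them non-zero, $c(0,0)=1$,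 and, for every $(p,q)\in\mathbb Z_{\ge0}^2\setminus\{(0,0)\}$, $$c(p,q)=\max\left(\sum_{k=1}^p(-1)^{k-1}c(p-k,q)\binom{a_2-cq+k-1}{k},\ \sum_{k=1}^q(-1)^{k-1}c(p,q-k)\binom{a_1-bp+k-1}{k}\right),$$ where $\binom ak=0$ unless $0\le k\le a$, and an empty sum is $0$. For an arbitrary $m\in\mathbb Z$, an element is greedy at $(a_1,a_2)$ with respect to the cluster $\{x_m,x_{m+1}\}$ if the same holds with $x_1,x_2$ replaced by $x_m,x_{m+1}$ and, when $m$ is even, with $b$ and $c$ interchanged. Theorem. (a) For every $(a_1,a_2)\in\mathbb Z^2$ there is exactly one element $x[a_1,a_2]\in\mathcal A$ that is greedy at $(a_1,a_2)$ with respect to $\{x_1,x_2\}$. (b) All the elements $x[a_1,a_2]$ are indecomposable positive elements. (c) The elements $x[a_1,a_2]$, $(a_1,a_2)\in\mathbb Z^2$, form a $\mathbb Z$-basis of $\mathcal A$ (the greedy basis). (d) The greedy basis does not depend on the choice of the initial cluster: for every $m\in\mathbb Z$, the set of all elements that are greedy with respect to $\{x_m,x_{m+1}\}$ at some point of $\mathbb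 Z^2$ equals $\{x[a_1,a_2]:(a_1,a_2)\in\mathbb Z^2\}$. (e) The greedy basis contains all cluster monomials. -/

import Mathlib

noncomputable section

namespace RankTwoCluster

/-- The field `ℚ(x₁, x₂)` of rational functions in two commuting variables. -/
abbrev AmbientField : Type := FractionRing (MvPolynomial (Fin 2) ℚ)

/-- The initial cluster variable `x₁`. -/
def x₁ : AmbientField := algebraMap (MvPolynomial (Fin 2) ℚ) AmbientField (MvPolynomial.X 0)

/-- The initial cluster variable `x₂`. -/
def x₂ : AmbientField := algebraMap (MvPolynomial (Fin 2) ℚ) AmbientField (MvPolynomial.X 1)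

/-- The exponent in the exchange relation `x_{m-1} x_{m+1} = x_m ^ e + 1`:
it is `b` for `m` odd and `c` for `m` even. -/
def exchangeExp (b c : ℕ) (m : ℤ) : ℕ := if Odd m then b else c

/-- The sequence `y₀ = u`, `y₁ = v`, `y_{n+2} = (y_{n+1} ^ e (n+1) + 1) / y_n`. -/
def exchangeSeq (e : ℕ → ℕ) (u v : AmbientField) : ℕ → AmbientField
  | 0 => u
  | 1 => v
  | n + 2 => (exchangeSeq e u v (n + 1) ^ e (n + 1) + 1) / exchangeSeq e u v n

/-- The cluster variables `x_m`, `m ∈ ℤ`: for `m ≥ 1` by running the exchange relations upwards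
from `x₁, x₂`, for `m ≤ 0` by running them downwards from `x₂, x₁`.
The facts `clusterVar_one`, `clusterVar_two`, `clusterVar_exchange`
below show that this is the sequence meant. -/
def clusterVar (b c : ℕ) (m : ℤ) : AmbientField :=
  if 1 ≤ m then exchangeSeq (fun n => exchangeExp b c ((n : ℤ) + 1)) x₁ x₂ (m - 1).toNat
  else exchangeSeq (fun n => exchangeExp b c (2 - (n : ℤ))) x₂ x₁ (2 - m).toNat

/-- A rational function that is a quotient of two polynomials positive at `(1, 1)`. -/
def PosAtOne (f : AmbientField) : Prop :=
  ∃ p q : MvPolynomial (Fin 2) ℚ, 0 < MvPolynomial.eval 1 p ∧ 0 < MvPolynomial.eval 1 q ∧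
    f = algebraMap _ AmbientField p / algebraMap _ AmbientField q

theorem algebraMap_ne_zero_of_pos {p : MvPolynomial (Fin 2) ℚ}
    (hp : 0 < MvPolynomial.eval 1 p) : algebraMap _ AmbientField p ≠ 0 := by
  intro h
  have h0 : p = 0 := (IsFractionRing.injective (MvPolynomial (Fin 2) ℚ) AmbientField)
    (by rw [h, map_zero])
  simp [h0] at hp

theorem PosAtOne.ne_zero {f : AmbientField} (hf : PosAtOne f) : f ≠ 0 := by
  obtain ⟨p, q, hp, hq, rfl⟩ := hf
  exact div_ne_zero (algebraMap_ne_zero_of_pos hp) (algebraMap_ne_zero_of_pos hq)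

theorem PosAtOne.step {f g : AmbientField} (hf : PosAtOne f) (hg : PosAtOne g) (n : ℕ) :
    PosAtOne ((f ^ n + 1) / g) := by
  obtain ⟨p, q, hp, hq, rfl⟩ := hf
  obtain ⟨r, s, hr, hs, rfl⟩ := hg
  have hq' := algebraMap_ne_zero_of_pos hq
  have hr' := algebraMap_ne_zero_of_pos hr
  have hs' := algebraMap_ne_zero_of_pos hs
  refine ⟨(p ^ n + q ^ n) * s, q ^ n * r, ?_, ?_, ?_⟩
  · simp only [map_mul, map_add, map_pow]; positivity
  · simp only [map_mul, map_pow]; positivity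
  · simp only [map_mul, map_add, map_pow, div_pow]
    field_simp

theorem exchangeSeq_pos (e : ℕ → ℕ) {u v : AmbientField} (hu : PosAtOne u) (hv : PosAtOne v) :
    ∀ n, PosAtOne (exchangeSeq e u v n)
  | 0 => by rw [exchangeSeq]; exact hu
  | 1 => by rw [exchangeSeq]; exact hv
  | n + 2 => by
    rw [exchangeSeq]
    exact (exchangeSeq_pos e hu hv (n + 1)).step (exchangeSeq_pos e hu hv n) _

theorem posAtOne_x₁ : PosAtOne x₁ := ⟨MvPolynomial.X 0, 1, by simp, by simp, by simp [x₁]⟩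

theorem posAtOne_x₂ : PosAtOne x₂ := ⟨MvPolynomial.X 1, 1, by simp, by simp, by simp [x₂]⟩

theorem clusterVar_ne_zero (b c : ℕ) (m : ℤ) : clusterVar b c m ≠ 0 := by
  unfold clusterVar
  split_ifs
  · exact (exchangeSeq_pos _ posAtOne_x₁ posAtOne_x₂ _).ne_zero
  · exact (exchangeSeq_pos _ posAtOne_x₂ posAtOne_x₁ _).ne_zero

theorem clusterVar_one (b c : ℕ) : clusterVar b c 1 = x₁ := by
  simp [clusterVar, exchangeSeq]

theorem clusterVar_two (b c : ℕ) : clusterVar b c 2 = x₂ := by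
  simp [clusterVar, exchangeSeq]

theorem clusterVar_up (b c : ℕ) (n : ℕ) : clusterVar b c (n + 1) =
    exchangeSeq (fun n => exchangeExp b c ((n : ℤ) + 1)) x₁ x₂ n := by
  simp [clusterVar]

theorem clusterVar_down (b c : ℕ) : ∀ n : ℕ, clusterVar b c (2 - n) =
    exchangeSeq (fun n => exchangeExp b c (2 - (n : ℤ))) x₂ x₁ n
  | 0 => by simp [clusterVar, exchangeSeq]
  | 1 => by simp [clusterVar, exchangeSeq]
  | n + 2 => by
    have h : ¬ (1 : ℤ) ≤ 2 - ((n + 2 : ℕ) : ℤ) := by push_cast; omega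
    have h' : (2 - (2 - ((n + 2 : ℕ) : ℤ))).toNat = n + 2 := by omega
    rw [clusterVar, if_neg h, h']

/-- The exchange relations. -/
theorem clusterVar_exchange (b c : ℕ) (m : ℤ) :
    clusterVar b c (m - 1) * clusterVar b c (m + 1) =
      clusterVar b c m ^ (if Odd m then b else c) + 1 := by
  rcases le_or_gt 2 m with hm | hm
  · obtain ⟨n, rfl⟩ : ∃ n : ℕ, m = n + 2 := ⟨(m - 2).toNat, by omega⟩
    have e0 : ((n : ℤ) + 2 - 1) = n + 1 := by ring
    have e1 : ((n : ℤ) + 2) = ((n + 1 : ℕ) : ℤ) + 1 := by push_cast; ring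
    have e2 : ((n : ℤ) + 2 + 1) = ((n + 2 : ℕ) : ℤ) + 1 := by push_cast; ring
    have h0 := clusterVar_ne_zero b c (n + 1)
    rw [e0, e2, e1, clusterVar_up b c n, clusterVar_up b c (n + 2), clusterVar_up b c (n + 1)]
    rw [clusterVar_up] at h0
    rw [exchangeSeq, mul_div_cancel₀ _ h0]
    rfl
  · obtain ⟨n, rfl⟩ : ∃ n : ℕ, m = 1 - n := ⟨(1 - m).toNat, by omega⟩
    have e0 : (1 - (n : ℤ) + 1) = 2 - n := by ring
    have e1 : (1 - (n : ℤ)) = 2 - ((n + 1 : ℕ) : ℤ) := by push_cast; ring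
    have e2 : (1 - (n : ℤ) - 1) = 2 - ((n + 2 : ℕ) : ℤ) := by push_cast; ring
    have h0 := clusterVar_ne_zero b c (2 - n)
    rw [e0, e2, e1, clusterVar_down b c n, clusterVar_down b c (n + 2), clusterVar_down b c (n + 1)]
    rw [clusterVar_down] at h0
    rw [exchangeSeq, div_mul_cancel₀ _ h0]
    rfl

/-- The cluster algebra `𝒜(b, c)`: the subring of `ℚ(x₁, x₂)` generated by all `x_m`. -/
def clusterAlgebra (b c : ℕ) : Subring AmbientField :=
  Subring.closure (Set.range (clusterVar b c))

/-- `f` is the Laurent expansion of `x` at the cluster `{x_m, x_{m+1}}`: it has integer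
coefficients, and `f (i, j)` is the coefficient of `x_m ^ i * x_{m+1} ^ j`. -/
def IsLaurentExpansion (b c : ℕ) (m : ℤ) (x : AmbientField) (f : ℤ × ℤ →₀ ℤ) : Prop :=
  x = f.sum fun i n => (n : AmbientField) * clusterVar b c m ^ i.1 * clusterVar b c (m + 1) ^ i.2

/-- `x` is a non-zero element whose Laurent expansion at the cluster `{x_m, x_{m+1}}` has
(on its support) positive coefficients only. -/
def IsPositiveAt (b c : ℕ) (m : ℤ) (x : clusterAlgebra b c) : Prop :=
  x ≠ 0 ∧ ∃ f : ℤ × ℤ →₀ ℤ,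
    IsLaurentExpansion b c m x f ∧ ∀ i ∈ f.support, 0 < f i

/-- `x` is positive: it is positive at all the clusters. -/
def IsPositive (b c : ℕ) (x : clusterAlgebra b c) : Prop :=
  ∀ m : ℤ, IsPositiveAt b c m x

/-- `x` is an indecomposable positive element: it is positive, and it is not the sum of two
positive elements. -/
def IsIndecomposablePositive (b c : ℕ) (x : clusterAlgebra b c) : Prop :=
  IsPositive b c x ∧ ¬ ∃ y z : clusterAlgebra b c, IsPositive b c y ∧ IsPositive b c z ∧ x = y + z

/-- The binomial coefficient, with the convention that it is zero unless `0 ≤ k ≤ a`. -/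
def binom (a : ℤ) (k : ℕ) : ℤ := if 0 ≤ a then (a.toNat.choose k : ℤ) else 0

/-- `x` is pointed at `(a₁, a₂)` with respect to the cluster `{x_m, x_{m+1}}`, with coefficients
`coeff (p, q)`. Here `b' = exchangeExp b c m` and `c' = exchangeExp b c (m + 1)` play the role
that `b` and `c` have at the cluster `{x₁, x₂}`:
`x = x_m ^ (-a₁) x_{m+1} ^ (-a₂) ∑ coeff (p, q) x_m ^ (b' p) x_{m+1} ^ (c' q)`. -/
def IsPointedExpansion (b c : ℕ) (m : ℤ) (a : ℤ × ℤ) (x : AmbientField)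
    (coeff : ℕ × ℕ →₀ ℤ) : Prop :=
  coeff (0, 0) = 1 ∧
  x = clusterVar b c m ^ (-a.1) * clusterVar b c (m + 1) ^ (-a.2) *
    coeff.sum fun i n => (n : AmbientField) * clusterVar b c m ^ (exchangeExp b c m * i.1) *
      clusterVar b c (m + 1) ^ (exchangeExp b c (m + 1) * i.2)

/-- The greedy recurrence for the coefficients, with parameters `b`, `c` and `(a₁, a₂)`. -/
def GreedyRecurrence (b c : ℕ) (a : ℤ × ℤ) (coeff : ℕ × ℕ →₀ ℤ) : Prop :=
  ∀ p q : ℕ, (p, q) ≠ (0, 0) →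
    coeff (p, q) = max
      (∑ k ∈ Finset.Icc 1 p, (-1) ^ (k - 1) * coeff (p - k, q) *
        binom (a.2 - (c : ℤ) * q + k - 1) k)
      (∑ k ∈ Finset.Icc 1 q, (-1) ^ (k - 1) * coeff (p, q - k) *
        binom (a.1 - (b : ℤ) * p + k - 1) k)

/-- `x` is greedy at `a = (a₁, a₂)` with respect to the initial cluster `{x_m, x_{m+1}}`.
For `m = 1` the exponents are `b` and `c`; for an even `m` they change places, because
then the exchange relations, read from `x_m, x_{m+1}` on, are those of `𝒜(c, b)`. -/
def IsGreedy (b c : ℕ) (m : ℤ) (a : ℤ × ℤ) (x : clusterAlgebra b c) : Prop :=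
  ∃ coeff : ℕ × ℕ →₀ ℤ, IsPointedExpansion b c m a x coeff ∧
    GreedyRecurrence (exchangeExp b c m) (exchangeExp b c (m + 1)) a coeff

/-- `x` is a cluster monomial: `x = x_m ^ d₁ x_{m+1} ^ d₂` for some `m ∈ ℤ` and `d₁, d₂ ≥ 0`. -/
def IsClusterMonomial (b c : ℕ) (x : AmbientField) : Prop :=
  ∃ (m : ℤ) (d₁ d₂ : ℕ), x = clusterVar b c m ^ d₁ * clusterVar b c (m + 1) ^ d₂

end RankTwoCluster

end

noncomputable section

namespace RankTwoCluster

open Set Polynomial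

/-! Let C(p,q) be the coefficients sought. If row q of C is (1+X)^N times a row of numbers D(p,q),
where N is the positive part of a₂-cq, then inverting the convolution shows that the first sum of
the recurrence is C-D (`sum_binom_eq_sub`). In the same way the second sum is C-E, with E defined
through the columns. Hence C solves the recurrence once C(0,0)=1, D and E are non-negative, and one
of D, E vanishes at every (p,q) ≠ (0,0).

For a₁, a₂ > 0 let C count periodic compatible pairs: chosen horizontal and vertical steps of the
lattice path of slope a₂/a₁, subject to a condition symmetric in the two axes (`pairCount_swap`).
The q chosen horizontal steps define a height function that rises by c at each of them. A vertical
step is either matched with the last rise through its level, or unmatched. Compatibility constrains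
only the matched steps: it says that the resulting arcs are sparse (`compatible_iff`,
`isSparse_iff`). The unmatched steps, as many per period as the positive part of a₂-cq, are free,
and this is the required factorization, with D counting sparse arc configurations
(`pairCount_eq_sum`). Sparse arcs obey an inequality that, for p > 0, gives a₂bp < a₁cq; since E ≠ 0
gives the opposite one, D and E cannot both be non-zero away from the origin
(`slope_le_of_arcCount_ne_zero`, `greedyQuot_eq_zero_or`).

Reversing the path and complementing the set of rises preserves arcs and sparsity
(`arcCount_reflect`). This exchanges the rows of D at (a₁,a₂) with those at (a₁,ca₁⁺-a₂), where a₁⁺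
is the positive part, and together with w·v = 1+u^b it identifies greedy elements at neighbouring
clusters (`greedyElement_mutate`). So all clusters have the same greedy elements (`range_greedyAt`).
Positivity, the Laurent phenomenon and the cluster monomials, which sit at the points (-d₁,-d₂),
follow.

For the spanning property, an element that is Laurent at three consecutive clusters is reduced by
removing its lowest row, then its lowest column; divisibility of these by powers of 1+u^b and 1+v^c
says that enough elements are available (`le_of_standard`). The criterion is applied once to the
cluster algebra and once to the span of the greedy elements. Independence holds because each element
has a lowest monomial with coefficient 1. In a decomposition into positive elements, the vanishing
of D or E forces every non-zero summand to contain that lowest monomial (`IsRowHom.exists_smaller`),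
so there is only one such summand. -/

/-- A set that is invariant under translation by `v`. -/
def IsShiftInvariant {V : Type*} [AddCommGroup V] (v : V) (X : Set V) : Prop :=
  ∀ x, x + v ∈ X ↔ x ∈ X

/-! ### Periodic sets and counts per period -/

section Shift

variable {V : Type*} [AddCommGroup V] {v : V} {X : Set V}

theorem IsShiftInvariant.zsmul (hX : IsShiftInvariant v X) (k : ℤ) (x : V) :
    x + k • v ∈ X ↔ x ∈ X := by
  induction k with
  | zero => simp
  | succ k ih => rw [add_smul, one_smul, ← add_assoc, hX, ih]
  | pred k ih => rw [← ih, ← hX (x + (-(k : ℤ) - 1) • v), sub_smul, one_smul]; simp [add_assoc]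

theorem map_add_zsmul {f : V → ℤ} {n : ℤ} (hf : ∀ x, f (x + v) = f x + n) (k : ℤ) (x : V) :
    f (x + k • v) = f x + k * n := by
  induction k with
  | zero => simp
  | succ k ih => rw [add_smul, one_smul, ← add_assoc, hf, ih]; ring
  | pred k ih =>
    have h := hf (x + (-(k : ℤ) - 1) • v)
    have e : x + (-(k : ℤ) - 1) • v + v = x + (-(k : ℤ)) • v := by
      rw [sub_smul, one_smul, add_assoc, sub_add_cancel]
    rw [e, ih] at h
    linarith

/-- The number of orbits of a shift does not depend on the fundamental domain. -/
theorem ncard_window_eq (hX : IsShiftInvariant v X) {f g : V → ℤ} {n n' : ℤ}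
    (hn : 0 < n) (hn' : 0 < n') (hf : ∀ x, f (x + v) = f x + n)
    (hg : ∀ x, g (x + v) = g x + n') :
    {x ∈ X | 0 ≤ f x ∧ f x < n}.ncard = {x ∈ X | 0 ≤ g x ∧ g x < n'}.ncard := by
  -- Every orbit meets each window exactly once: `key` gives the representative, `uniq` its
  -- uniqueness. Sending a point to its representative in the other window is then a bijection.
  have key : ∀ {f : V → ℤ} {n : ℤ}, 0 < n → (∀ x, f (x + v) = f x + n) → ∀ x : V,
      0 ≤ f (x + (-(f x / n)) • v) ∧ f (x + (-(f x / n)) • v) < n := by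
    intro f n hn hf x
    rw [map_add_zsmul hf]
    have h1 := Int.emod_nonneg (f x) hn.ne'
    have h2 := Int.emod_lt_of_pos (f x) hn
    have h3 := Int.mul_ediv_add_emod (f x) n
    constructor <;> nlinarith
  have uniq : ∀ {f : V → ℤ} {n : ℤ}, 0 < n → (∀ x, f (x + v) = f x + n) → ∀ (x : V) (k : ℤ),
      0 ≤ f x → f x < n → 0 ≤ f (x + k • v) → f (x + k • v) < n → k = 0 := by
    intro f n hn hf x k h1 h2 h3 h4
    rw [map_add_zsmul hf] at h3 h4
    have : k < 1 := by by_contra h; push Not at h; nlinarith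
    have : -1 < k := by by_contra h; push Not at h; nlinarith
    omega
  refine Set.ncard_congr (fun x _ => x + (-(g x / n')) • v) ?_ ?_ ?_
  · rintro x ⟨hx, -⟩
    exact ⟨(hX.zsmul _ _).2 hx, key hn' hg x⟩
  · rintro x y ⟨-, hx1, hx2⟩ ⟨-, hy1, hy2⟩ h
    have e : y = x + (g y / n' - g x / n') • v := by
      rw [sub_smul, sub_eq_add_neg, ← neg_smul, add_comm (_ • v), ← add_assoc, h, add_assoc,
        ← add_smul]
      simp
    have := uniq hn hf x (g y / n' - g x / n') hx1 hx2 (by rwa [← e]) (by rwa [← e])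
    rw [e, this]
    simp
  · rintro y ⟨hy, hy1, hy2⟩
    refine ⟨y + (-(f y / n)) • v, ⟨(hX.zsmul _ _).2 hy, key hn hf y⟩, ?_⟩
    set x := y + (-(f y / n)) • v with hx
    have h0 := key hn' hg x
    have e : x + (-(g x / n')) • v = y + (-(f y / n) + -(g x / n')) • v := by
      rw [hx, add_assoc, ← add_smul]
    rw [e] at h0 ⊢
    rw [uniq hn' hg y _ hy1 hy2 h0.1 h0.2]
    simp

end Shift

theorem int_funext {f g : ℤ → ℤ} (h0 : f 0 = g 0)
    (h : ∀ k, f (k + 1) - f k = g (k + 1) - g k) (k : ℤ) : f k = g k := by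
  induction k with
  | zero => exact h0
  | succ k ih => have := h k; linarith
  | pred k ih => have := h (-(k : ℤ) - 1); rw [sub_add_cancel] at this; linarith

/-- The signed number of elements of `S` between `0` and `k`. -/
def signedCount (S : Set ℤ) (k : ℤ) : ℤ := ((S ∩ Ico 0 k).ncard : ℤ) - (S ∩ Ico k 0).ncard

section Count

variable (S : Set ℤ)

@[simp] theorem signedCount_zero : signedCount S 0 = 0 := by simp [signedCount]

theorem signedCount_succ_of_mem {k : ℤ} (hk : k ∈ S) :
    signedCount S (k + 1) = signedCount S k + 1 := by
  unfold signedCount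
  rcases le_or_gt 0 k with h | h
  · have e1 : S ∩ Ico 0 (k + 1) = insert k (S ∩ Ico 0 k) := by
      ext x; simp only [mem_inter_iff, mem_Ico, mem_insert_iff]
      constructor
      · rintro ⟨h1, h2, h3⟩
        rcases eq_or_ne x k with e | e
        · exact .inl e
        · exact .inr ⟨h1, h2, by omega⟩
      · rintro (rfl | ⟨h1, h2, h3⟩)
        · exact ⟨hk, h, by omega⟩
        · exact ⟨h1, h2, by omega⟩
    rw [e1, Set.ncard_insert_of_notMem (by simp) ((finite_Ico 0 k).inter_of_right S),
      Ico_eq_empty (a := k + 1) (by omega), Ico_eq_empty (a := k) (by omega)]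
    simp
  · have e1 : S ∩ Ico k 0 = insert k (S ∩ Ico (k + 1) 0) := by
      ext x; simp only [mem_inter_iff, mem_Ico, mem_insert_iff]
      constructor
      · rintro ⟨h1, h2, h3⟩
        rcases eq_or_ne x k with e | e
        · exact .inl e
        · exact .inr ⟨h1, by omega, by omega⟩
      · rintro (rfl | ⟨h1, h2, h3⟩)
        · exact ⟨hk, le_rfl, h⟩
        · exact ⟨h1, by omega, by omega⟩
    rw [e1, Set.ncard_insert_of_notMem (by simp) ((finite_Ico (k + 1) 0).inter_of_right S),
      Ico_eq_empty (a := 0) (by omega), Ico_eq_empty (a := 0) (by omega)]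
    simp

theorem signedCount_succ_of_notMem {k : ℤ} (hk : k ∉ S) :
    signedCount S (k + 1) = signedCount S k := by
  unfold signedCount
  have e1 : S ∩ Ico 0 (k + 1) = S ∩ Ico 0 k := by
    ext x; simp only [mem_inter_iff, mem_Ico]
    constructor
    · rintro ⟨h1, h2, h3⟩
      have : x ≠ k := by rintro rfl; exact hk h1
      exact ⟨h1, h2, by omega⟩
    · rintro ⟨h1, h2, h3⟩; exact ⟨h1, h2, by omega⟩
  have e2 : S ∩ Ico k 0 = S ∩ Ico (k + 1) 0 := by
    ext x; simp only [mem_inter_iff, mem_Ico]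
    constructor
    · rintro ⟨h1, h2, h3⟩
      have : x ≠ k := by rintro rfl; exact hk h1
      exact ⟨h1, by omega, by omega⟩
    · rintro ⟨h1, h2, h3⟩; exact ⟨h1, by omega, by omega⟩
  rw [e1, e2]

theorem signedCount_le_succ (k : ℤ) : signedCount S k ≤ signedCount S (k + 1) := by
  by_cases hk : k ∈ S
  · rw [signedCount_succ_of_mem S hk]; omega
  · rw [signedCount_succ_of_notMem S hk]

theorem signedCount_succ_le (k : ℤ) : signedCount S (k + 1) ≤ signedCount S k + 1 := by
  by_cases hk : k ∈ S
  · rw [signedCount_succ_of_mem S hk]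
  · rw [signedCount_succ_of_notMem S hk]; omega

theorem signedCount_mono : Monotone (signedCount S) :=
  monotone_int_of_le_succ (signedCount_le_succ S)

theorem signedCount_sub {k l : ℤ} (h : k ≤ l) :
    signedCount S l - signedCount S k = (S ∩ Ico k l).ncard := by
  induction l, h using Int.leInduction with
  | base => simp
  | succ l hl ih =>
    by_cases hk : l ∈ S
    · have e1 : S ∩ Ico k (l + 1) = insert l (S ∩ Ico k l) := by
        ext x; simp only [mem_inter_iff, mem_Ico, mem_insert_iff]
        constructor
        · rintro ⟨h1, h2, h3⟩
          rcases eq_or_ne x l with e | e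
          · exact .inl e
          · exact .inr ⟨h1, h2, by omega⟩
        · rintro (rfl | ⟨h1, h2, h3⟩)
          · exact ⟨hk, hl, by omega⟩
          · exact ⟨h1, h2, by omega⟩
      rw [e1, Set.ncard_insert_of_notMem (by simp) ((finite_Ico k l).inter_of_right S),
        signedCount_succ_of_mem S hk]
      push_cast; omega
    · have e1 : S ∩ Ico k (l + 1) = S ∩ Ico k l := by
        ext x; simp only [mem_inter_iff, mem_Ico]
        constructor
        · rintro ⟨h1, h2, h3⟩
          have : x ≠ l := by rintro rfl; exact hk h1
          exact ⟨h1, h2, by omega⟩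
        · rintro ⟨h1, h2, h3⟩; exact ⟨h1, h2, by omega⟩
      rw [e1, signedCount_succ_of_notMem S hk, ih]

theorem signedCount_eq_ncard {k : ℤ} (h : 0 ≤ k) : signedCount S k = (S ∩ Ico 0 k).ncard := by
  rw [← signedCount_sub S h]; simp

theorem signedCount_nonneg {k : ℤ} (h : 0 ≤ k) : 0 ≤ signedCount S k := by
  rw [signedCount_eq_ncard S h]; omega

theorem signedCount_le {k : ℤ} (h : 0 ≤ k) : signedCount S k ≤ k := by
  induction k, h using Int.leInduction with
  | base => simp
  | succ l hl ih => have := signedCount_succ_le S l; omega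

variable {S} in
theorem signedCount_add_period {n : ℤ} (hS : IsShiftInvariant n S) (k : ℤ) :
    signedCount S (k + n) = signedCount S k + signedCount S n := by
  refine int_funext (f := fun k => signedCount S (k + n))
    (g := fun k => signedCount S k + signedCount S n) (by simp) (fun k => ?_) k
  simp only [show k + 1 + n = (k + n) + 1 by ring]
  by_cases hk : k ∈ S
  · rw [signedCount_succ_of_mem S hk, signedCount_succ_of_mem S ((hS k).2 hk)]; ring
  · rw [signedCount_succ_of_notMem S hk, signedCount_succ_of_notMem S (mt (hS k).1 hk)]; ring

theorem signedCount_reflect_compl (k : ℤ) :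
    signedCount {x | -1 - x ∉ S} k = k + signedCount S (-k) := by
  refine int_funext (f := fun k => signedCount {x | -1 - x ∉ S} k)
    (g := fun k => k + signedCount S (-k)) (by simp) (fun k => ?_) k
  by_cases hk : -1 - k ∈ S
  · have h1 := signedCount_succ_of_mem S hk
    have h2 := signedCount_succ_of_notMem {x | -1 - x ∉ S} (k := k) (by simpa using hk)
    rw [show -1 - k + 1 = -k by ring, show -1 - k = -(k + 1) by ring] at h1
    simp only [h2, h1]; ring
  · have h1 := signedCount_succ_of_notMem S hk
    have h2 := signedCount_succ_of_mem {x | -1 - x ∉ S} (k := k) (by simpa using hk)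
    rw [show -1 - k + 1 = -k by ring, show -1 - k = -(k + 1) by ring] at h1
    simp only [h2, h1]; ring

end Count

/-! ### Periodic arc configurations and their reflection -/

/-- The sets `S` that are invariant under translation by `n`, with `q` elements per period. -/
structure IsPeriodicSet (n : ℤ) (q : ℕ) (S : Set ℤ) : Prop where
  shift : IsShiftInvariant n S
  count : signedCount S n = q

/-- The height function of the lattice path that rises by `c` at the elements of `S` and descends
by the increments of `k ↦ ⌊k m / n⌋`. -/
def height (c : ℕ) (n m : ℤ) (S : Set ℤ) (k : ℤ) : ℤ := c * signedCount S k - k * m / n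

/-- A noncrossing arc `(i, j, ℓ)` under the graph of `H`: at level `ℓ` it joins an ascent `i`
to the descent `j` at which this level is left again. -/
def IsArc (H : ℤ → ℤ) (τ : ℤ × ℤ × ℤ) : Prop :=
  τ.1 < τ.2.1 ∧ H τ.1 < τ.2.2 ∧ (∀ k, τ.1 < k → k ≤ τ.2.1 → τ.2.2 ≤ H k) ∧ H (τ.2.1 + 1) < τ.2.2

/-- The elements of `T` nested weakly under `τ`. -/
def arcsUnder (T : Set (ℤ × ℤ × ℤ)) (τ : ℤ × ℤ × ℤ) : Set (ℤ × ℤ × ℤ) :=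
  {σ ∈ T | τ.1 ≤ σ.1 ∧ σ.2.1 ≤ τ.2.1 ∧ τ.2.2 ≤ σ.2.2}

/-- Periodic arc configurations. -/
structure IsArcConfig (b c : ℕ) (n m : ℤ) (p q : ℕ) (x : Set ℤ × Set (ℤ × ℤ × ℤ)) : Prop where
  periodic : IsPeriodicSet n q x.1
  arc : ∀ τ ∈ x.2, IsArc (height c n m x.1) τ
  shift : IsShiftInvariant ((n, n, c * q - m) : ℤ × ℤ × ℤ) x.2
  sparse : ∀ τ ∈ x.2, (b * (arcsUnder x.2 τ).ncard : ℤ) ≤ τ.2.1 - τ.1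
  count : {τ ∈ x.2 | 0 ≤ τ.2.1 ∧ τ.2.1 < n}.ncard = p

/-- The number of periodic arc configurations. -/
def arcCount (b c : ℕ) (n m : ℤ) (p q : ℕ) : ℕ := {x | IsArcConfig b c n m p q x}.ncard

section Height

variable {c : ℕ} {n m : ℤ} {S : Set ℤ} {q : ℕ}

@[simp] theorem height_zero : height c n m S 0 = 0 := by simp [height]

theorem floor_add_period (hn : 0 < n) (k : ℤ) : (k + n) * m / n = k * m / n + m := by
  rw [add_mul, mul_comm n m, Int.add_mul_ediv_right _ _ hn.ne']

theorem height_add_period (hn : 0 < n) (hS : IsPeriodicSet n q S) (k : ℤ) :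
    height c n m S (k + n) = height c n m S k + (c * q - m) := by
  unfold height
  rw [signedCount_add_period hS.shift, hS.count, floor_add_period hn]
  ring

theorem height_add_mul_period (hn : 0 < n) (hS : IsPeriodicSet n q S) (k t : ℤ) :
    height c n m S (k + t * n) = height c n m S k + t * (c * q - m) := by
  have := map_add_zsmul (f := height c n m S) (fun k => height_add_period hn hS k) t k
  simpa using this

/-- Passing to the reflected complement adds ck to the rises, and replacing m by cn-m adds ck to the
floor. The two cancel exactly, so that only the direction of travel changes. -/
theorem height_reflect (hn : 0 < n) (k : ℤ) :
    height c n (c * n - m) {x | -1 - x ∉ S} k = height c n m S (-k) := by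
  unfold height
  rw [signedCount_reflect_compl, show k * (c * n - m) = -k * m + (k * c) * n by ring,
    Int.add_mul_ediv_right _ _ hn.ne']
  ring

theorem IsPeriodicSet.reflect (hn : 0 < n) (hS : IsPeriodicSet n q S) :
    q ≤ n.toNat ∧ IsPeriodicSet n (n.toNat - q) {x | -1 - x ∉ S} := by
  have h0 := signedCount_le S hn.le
  rw [hS.count] at h0
  have h1 := signedCount_add_period hS.shift (-n)
  rw [neg_add_cancel, signedCount_zero, hS.count] at h1
  refine ⟨by omega, fun k => ?_, ?_⟩
  · have := hS.shift (-1 - (k + n))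
    rw [show -1 - (k + n) + n = -1 - k by ring] at this
    simp only [mem_ofPred_eq, this]
  · rw [signedCount_reflect_compl]
    omega

/-- An arc of length at least n would contain both the translate of its left end, which makes the
drift cq-m per period positive, and the translate back of the point after its right end, which makes
it negative. -/
theorem IsArc.length_lt (hn : 0 < n) (hS : IsPeriodicSet n q S) {τ : ℤ × ℤ × ℤ}
    (h : IsArc (height c n m S) τ) : τ.2.1 < τ.1 + n := by
  obtain ⟨h1, h2, h3, h4⟩ := h
  by_contra hlt
  push Not at hlt
  have e1 := height_add_period (c := c) (m := m) hn hS τ.1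
  have e2 := height_add_period (c := c) (m := m) hn hS (τ.2.1 + 1 - n)
  rw [sub_add_cancel] at e2
  have := h3 (τ.1 + n) (by omega) hlt
  have := h3 (τ.2.1 + 1 - n) (by omega) (by omega)
  omega

end Height

/-- The reflection of arcs that comes from reversing the lattice path. -/
def reflectArc (τ : ℤ × ℤ × ℤ) : ℤ × ℤ × ℤ := (-1 - τ.2.1, -1 - τ.1, τ.2.2)

theorem reflectArc_involutive : Function.Involutive reflectArc := fun τ => by
  simp [reflectArc]

/-- The reflection of arc configurations. -/
def reflectConfig (x : Set ℤ × Set (ℤ × ℤ × ℤ)) : Set ℤ × Set (ℤ × ℤ × ℤ) :=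
  ({k | -1 - k ∉ x.1}, {τ | reflectArc τ ∈ x.2})

theorem reflectConfig_involutive : Function.Involutive reflectConfig := fun x => by
  ext τ
  · simp [reflectConfig]
  · simp [reflectConfig, reflectArc_involutive τ]

section

variable {b c : ℕ} {n m : ℤ} {p q : ℕ}

theorem isArc_reflect (hn : 0 < n) {S : Set ℤ} {τ : ℤ × ℤ × ℤ}
    (h : IsArc (height c n m S) (reflectArc τ)) :
    IsArc (height c n (c * n - m) {x | -1 - x ∉ S}) τ := by
  obtain ⟨h1, h2, h3, h4⟩ := h
  simp only [reflectArc] at h1 h2 h3 h4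
  refine ⟨by omega, ?_, fun k hk1 hk2 => ?_, ?_⟩
  · rw [height_reflect hn, show -τ.1 = -1 - τ.1 + 1 by ring]; exact h4
  · rw [height_reflect hn]; exact h3 _ (by omega) (by omega)
  · rw [height_reflect hn, show -(τ.2.1 + 1) = -1 - τ.2.1 by ring]; exact h2

theorem arcsUnder_reflect (T : Set (ℤ × ℤ × ℤ)) (τ : ℤ × ℤ × ℤ) :
    (arcsUnder {σ | reflectArc σ ∈ T} τ).ncard = (arcsUnder T (reflectArc τ)).ncard := by
  rw [← Set.ncard_image_of_injective _ reflectArc_involutive.injective]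
  congr 1
  ext σ
  rw [reflectArc_involutive.image_eq_preimage_symm]
  simp only [arcsUnder, mem_preimage, mem_ofPred_eq, reflectArc_involutive σ]
  simp only [reflectArc]
  constructor <;> rintro ⟨h1, h2, h3, h4⟩ <;> exact ⟨h1, by omega, by omega, by omega⟩

theorem IsArcConfig.reflect (hn : 0 < n) {x : Set ℤ × Set (ℤ × ℤ × ℤ)}
    (hx : IsArcConfig b c n m p q x) :
    IsArcConfig b c n (c * n - m) p (n.toNat - q) (reflectConfig x) := by
  obtain ⟨hq, hS⟩ := hx.periodic.reflect hn
  refine ⟨hS, fun τ hτ => isArc_reflect hn (hx.arc _ hτ), fun τ => ?_, fun τ hτ => ?_, ?_⟩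
  · have := hx.shift (reflectArc (τ + (n, n, c * ((n.toNat - q : ℕ) : ℤ) - (c * n - m))))
    simp only [reflectConfig, mem_ofPred_eq]
    rw [← this]
    have e : ((n.toNat - q : ℕ) : ℤ) = n - q := by omega
    rw [e]
    apply iff_of_eq
    congr 1
    obtain ⟨i, j, l⟩ := τ
    simp only [reflectArc, Prod.mk_add_mk, Prod.mk.injEq]
    refine ⟨by ring, by ring, by ring⟩
  · have := hx.sparse _ hτ
    rw [← arcsUnder_reflect] at this
    have e : (reflectArc τ).2.1 - (reflectArc τ).1 = τ.2.1 - τ.1 := by simp only [reflectArc]; ring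
    rw [e] at this
    exact this
  -- Reflection exchanges the ends of an arc, so the count by right ends must first be turned into a
  -- count by left ends. The shift by n makes the two windows correspond under x ↦ -1-x.
  · have hw := ncard_window_eq hx.shift (f := fun τ => τ.2.1) (g := fun τ => τ.1 + n) hn hn
      (fun τ => by simp) (fun τ => by simp)
    rw [hx.count] at hw
    rw [hw, ← Set.ncard_image_of_injective _ reflectArc_involutive.injective]
    congr 1
    ext σ
    rw [reflectArc_involutive.image_eq_preimage_symm]
    simp only [reflectConfig, mem_preimage, mem_ofPred_eq, reflectArc_involutive σ]
    simp only [reflectArc]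
    constructor <;> rintro ⟨h1, h2, h3⟩ <;> exact ⟨h1, by omega, by omega⟩

/-- The combinatorial source of mutation invariance: the arcs, and the nesting of arcs, are the same
whichever way the path is read. -/
theorem arcCount_reflect (hn : 0 < n) (hq : q ≤ n.toNat) :
    arcCount b c n m p q = arcCount b c n (c * n - m) p (n.toNat - q) := by
  refine Set.ncard_congr (fun x _ => reflectConfig x) (fun x hx => hx.reflect hn)
    (fun x y _ _ h => reflectConfig_involutive.injective h) (fun y hy => ?_)
  refine ⟨reflectConfig y, ?_, reflectConfig_involutive y⟩
  have := IsArcConfig.reflect hn hy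
  rwa [sub_sub_cancel, Nat.sub_sub_self hq] at this

theorem arcCount_eq_zero (hn : 0 < n) (hq : n.toNat < q) : arcCount b c n m p q = 0 := by
  have : {x | IsArcConfig b c n m p q x} = ∅ := by
    ext x
    simp only [mem_ofPred_eq, mem_empty_iff_false, iff_false]
    intro hx
    have := (hx.periodic.reflect hn).1
    omega
  rw [arcCount, this, ncard_empty]

/-- Two sets invariant under the same shift agree if they agree on a fundamental domain. -/
theorem IsShiftInvariant.eq_of_window {V : Type*} [AddCommGroup V] {v : V} {X Y : Set V}
    (hX : IsShiftInvariant v X) (hY : IsShiftInvariant v Y) {f : V → ℤ} {n : ℤ} (hn : 0 < n)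
    (hf : ∀ x, f (x + v) = f x + n) (h : ∀ x, 0 ≤ f x → f x < n → (x ∈ X ↔ x ∈ Y)) : X = Y := by
  ext x
  have h1 := Int.emod_nonneg (f x) hn.ne'
  have h2 := Int.emod_lt_of_pos (f x) hn
  have h3 := Int.mul_ediv_add_emod (f x) n
  rw [← hX.zsmul (-(f x / n)), ← hY.zsmul (-(f x / n))]
  apply h <;> rw [map_add_zsmul hf] <;> nlinarith

theorem abs_height_le (hn : 0 < n) (S : Set ℤ) {k : ℤ} (h0 : 0 ≤ k) (hk : k ≤ n) :
    |height c n m S k| ≤ c * n + |m| + 1 := by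
  have h1 := signedCount_nonneg S h0
  have h2 := signedCount_le S h0
  have h3 : (c : ℤ) * signedCount S k ≤ c * n := by gcongr; omega
  have h4 : 0 ≤ (c : ℤ) * signedCount S k := by positivity
  have h5 : k * m / n ≤ |m| := by
    apply Int.ediv_le_of_le_mul hn
    have := le_abs_self m
    have := abs_nonneg m
    nlinarith
  have h6 : -|m| ≤ k * m / n := by
    rw [Int.le_ediv_iff_mul_le hn]
    have := neg_abs_le m
    have := abs_nonneg m
    nlinarith
  unfold height
  rw [abs_le]
  constructor <;> linarith

theorem finite_arcs_window (hn : 0 < n) {S : Set ℤ} (hS : IsPeriodicSet n q S) :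
    {τ | IsArc (height c n m S) τ ∧ 0 ≤ τ.1 ∧ τ.1 < n} ⊆
      Icc 0 n ×ˢ Icc 0 (2 * n) ×ˢ Icc (-(c * n + |m| + 1)) (c * n + |m| + 1) := by
  rintro ⟨i, j, l⟩ ⟨h, h0, h1⟩
  have h2 := h.length_lt hn hS
  obtain ⟨h3, h4, h5, h6⟩ := h
  dsimp only at *
  have h7 := abs_le.1 (abs_height_le (c := c) (m := m) hn S h0 h1.le)
  have h8 := abs_le.1 (abs_height_le (c := c) (m := m) hn S (k := i + 1) (by omega) (by omega))
  have h9 := h5 (i + 1) (by omega) (by omega)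
  simp only [mem_prod, mem_Icc]
  omega

/-- A configuration is determined by what starts in one period, and there the ends and levels of
arcs are bounded. -/
theorem finite_arcConfig (hn : 0 < n) : {x | IsArcConfig b c n m p q x}.Finite := by
  set B : Set (ℤ × ℤ × ℤ) :=
    Icc 0 n ×ˢ Icc 0 (2 * n) ×ˢ Icc (-(c * n + |m| + 1)) (c * n + |m| + 1)
  have hB : B.Finite := (finite_Icc _ _).prod ((finite_Icc _ _).prod (finite_Icc _ _))
  refine Set.Finite.of_finite_image (f := fun x : Set ℤ × Set (ℤ × ℤ × ℤ) =>
      (x.1 ∩ Ico 0 n, x.2 ∩ {τ | 0 ≤ τ.1 ∧ τ.1 < n}))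
    (Set.Finite.subset ((finite_Ico 0 n).finite_subsets.prod hB.finite_subsets) ?_) ?_
  · rintro _ ⟨x, hx, rfl⟩
    refine ⟨inter_subset_right, fun τ hτ => ?_⟩
    exact finite_arcs_window hn hx.periodic ⟨hx.arc _ hτ.1, hτ.2⟩
  · intro x hx y hy h
    simp only [Prod.mk.injEq] at h
    have e1 : x.1 = y.1 := hx.periodic.shift.eq_of_window hy.periodic.shift (f := id) hn
      (fun _ => rfl) (fun k h0 h1 => by
        have hk : k ∈ Ico 0 n := ⟨h0, h1⟩
        simpa only [mem_inter_iff, hk, and_true] using Set.ext_iff.1 h.1 k)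
    have e2 : x.2 = y.2 := hx.shift.eq_of_window hy.shift (f := fun τ => τ.1) hn
      (fun _ => rfl) (fun τ h0 h1 => by
        have := Set.ext_iff.1 h.2 τ
        simpa [h0, h1] using this)
    exact Prod.ext e1 e2

theorem ncard_periodicSet (hn : 0 < n) (q : ℕ) :
    {S | IsPeriodicSet n q S}.ncard = n.toNat.choose q := by
  have : ((Finset.Ico 0 n).powersetCard q).card = n.toNat.choose q := by
    rw [Finset.card_powersetCard, Int.card_Ico, sub_zero]
  rw [← this, ← Set.ncard_coe_finset]
  have hmod : ∀ k : ℤ, 0 ≤ k → k < n → k % n = k := fun k => Int.emod_eq_of_lt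
  symm
  refine Set.ncard_congr (fun s _ => {k : ℤ | k % n ∈ s}) ?_ ?_ ?_
  · intro s hs
    rw [Finset.mem_coe, Finset.mem_powersetCard] at hs
    refine ⟨fun k => by simp, ?_⟩
    rw [signedCount_eq_ncard _ hn.le, ← hs.2, ← Set.ncard_coe_finset]
    congr 2
    ext k
    simp only [mem_inter_iff, mem_ofPred_eq, mem_Ico, Finset.mem_coe]
    constructor
    · rintro ⟨h1, h2, h3⟩; rwa [hmod k h2 h3] at h1
    · intro h1
      have h2 := Finset.mem_Ico.1 (hs.1 h1)
      exact ⟨by rwa [hmod k h2.1 h2.2], h2⟩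
  · intro s t hs ht h
    rw [Finset.mem_coe, Finset.mem_powersetCard] at hs ht
    ext k
    have hk := Set.ext_iff.1 h k
    simp only [mem_ofPred_eq] at hk
    constructor
    · intro h1
      have h2 := Finset.mem_Ico.1 (hs.1 h1)
      rw [hmod k h2.1 h2.2] at hk
      exact hk.1 h1
    · intro h1
      have h2 := Finset.mem_Ico.1 (ht.1 h1)
      rw [hmod k h2.1 h2.2] at hk
      exact hk.2 h1
  · intro S hS
    have hfin : (S ∩ Ico 0 n).Finite := (finite_Ico 0 n).inter_of_right S
    refine ⟨hfin.toFinset, ?_, ?_⟩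
    · rw [Finset.mem_coe, Finset.mem_powersetCard]
      refine ⟨fun k hk => ?_, ?_⟩
      · rw [Set.Finite.mem_toFinset] at hk
        exact Finset.mem_Ico.2 hk.2
      · have := hS.count
        rw [signedCount_eq_ncard _ hn.le] at this
        rw [← Set.ncard_eq_toFinset_card _ hfin]
        exact_mod_cast this
    · ext k
      simp only [Set.Finite.mem_toFinset, mem_ofPred_eq, mem_inter_iff, mem_Ico]
      have h := hS.shift.zsmul (k / n) (k % n)
      rw [show k % n + (k / n) • n = k by
        rw [smul_eq_mul, mul_comm]; exact Int.emod_add_mul_ediv k n] at h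
      rw [h]
      exact and_iff_left ⟨Int.emod_nonneg _ hn.ne', Int.emod_lt_of_pos _ hn⟩

theorem isArcConfig_empty {S : Set ℤ} (hS : IsPeriodicSet n q S) :
    IsArcConfig b c n m 0 q (S, ∅) :=
  ⟨hS, by simp, fun τ => by simp, by simp, by simp⟩

theorem IsArcConfig.eq_empty (hn : 0 < n) {x : Set ℤ × Set (ℤ × ℤ × ℤ)}
    (hx : IsArcConfig b c n m 0 q x) : x.2 = ∅ := by
  have hw := ncard_window_eq hx.shift (f := fun τ => τ.2.1) (g := fun τ => τ.1) hn hn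
      (fun τ => by simp) (fun τ => by simp)
  rw [hx.count] at hw
  have hfin : {τ ∈ x.2 | 0 ≤ τ.1 ∧ τ.1 < n}.Finite :=
    Set.Finite.subset ((finite_Icc _ _).prod ((finite_Icc _ _).prod (finite_Icc _ _)))
      (fun τ hτ => finite_arcs_window hn hx.periodic ⟨hx.arc _ hτ.1, hτ.2⟩)
  have h0 := (Set.ncard_eq_zero hfin).1 hw.symm
  refine hx.shift.eq_of_window (fun τ => by simp) (f := fun τ => τ.1) hn (fun τ => by simp)
    (fun τ h1 h2 => ?_)
  have := Set.ext_iff.1 h0 τ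
  simpa [h1, h2] using this

theorem arcCount_zero (hn : 0 < n) : arcCount b c n m 0 q = n.toNat.choose q := by
  rw [← ncard_periodicSet hn q]
  refine Set.ncard_congr (fun x _ => x.1) (fun x hx => hx.periodic) (fun x y hx hy h => ?_)
    (fun S hS => ⟨(S, ∅), isArcConfig_empty hS, rfl⟩)
  exact Prod.ext h (by rw [hx.eq_empty hn, hy.eq_empty hn])

/-- For m ≤ 0 the height never decreases, so no level that was reached is left again and there are
no arcs. -/
theorem arcCount_of_nonpos (hn : 0 < n) (hm : m ≤ 0) (hp : p ≠ 0) :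
    arcCount b c n m p q = 0 := by
  have : {x | IsArcConfig b c n m p q x} = ∅ := by
    ext x
    simp only [mem_ofPred_eq, mem_empty_iff_false, iff_false]
    intro hx
    have h0 : x.2 = ∅ := by
      ext τ
      simp only [mem_empty_iff_false, iff_false]
      intro hτ
      obtain ⟨h1, h2, h3, h4⟩ := hx.arc τ hτ
      have h5 := h3 τ.2.1 h1 le_rfl
      have h6 := signedCount_le_succ x.1 τ.2.1
      have h7 : (τ.2.1 + 1) * m / n ≤ τ.2.1 * m / n :=
        Int.ediv_le_ediv hn (by nlinarith)
      unfold height at h4 h5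
      nlinarith
    have := hx.count
    simp [h0] at this
    omega
  rw [arcCount, this, ncard_empty]

end

/-! ### Compatible pairs and sparsity -/

/-- In the lattice path of slope `m / n`, the vertical steps after the horizontal step `k` are
those with index at least `stair n m k`. -/
def stair (n m k : ℤ) : ℤ := k * m / n

/-- The last horizontal step before the vertical step `l`. -/
def column (n m l : ℤ) : ℤ := ((l + 1) * n - 1) / m

/-- The vertical step `l` lies in the shadow of the horizontal step `k`. -/
def InVerticalShadow (c : ℕ) (n m : ℤ) (S : Set ℤ) (k l : ℤ) : Prop :=
  ∀ l', stair n m k ≤ l' → l' < l → l' + 1 - stair n m k < c * (S ∩ Icc k (column n m l')).ncard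

/-- The horizontal step `k` lies in the shadow of the vertical step `l`. -/
def InHorizontalShadow (b : ℕ) (n m : ℤ) (S : Set ℤ) (k l : ℤ) : Prop :=
  ∀ k', k < k' → k' ≤ column n m l → column n m l + 1 - k' < b * (S ∩ Icc (stair n m k') l).ncard

/-- Periodic compatible pairs in the lattice path of slope `m / n`. -/
structure IsCompatiblePair (b c : ℕ) (n m : ℤ) (p q : ℕ) (x : Set ℤ × Set ℤ) : Prop where
  horizontal : IsPeriodicSet n q x.1
  vertical : IsPeriodicSet m p x.2
  compatible : ∀ k ∈ x.1, ∀ l ∈ x.2, k ≤ column n m l →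
    ¬ (InVerticalShadow c n m x.1 k l ∧ InHorizontalShadow b n m x.2 k l)

/-- The number of periodic compatible pairs. -/
def pairCount (b c : ℕ) (n m : ℤ) (p q : ℕ) : ℕ := {x | IsCompatiblePair b c n m p q x}.ncard

/-- The image of a set under `k ↦ -1 - k`. -/
def reflectSet (S : Set ℤ) : Set ℤ := {k | -1 - k ∈ S}

theorem reflectSet_involutive : Function.Involutive reflectSet := fun S => by
  ext k; simp [reflectSet]

theorem signedCount_reflectSet (S : Set ℤ) (k : ℤ) :
    signedCount (reflectSet S) k = -signedCount S (-k) := by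
  refine int_funext (f := signedCount (reflectSet S)) (g := fun k => -signedCount S (-k))
    (by simp) (fun k => ?_) k
  by_cases hk : -1 - k ∈ S
  · have h1 := signedCount_succ_of_mem S hk
    have h2 := signedCount_succ_of_mem (reflectSet S) (k := k) hk
    rw [show -1 - k + 1 = -k by ring, show -1 - k = -(k + 1) by ring] at h1
    simp only [h2, h1]; ring
  · have h1 := signedCount_succ_of_notMem S hk
    have h2 := signedCount_succ_of_notMem (reflectSet S) (k := k) hk
    rw [show -1 - k + 1 = -k by ring, show -1 - k = -(k + 1) by ring] at h1
    simp only [h2, h1]; ring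

theorem ncard_reflectSet_inter_Icc (S : Set ℤ) (k l : ℤ) :
    (reflectSet S ∩ Icc k l).ncard = (S ∩ Icc (-1 - l) (-1 - k)).ncard := by
  have hinv : Function.Involutive (fun x : ℤ => -1 - x) := fun x => by ring
  rw [← Set.ncard_image_of_injective _ hinv.injective]
  congr 1
  ext x
  rw [hinv.image_eq_preimage_symm]
  simp only [reflectSet, mem_preimage, mem_inter_iff, mem_ofPred_eq, mem_Icc, sub_sub_cancel]
  constructor <;> rintro ⟨h1, h2, h3⟩ <;> exact ⟨h1, by omega, by omega⟩

section

variable {b c : ℕ} {n m : ℤ} {p q : ℕ}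

theorem IsPeriodicSet.reflectSet {S : Set ℤ} (hS : IsPeriodicSet n q S) :
    IsPeriodicSet n q (reflectSet S) := by
  refine ⟨fun k => ?_, ?_⟩
  · have := hS.shift (-1 - (k + n))
    rw [show -1 - (k + n) + n = -1 - k by ring] at this
    exact this.symm
  · have h1 := signedCount_add_period hS.shift (-n)
    rw [neg_add_cancel, signedCount_zero, hS.count] at h1
    rw [signedCount_reflectSet]
    omega

/-- A Galois connection: both sides say that the horizontal step k comes before the vertical step l
on the path. -/
theorem le_column_iff (hn : 0 < n) (hm : 0 < m) {k l : ℤ} :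
    k ≤ column n m l ↔ stair n m k ≤ l := by
  rw [column, Int.le_ediv_iff_mul_le hm, stair, ← Int.lt_add_one_iff (b := l),
    Int.ediv_lt_iff_lt_mul hn]
  omega

theorem column_lt_iff (hn : 0 < n) (hm : 0 < m) {k l : ℤ} :
    column n m l < k ↔ l < stair n m k := by
  rw [← not_le, le_column_iff hn hm, not_le]

theorem stair_mono (hn : 0 < n) (hm : 0 < m) : Monotone (stair n m) := fun k l h =>
  Int.ediv_le_ediv hn (by nlinarith)

theorem column_mono (hn : 0 < n) (hm : 0 < m) : Monotone (column n m) := fun k l h =>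
  Int.ediv_le_ediv hm (by nlinarith)

theorem stair_column_le (hn : 0 < n) (hm : 0 < m) (l : ℤ) : stair n m (column n m l) ≤ l :=
  (le_column_iff hn hm).1 le_rfl

theorem lt_stair_column_succ (hn : 0 < n) (hm : 0 < m) (l : ℤ) :
    l < stair n m (column n m l + 1) :=
  (column_lt_iff hn hm).1 (by omega)

theorem stair_add_period (hn : 0 < n) (k : ℤ) : stair n m (k + n) = stair n m k + m :=
  floor_add_period hn k

theorem column_add_period (hm : 0 < m) (l : ℤ) : column n m (l + m) = column n m l + n := by
  unfold column
  rw [show (l + m + 1) * n - 1 = (l + 1) * n - 1 + n * m by ring,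
    Int.add_mul_ediv_right _ _ hm.ne']

/-- Reversing the path by x ↦ -1-x on both axes and transposing it turns slope m/n into n/m. -/
theorem column_reflect (hn : 0 < n) (hm : 0 < m) (k : ℤ) :
    column m n (-1 - k) = -1 - stair n m k := by
  apply le_antisymm
  · rw [← Int.lt_add_one_iff, column_lt_iff hm hn, stair, Int.lt_iff_add_one_le,
      Int.le_ediv_iff_mul_le hm]
    have := Int.mul_ediv_add_emod (k * m) n
    have := Int.emod_nonneg (k * m) hn.ne'
    unfold stair
    nlinarith
  · rw [le_column_iff hm hn, stair, ← Int.lt_add_one_iff, Int.ediv_lt_iff_lt_mul hm]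
    have := Int.mul_ediv_add_emod (k * m) n
    have := Int.emod_lt_of_pos (k * m) hn
    unfold stair
    nlinarith

theorem stair_reflect (hn : 0 < n) (hm : 0 < m) (l : ℤ) :
    stair m n (-1 - l) = -1 - column n m l := by
  have := column_reflect hm hn (-1 - l)
  rw [sub_sub_cancel] at this
  omega

theorem IsCompatiblePair.reflect (hn : 0 < n) (hm : 0 < m) {x : Set ℤ × Set ℤ}
    (hx : IsCompatiblePair b c n m p q x) :
    IsCompatiblePair c b m n q p (reflectSet x.2, reflectSet x.1) := by
  refine ⟨hx.vertical.reflectSet, hx.horizontal.reflectSet, fun k hk l hl hkl h => ?_⟩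
  obtain ⟨h1, h2⟩ := h
  refine hx.compatible (-1 - l) hl (-1 - k) hk ?_ ⟨fun l' hl1 hl2 => ?_, fun k' hk1 hk2 => ?_⟩
  · rw [column_reflect hm hn]
    rw [le_column_iff hm hn] at hkl
    omega
  · rw [stair_reflect hm hn] at hl1 ⊢
    have := h2 (-1 - l') (by omega) (by omega)
    rw [stair_reflect hn hm, ncard_reflectSet_inter_Icc] at this
    rw [show -1 - (-1 - column n m l') = column n m l' by ring] at this
    omega
  · rw [column_reflect hm hn] at hk2 ⊢
    have := h1 (-1 - k') (by omega) (by omega)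
    rw [column_reflect hn hm, ncard_reflectSet_inter_Icc] at this
    rw [show -1 - (-1 - stair n m k') = stair n m k' by ring] at this
    omega

/-- Reversal and transposition exchange the two kinds of shadow, and compatibility is symmetric in
them. This symmetry is invisible in the description by arcs. -/
theorem pairCount_swap (hn : 0 < n) (hm : 0 < m) :
    pairCount b c n m p q = pairCount c b m n q p := by
  refine Set.ncard_congr (fun x _ => (reflectSet x.2, reflectSet x.1))
    (fun x hx => hx.reflect hn hm) (fun x y _ _ h => ?_) (fun y hy => ?_)
  · simp only [Prod.mk.injEq] at h
    exact Prod.ext (reflectSet_involutive.injective h.2) (reflectSet_involutive.injective h.1)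
  · refine ⟨_, IsCompatiblePair.reflect hm hn hy, ?_⟩
    simp [reflectSet_involutive y.1, reflectSet_involutive y.2]

/-- The level from which the vertical step `l` descends. -/
def stepLevel (c : ℕ) (n m : ℤ) (S : Set ℤ) (l : ℤ) : ℤ :=
  c * signedCount S (column n m l + 1) - l

/-- The horizontal step `i` is matched with the vertical step `l`. -/
def IsMatched (c : ℕ) (n m : ℤ) (S : Set ℤ) (i l : ℤ) : Prop :=
  i ≤ column n m l ∧ height c n m S i < stepLevel c n m S l ∧
    ∀ k, i < k → k ≤ column n m l → stepLevel c n m S l ≤ height c n m S k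

theorem height_eq (S : Set ℤ) (k : ℤ) :
    height c n m S k = c * signedCount S k - stair n m k := rfl

theorem ncard_inter_Icc (S : Set ℤ) {k l : ℤ} (h : k ≤ l + 1) :
    ((S ∩ Icc k l).ncard : ℤ) = signedCount S (l + 1) - signedCount S k := by
  rw [signedCount_sub S h]
  congr 3
  ext x; simp only [mem_Icc, mem_Ico]; omega

variable {S : Set ℤ}

theorem exists_isMatched {i l : ℤ} (h : i ≤ column n m l)
    (hi : height c n m S i < stepLevel c n m S l) : ∃ i, IsMatched c n m S i l := by
  obtain ⟨i, ⟨h1, h2⟩, h3⟩ := Int.exists_greatest_of_bdd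
    (P := fun i => i ≤ column n m l ∧ height c n m S i < stepLevel c n m S l)
    ⟨_, fun z hz => hz.1⟩ ⟨i, h, hi⟩
  refine ⟨i, h1, h2, fun k hk1 hk2 => ?_⟩
  by_contra hk
  have := h3 k ⟨hk2, not_le.1 hk⟩
  omega

theorem IsMatched.le {i l k : ℤ} (hi : IsMatched c n m S i l) (h : k ≤ column n m l)
    (hk : height c n m S k < stepLevel c n m S l) : k ≤ i := by
  by_contra hik
  have := hi.2.2 k (not_le.1 hik) h
  omega

theorem IsMatched.unique {i i' l : ℤ} (hi : IsMatched c n m S i l)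
    (hi' : IsMatched c n m S i' l) : i = i' :=
  le_antisymm (hi'.le hi.1 hi.2.1) (hi.le hi'.1 hi'.2.1)

theorem height_succ_lt_stepLevel (hn : 0 < n) (hm : 0 < m) (l : ℤ) :
    height c n m S (column n m l + 1) < stepLevel c n m S l := by
  have h1 := lt_stair_column_succ hn hm l
  rw [height_eq, stepLevel]
  omega

theorem IsMatched.mem (hn : 0 < n) (hm : 0 < m) {i l : ℤ} (hi : IsMatched c n m S i l) :
    i ∈ S := by
  by_contra h
  obtain ⟨h1, h2, h3⟩ := hi
  have h4 := signedCount_succ_of_notMem S h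
  rcases h1.eq_or_lt with e | h5
  · have := stair_column_le hn hm l
    rw [height_eq, stepLevel, ← e, h4] at h2
    rw [← e] at this
    omega
  · have h6 := h3 (i + 1) (by omega) (by omega)
    have := stair_mono hn hm (show i ≤ i + 1 by omega)
    rw [height_eq] at h2 h6
    rw [h4] at h6
    omega

/-- The shadow condition counts vertical steps against c times the chosen horizontal steps, that is,
it compares heights. It has to be tested only where the path turns from vertical to horizontal, and
at l itself. -/
theorem inVerticalShadow_iff (hn : 0 < n) (hm : 0 < m) (hc : 0 < c) {k l : ℤ} (hk : k ∈ S)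
    (hkl : k ≤ column n m l) :
    InVerticalShadow c n m S k l ↔ height c n m S k < stepLevel c n m S l ∧
      ∀ i, k < i → i ≤ column n m l → height c n m S k < height c n m S i := by
  have hk1 := signedCount_succ_of_mem S hk
  have hkl' := (le_column_iff hn hm).1 hkl
  have hc' : (1 : ℤ) ≤ c := by exact_mod_cast hc
  constructor
  · intro h
    constructor
    · rw [height_eq, stepLevel]
      rcases hkl'.eq_or_lt with e | h1
      · have := signedCount_mono S (show k + 1 ≤ column n m l + 1 by omega)
        nlinarith
      · have h2 := h (l - 1) (by omega) (by omega)
        have h3 := (le_column_iff hn hm (k := k) (l := l - 1)).2 (by omega)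
        rw [ncard_inter_Icc S (by omega)] at h2
        have := signedCount_mono S
          (show column n m (l - 1) + 1 ≤ column n m l + 1 by
            have := column_mono hn hm (show l - 1 ≤ l by omega); omega)
        nlinarith
    · intro i hi1 hi2
      rw [height_eq, height_eq]
      have hmon := stair_mono hn hm hi1.le
      have hil := (le_column_iff hn hm).1 hi2
      rcases hmon.eq_or_lt with e | h1
      · have := signedCount_mono S (show k + 1 ≤ i by omega)
        nlinarith
      · have h2 := h (stair n m i - 1) (by omega) (by omega)
        have h3 := (le_column_iff hn hm (k := k) (l := stair n m i - 1)).2 (by omega)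
        have h4 := (column_lt_iff hn hm (k := i) (l := stair n m i - 1)).2 (by omega)
        rw [ncard_inter_Icc S (by omega)] at h2
        have := signedCount_mono S (show column n m (stair n m i - 1) + 1 ≤ i by omega)
        nlinarith
  · rintro ⟨h1, h2⟩ l' hl1 hl2
    have h3 := (le_column_iff hn hm).2 hl1
    rw [ncard_inter_Icc S (by omega), mul_sub]
    rcases (column_mono hn hm hl2.le).eq_or_lt with e | h4
    · rw [height_eq, stepLevel] at h1
      rw [e]
      omega
    · have h5 := h2 (column n m l' + 1) (by omega) (by omega)
      have := lt_stair_column_succ hn hm l'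
      rw [height_eq, height_eq] at h5
      omega

/-- Sparsity of a set of vertical steps, in terms of the matched ones. -/
def IsSparse (b c : ℕ) (n m : ℤ) (S S' : Set ℤ) : Prop :=
  ∀ l ∈ S', ∀ i, IsMatched c n m S i l →
    (b * (S' ∩ Icc (stair n m i) l).ncard : ℤ) ≤ column n m l - i

theorem InHorizontalShadow.mono {S' : Set ℤ} {k k' l : ℤ} (h : InHorizontalShadow b n m S' k l)
    (hk : k ≤ k') : InHorizontalShadow b n m S' k' l :=
  fun k'' h1 h2 => h k'' (by omega) h2

/-- Among the horizontal steps that have l in their shadow, the matched one is the last, and a later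
step lies more easily in the shadow of l. So the matched step is the only one that has to be tested.
-/
theorem compatible_iff (hn : 0 < n) (hm : 0 < m) (hc : 0 < c) {S' : Set ℤ} :
    (∀ k ∈ S, ∀ l ∈ S', k ≤ column n m l →
      ¬ (InVerticalShadow c n m S k l ∧ InHorizontalShadow b n m S' k l)) ↔
    ∀ l ∈ S', ∀ i, IsMatched c n m S i l → ¬ InHorizontalShadow b n m S' i l := by
  constructor
  · intro h l hl i hi h2
    refine h i (hi.mem hn hm) l hl hi.1 ⟨?_, h2⟩
    rw [inVerticalShadow_iff hn hm hc (hi.mem hn hm) hi.1]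
    exact ⟨hi.2.1, fun k hk1 hk2 => hi.2.1.trans_le (hi.2.2 k hk1 hk2)⟩
  · rintro h k hk l hl hkl ⟨h1, h2⟩
    rw [inVerticalShadow_iff hn hm hc hk hkl] at h1
    obtain ⟨i, hi⟩ := exists_isMatched hkl h1.1
    exact h l hl i hi (h2.mono (hi.le hkl h1.1))

theorem stepLevel_lt_of_lt (hn : 0 < n) (hm : 0 < m) {i l l' : ℤ} (hi : IsMatched c n m S i l)
    (h1 : stair n m i ≤ l') (h2 : l' < l) : stepLevel c n m S l < stepLevel c n m S l' := by
  have h3 := (le_column_iff hn hm).2 h1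
  rcases (column_mono hn hm h2.le).eq_or_lt with e | h4
  · rw [stepLevel, stepLevel, e]; omega
  · have := hi.2.2 (column n m l' + 1) (by omega) (by omega)
    exact this.trans_lt (height_succ_lt_stepLevel hn hm l')

/-- Vertical steps under an arc descend from levels above that of the arc, while its left end lies
below; hence they are matched inside the arc. -/
theorem IsMatched.exists_nested (hn : 0 < n) (hm : 0 < m) {i l l' : ℤ}
    (hi : IsMatched c n m S i l) (h1 : stair n m i ≤ l') (h2 : l' ≤ l) :
    ∃ i', i ≤ i' ∧ IsMatched c n m S i' l' := by
  rcases h2.eq_or_lt with rfl | h2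
  · exact ⟨i, le_rfl, hi⟩
  have h3 := (le_column_iff hn hm).2 h1
  have h4 := hi.2.1.trans (stepLevel_lt_of_lt hn hm hi h1 h2)
  obtain ⟨i', hi'⟩ := exists_isMatched h3 h4
  exact ⟨i', hi'.le h3 h4, hi'⟩

/-- Local bounds add up: the last element of G accounts for a block reaching back to its i, and the
remaining elements come before that block, so that the differences of Φ telescope. Apart from the
identity, Φ will be a multiple of the counting function of the rises. -/
theorem ncard_inter_Ico_le_of_sparse (hn : 0 < n) (hm : 0 < m) {G : Set ℤ} {κ u : ℤ}
    {Φ : ℤ → ℤ} (hΦ : Monotone Φ)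
    (h : ∀ l ∈ G, ∃ i, u ≤ i ∧ i ≤ column n m l ∧
      κ * (G ∩ Icc (stair n m i) l).ncard ≤ Φ (column n m l) - Φ i) (x : ℤ) :
    κ * (G ∩ Ico (stair n m u) x).ncard ≤ Φ (max u (column n m (x - 1))) - Φ u := by
  rcases le_or_gt x (stair n m u) with hx | hx
  · rw [Ico_eq_empty (by omega)]
    simpa using hΦ (le_max_left _ _)
  obtain ⟨d, hd⟩ : ∃ d : ℕ, x - stair n m u = d := ⟨(x - stair n m u).toNat, by omega⟩
  induction d using Nat.strong_induction_on generalizing x with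
  | _ d ih =>
    have hprev : ∀ y, y < x →
        κ * (G ∩ Ico (stair n m u) y).ncard ≤ Φ (max u (column n m (y - 1))) - Φ u := by
      intro y hy
      rcases le_or_gt y (stair n m u) with hy' | hy'
      · rw [Ico_eq_empty (by omega)]
        simpa using hΦ (le_max_left _ _)
      · exact ih (y - stair n m u).toNat (by omega) y hy' (by omega)
    by_cases hl : x - 1 ∈ G
    · obtain ⟨i, h1, h2, h3⟩ := h _ hl
      have e : G ∩ Ico (stair n m u) x =
          (G ∩ Ico (stair n m u) (stair n m i)) ∪ (G ∩ Icc (stair n m i) (x - 1)) := by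
        have := stair_mono hn hm h1
        have := (le_column_iff hn hm).1 h2
        ext y
        simp only [mem_inter_iff, mem_union, mem_Ico, mem_Icc]
        constructor
        · rintro ⟨h4, h5, h6⟩
          rcases lt_or_ge y (stair n m i) with h7 | h7
          · exact .inl ⟨h4, h5, h7⟩
          · exact .inr ⟨h4, h7, by omega⟩
        · rintro (⟨h4, h5, h6⟩ | ⟨h4, h5, h6⟩)
          · exact ⟨h4, h5, by omega⟩
          · exact ⟨h4, by omega, by omega⟩
      rw [e, Set.ncard_union_eq (by
          rw [Set.disjoint_left]
          rintro y ⟨-, hy1⟩ ⟨-, hy2⟩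
          rw [mem_Ico] at hy1; rw [mem_Icc] at hy2; omega)
        ((finite_Ico _ _).inter_of_right G) ((finite_Icc _ _).inter_of_right G)]
      have h4 := hprev (stair n m i) (by have := (le_column_iff hn hm).1 h2; omega)
      have h5 := (column_lt_iff hn hm (k := i) (l := stair n m i - 1)).2 (by omega)
      have h6 : Φ (max u (column n m (stair n m i - 1))) ≤ Φ i := hΦ (max_le h1 h5.le)
      have h7 : Φ (column n m (x - 1)) ≤ Φ (max u (column n m (x - 1))) := hΦ (le_max_right _ _)
      push_cast
      linarith
    · have e : G ∩ Ico (stair n m u) x = G ∩ Ico (stair n m u) (x - 1) := by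
        ext y
        simp only [mem_inter_iff, mem_Ico]
        constructor
        · rintro ⟨h4, h5, h6⟩
          have : y ≠ x - 1 := by rintro rfl; exact hl h4
          exact ⟨h4, h5, by omega⟩
        · rintro ⟨h4, h5, h6⟩; exact ⟨h4, h5, by omega⟩
      rw [e]
      have h4 := hprev (x - 1) (by omega)
      have h5 : Φ (max u (column n m (x - 1 - 1))) ≤ Φ (max u (column n m (x - 1))) :=
        hΦ (max_le_max le_rfl (column_mono hn hm (by omega)))
      linarith

/-- Being outside the shadow asks only for some final part of the arc to be sparse, sparsity asks
for the whole arc. The part cut off contains only nested arcs, which are sparse by induction on the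
number of vertical steps under the arc. -/
theorem isSparse_iff (hn : 0 < n) (hm : 0 < m) (hb : 0 < b) {S' : Set ℤ} :
    (∀ l ∈ S', ∀ i, IsMatched c n m S i l → ¬ InHorizontalShadow b n m S' i l) ↔
      IsSparse b c n m S S' := by
  constructor
  · intro h l hl i hi
    obtain ⟨d, hd⟩ : ∃ d : ℕ, l - stair n m i = d := by
      have := (le_column_iff hn hm).1 hi.1
      exact ⟨(l - stair n m i).toNat, by omega⟩
    induction d using Nat.strong_induction_on generalizing i l with
    | _ d ih =>
      have h1 := h l hl i hi
      unfold InHorizontalShadow at h1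
      push Not at h1
      -- The arc is cut at k. The bound column + 1 - k on the right part and the bound k - 1 - i on
      -- the nested arcs to the left add up to exactly column - i.
      obtain ⟨k, hk1, hk2, hk3⟩ := h1
      have hkl := (le_column_iff hn hm).1 hk2
      have hik := stair_mono hn hm hk1.le
      set G : Set ℤ := S' ∩ Ico (stair n m i) (stair n m k) with hG
      have hsub := ncard_inter_Ico_le_of_sparse hn hm (G := G) (κ := b) (u := i) (Φ := id)
        monotone_id (fun l' hl' => by
          obtain ⟨i', h2, h3⟩ := hi.exists_nested hn hm (l' := l') hl'.2.1 (by
            have := hl'.2.2; omega)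
          refine ⟨i', h2, h3.1, ?_⟩
          have h4 := stair_mono hn hm h2
          have h5 := (le_column_iff hn hm).1 h3.1
          have h6 := ih (l' - stair n m i').toNat (by have := hl'.2.2; omega) l' hl'.1 i' h3
            (by omega)
          refine le_trans ?_ h6
          have : ((G ∩ Icc (stair n m i') l').ncard : ℤ) ≤
              (S' ∩ Icc (stair n m i') l').ncard := by
            exact_mod_cast Set.ncard_le_ncard (inter_subset_inter_left _ inter_subset_left)
              ((finite_Icc _ _).inter_of_right _)
          exact mul_le_mul_of_nonneg_left this (by positivity)) (stair n m k)
      have h7 := (column_lt_iff hn hm (k := k) (l := stair n m k - 1)).2 (by omega)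
      have h8 : G ∩ Ico (stair n m i) (stair n m k) = S' ∩ Ico (stair n m i) (stair n m k) := by
        rw [hG, inter_assoc, inter_self]
      rw [h8] at hsub
      have e : S' ∩ Icc (stair n m i) l =
          (S' ∩ Ico (stair n m i) (stair n m k)) ∪ (S' ∩ Icc (stair n m k) l) := by
        ext y
        simp only [mem_inter_iff, mem_union, mem_Ico, mem_Icc]
        constructor
        · rintro ⟨h4, h5, h6⟩
          rcases lt_or_ge y (stair n m k) with h7 | h7
          · exact .inl ⟨h4, h5, h7⟩
          · exact .inr ⟨h4, h7, by omega⟩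
        · rintro (⟨h4, h5, h6⟩ | ⟨h4, h5, h6⟩)
          · exact ⟨h4, h5, by omega⟩
          · exact ⟨h4, by omega, by omega⟩
      rw [e, Set.ncard_union_eq (by
          rw [Set.disjoint_left]
          rintro y ⟨-, hy1⟩ ⟨-, hy2⟩
          rw [mem_Ico] at hy1; rw [mem_Icc] at hy2; omega)
        ((finite_Ico _ _).inter_of_right _) ((finite_Icc _ _).inter_of_right _)]
      simp only [id] at hsub
      have h9 : max i (column n m (stair n m k - 1)) ≤ k - 1 := max_le (by omega) (by omega)
      push_cast
      linarith
  · intro h l hl i hi hsh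
    have h1 := h l hl i hi
    have hmem : l ∈ S' ∩ Icc (stair n m i) l := ⟨hl, (le_column_iff hn hm).1 hi.1, le_rfl⟩
    have h2 : 0 < (S' ∩ Icc (stair n m i) l).ncard :=
      (Set.ncard_pos ((finite_Icc _ _).inter_of_right _)).2 ⟨l, hmem⟩
    have h3 : (0 : ℤ) < b * (S' ∩ Icc (stair n m i) l).ncard := by positivity
    -- Positivity of b times the count gives i < column, so k' = i + 1 is admissible; it contradicts
    -- sparsity at once.
    have h4 := hsh (i + 1) (by omega) (by omega)
    have h5 : ((S' ∩ Icc (stair n m (i + 1)) l).ncard : ℤ) ≤ (S' ∩ Icc (stair n m i) l).ncard := by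
      exact_mod_cast Set.ncard_le_ncard (inter_subset_inter_right _
        (Icc_subset_Icc_left (stair_mono hn hm (by omega)))) ((finite_Icc _ _).inter_of_right _)
    nlinarith

theorem isCompatiblePair_iff (hn : 0 < n) (hm : 0 < m) (hb : 0 < b) (hc : 0 < c)
    {x : Set ℤ × Set ℤ} : IsCompatiblePair b c n m p q x ↔
      IsPeriodicSet n q x.1 ∧ IsPeriodicSet m p x.2 ∧ IsSparse b c n m x.1 x.2 := by
  rw [← isSparse_iff hn hm hb, ← compatible_iff hn hm hc]
  exact ⟨fun h => ⟨h.1, h.2, h.3⟩, fun h => ⟨h.1, h.2.1, h.2.2⟩⟩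

end

/-! ### Encoding compatible pairs by arcs and free levels -/

/-- The vertical step at the right end of an arc. -/
def arcStep (c : ℕ) (S : Set ℤ) (τ : ℤ × ℤ × ℤ) : ℤ := c * signedCount S (τ.2.1 + 1) - τ.2.2

/-- The arcs whose right ends are steps in `S'`. -/
def stepArcs (c : ℕ) (n m : ℤ) (S S' : Set ℤ) : Set (ℤ × ℤ × ℤ) :=
  {τ | IsArc (height c n m S) τ ∧ arcStep c S τ ∈ S'}

/-- The vertical step `l` is not matched with any horizontal step. -/
def IsUnmatched (c : ℕ) (n m : ℤ) (S : Set ℤ) (l : ℤ) : Prop := ∀ i, ¬ IsMatched c n m S i l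

open Classical in
/-- The negated levels, within one period `N`, of the unmatched steps in `S'`. -/
def unmatchedLevels (c : ℕ) (n m : ℤ) (N : ℕ) (S S' : Set ℤ) : Finset ℕ :=
  (Finset.range N).filter fun x => ∃ l ∈ S', IsUnmatched c n m S l ∧ stepLevel c n m S l = -x

theorem mem_unmatchedLevels {c : ℕ} {n m : ℤ} {N : ℕ} {S S' : Set ℤ} {x : ℕ} :
    x ∈ unmatchedLevels c n m N S S' ↔
      x < N ∧ ∃ l ∈ S', IsUnmatched c n m S l ∧ stepLevel c n m S l = -x := by
  simp [unmatchedLevels]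

/-- The vertical steps determined by a set of arcs and a set of levels. -/
def stepsOf (c : ℕ) (n m : ℤ) (N : ℕ) (F : Finset ℕ) (S : Set ℤ) (T : Set (ℤ × ℤ × ℤ)) : Set ℤ :=
  {l | (∃ τ ∈ T, arcStep c S τ = l) ∨
    (IsUnmatched c n m S l ∧ (-stepLevel c n m S l % N).toNat ∈ F)}

section

variable {b c : ℕ} {n m : ℤ} {p q : ℕ} {S S' : Set ℤ}

theorem IsArc.column_arcStep (hn : 0 < n) (hm : 0 < m) {τ : ℤ × ℤ × ℤ}
    (h : IsArc (height c n m S) τ) : column n m (arcStep c S τ) = τ.2.1 := by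
  obtain ⟨h1, h2, h3, h4⟩ := h
  have h5 := h3 τ.2.1 h1 le_rfl
  rw [height_eq] at h4 h5
  have h6 := signedCount_le_succ S τ.2.1
  apply le_antisymm
  · rw [← Int.lt_add_one_iff, column_lt_iff hn hm, arcStep]
    omega
  · rw [le_column_iff hn hm, arcStep]
    nlinarith

theorem IsArc.stepLevel_arcStep (hn : 0 < n) (hm : 0 < m) {τ : ℤ × ℤ × ℤ}
    (h : IsArc (height c n m S) τ) : stepLevel c n m S (arcStep c S τ) = τ.2.2 := by
  rw [stepLevel, h.column_arcStep hn hm, arcStep, sub_sub_cancel]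

theorem IsArc.isMatched (hn : 0 < n) (hm : 0 < m) {τ : ℤ × ℤ × ℤ}
    (h : IsArc (height c n m S) τ) : IsMatched c n m S τ.1 (arcStep c S τ) := by
  rw [IsMatched, h.column_arcStep hn hm, h.stepLevel_arcStep hn hm]
  exact ⟨h.1.le, h.2.1, h.2.2.1⟩

theorem IsMatched.isArc (hn : 0 < n) (hm : 0 < m) {i l : ℤ} (h : IsMatched c n m S i l)
    (hi : i < column n m l) :
    IsArc (height c n m S) (i, column n m l, stepLevel c n m S l) :=
  ⟨hi, h.2.1, h.2.2, height_succ_lt_stepLevel hn hm l⟩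

theorem arcStep_mk (l i : ℤ) : arcStep c S (i, column n m l, stepLevel c n m S l) = l := by
  simp [arcStep, stepLevel]

theorem IsArc.eq_mk (hn : 0 < n) (hm : 0 < m) {τ : ℤ × ℤ × ℤ} (h : IsArc (height c n m S) τ)
    {i : ℤ} (hi : IsMatched c n m S i (arcStep c S τ)) :
    τ = (i, column n m (arcStep c S τ), stepLevel c n m S (arcStep c S τ)) := by
  rw [h.column_arcStep hn hm, h.stepLevel_arcStep hn hm, hi.unique (h.isMatched hn hm)]

theorem IsArc.ext (hn : 0 < n) (hm : 0 < m) {τ σ : ℤ × ℤ × ℤ} (h : IsArc (height c n m S) τ)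
    (h' : IsArc (height c n m S) σ) (e : arcStep c S τ = arcStep c S σ) : τ = σ := by
  rw [h.eq_mk hn hm (h.isMatched hn hm), h'.eq_mk hn hm (h'.isMatched hn hm)]
  have h1 := h.isMatched hn hm
  rw [e] at h1
  rw [e, h1.unique (h'.isMatched hn hm)]

theorem IsArc.shift (hn : 0 < n) (hS : IsPeriodicSet n q S) {τ : ℤ × ℤ × ℤ}
    (h : IsArc (height c n m S) τ) (t : ℤ) :
    IsArc (height c n m S) (τ + t • ((n, n, c * q - m) : ℤ × ℤ × ℤ)) := by
  obtain ⟨h1, h2, h3, h4⟩ := h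
  have hp := height_add_mul_period (c := c) (m := m) hn hS
  simp only [IsArc, Prod.fst_add, Prod.snd_add, Prod.smul_fst, Prod.smul_snd, smul_eq_mul]
  refine ⟨by omega, ?_, fun k hk1 hk2 => ?_, ?_⟩
  · rw [hp]; omega
  · have := h3 (k - t * n) (by omega) (by omega)
    have e := hp (k - t * n) t
    rw [sub_add_cancel] at e
    omega
  · rw [show τ.2.1 + t * n + 1 = τ.2.1 + 1 + t * n by ring, hp]; omega

theorem stepLevel_add_period (hm : 0 < m) (hS : IsPeriodicSet n q S) (l : ℤ) :
    stepLevel c n m S (l + m) = stepLevel c n m S l + (c * q - m) := by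
  rw [stepLevel, stepLevel, column_add_period hm,
    show column n m l + n + 1 = column n m l + 1 + n by ring, signedCount_add_period hS.shift,
    hS.count]
  ring

theorem IsMatched.shift (hn : 0 < n) (hm : 0 < m) (hS : IsPeriodicSet n q S) {i l : ℤ}
    (h : IsMatched c n m S i l) (t : ℤ) : IsMatched c n m S (i + t * n) (l + t * m) := by
  obtain ⟨h1, h2, h3⟩ := h
  have hp := height_add_mul_period (c := c) (m := m) hn hS
  have hc := map_add_zsmul (f := column n m) (column_add_period (n := n) hm) t l
  have hl := map_add_zsmul (f := stepLevel c n m S) (stepLevel_add_period hm hS) t l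
  rw [smul_eq_mul] at hc hl
  rw [IsMatched, hc, hl, hp]
  refine ⟨by omega, by omega, fun k hk1 hk2 => ?_⟩
  have := h3 (k - t * n) (by omega) (by omega)
  have e := hp (k - t * n) t
  rw [sub_add_cancel] at e
  omega

theorem IsUnmatched.shift (hn : 0 < n) (hm : 0 < m) (hS : IsPeriodicSet n q S) :
    IsShiftInvariant m {l | IsUnmatched c n m S l} := by
  intro l
  constructor
  · intro h i hi
    have := hi.shift hn hm hS 1
    rw [one_mul, one_mul] at this
    exact h _ this
  · intro h i hi
    have := hi.shift hn hm hS (-1)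
    rw [neg_one_mul m, add_neg_cancel_right] at this
    exact h _ this

theorem arcStep_shift (hS : IsPeriodicSet n q S) (τ : ℤ × ℤ × ℤ) :
    arcStep c S (τ + (n, n, c * q - m)) = arcStep c S τ + m := by
  simp only [arcStep, Prod.snd_add, Prod.fst_add]
  rw [show τ.2.1 + n + 1 = τ.2.1 + 1 + n by ring, signedCount_add_period hS.shift, hS.count]
  ring

theorem stepArcs_shift (hn : 0 < n) (hS : IsPeriodicSet n q S) (hS' : IsShiftInvariant m S') :
    IsShiftInvariant ((n, n, c * q - m) : ℤ × ℤ × ℤ) (stepArcs c n m S S') := by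
  intro τ
  simp only [stepArcs, mem_ofPred_eq, arcStep_shift hS, hS' _]
  refine and_congr_left fun _ => ⟨fun h => ?_, fun h => ?_⟩
  · have := h.shift hn hS (-1)
    rwa [neg_one_smul, add_neg_cancel_right] at this
  · simpa using h.shift hn hS 1

/-- Arcs correspond to the vertical steps at their right ends, and nesting under τ becomes lying
between the two ends of τ on the path. Hypothesis `hs` excludes matched steps directly after their
rise, which do not form arcs. -/
theorem ncard_arcsUnder_stepArcs (hn : 0 < n) (hm : 0 < m)
    (hs : ∀ l ∈ S', ∀ i, IsMatched c n m S i l → i < column n m l) {τ : ℤ × ℤ × ℤ}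
    (hτ : τ ∈ stepArcs c n m S S') :
    (arcsUnder (stepArcs c n m S S') τ).ncard =
      (S' ∩ Icc (stair n m τ.1) (arcStep c S τ)).ncard := by
  have hmτ := hτ.1.isMatched hn hm
  refine Set.ncard_congr (fun σ _ => arcStep c S σ) ?_ ?_ ?_
  · rintro σ ⟨hσ, h1, h2, h3⟩
    refine ⟨hσ.2, ?_, ?_⟩
    · rw [← le_column_iff hn hm, hσ.1.column_arcStep hn hm]
      exact h1.trans hσ.1.1.le
    · have e1 := hσ.1.column_arcStep hn hm
      have e2 := hτ.1.column_arcStep hn hm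
      rcases h2.eq_or_lt with e | h4
      · rw [arcStep, arcStep, e]; omega
      · rw [← e1, ← e2] at h4
        exact ((column_mono hn hm).reflect_lt h4).le
  · intro σ σ' hσ hσ' e
    exact hσ.1.1.ext hn hm hσ'.1.1 e
  · rintro l ⟨hl, h1, h2⟩
    obtain ⟨i, hi, hil⟩ := hmτ.exists_nested hn hm h1 h2
    refine ⟨(i, column n m l, stepLevel c n m S l),
      ⟨⟨hil.isArc hn hm (hs l hl i hil), by rwa [arcStep_mk]⟩, hi, ?_, ?_⟩, arcStep_mk l i⟩
    · rw [← hτ.1.column_arcStep hn hm]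
      exact column_mono hn hm h2
    · rw [← hτ.1.stepLevel_arcStep hn hm]
      rcases h2.eq_or_lt with rfl | h3
      · exact le_rfl
      · exact (stepLevel_lt_of_lt hn hm hmτ h1 h3).le

theorem IsSparse.lt_column (hn : 0 < n) (hm : 0 < m) (hb : 0 < b) (h : IsSparse b c n m S S') :
    ∀ l ∈ S', ∀ i, IsMatched c n m S i l → i < column n m l := by
  intro l hl i hi
  have h1 := h l hl i hi
  have hmem : l ∈ S' ∩ Icc (stair n m i) l := ⟨hl, (le_column_iff hn hm).1 hi.1, le_rfl⟩
  have h2 : 0 < (S' ∩ Icc (stair n m i) l).ncard :=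
    (Set.ncard_pos ((finite_Icc _ _).inter_of_right _)).2 ⟨l, hmem⟩
  have h3 : (0 : ℤ) < b * (S' ∩ Icc (stair n m i) l).ncard := by positivity
  omega

theorem isSparse_iff_arcs (hn : 0 < n) (hm : 0 < m)
    (hs : ∀ l ∈ S', ∀ i, IsMatched c n m S i l → i < column n m l) :
    IsSparse b c n m S S' ↔ ∀ τ ∈ stepArcs c n m S S',
      (b * (arcsUnder (stepArcs c n m S S') τ).ncard : ℤ) ≤ τ.2.1 - τ.1 := by
  constructor
  · intro h τ hτ
    rw [ncard_arcsUnder_stepArcs hn hm hs hτ, ← hτ.1.column_arcStep hn hm]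
    exact h _ hτ.2 _ (hτ.1.isMatched hn hm)
  · intro h l hl i hi
    have hτ : (i, column n m l, stepLevel c n m S l) ∈ stepArcs c n m S S' :=
      ⟨hi.isArc hn hm (hs l hl i hi), by rwa [arcStep_mk]⟩
    have := h _ hτ
    rw [ncard_arcsUnder_stepArcs hn hm hs hτ, arcStep_mk] at this
    exact this

/-- If the path does not descend over a period, all vertical steps are matched. -/
theorem not_isUnmatched (hn : 0 < n) (hm : 0 < m) (hS : IsPeriodicSet n q S) (h : m ≤ c * q)
    (l : ℤ) : ¬ IsUnmatched c n m S l := by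
  intro hl
  have h1 := height_add_period (c := c) (m := m) hn hS (column n m l + 1 - n)
  rw [sub_add_cancel] at h1
  have h2 := height_succ_lt_stepLevel (c := c) (S := S) hn hm l
  obtain ⟨i, hi⟩ := exists_isMatched (S := S) (c := c) (n := n) (m := m) (i := column n m l + 1 - n) (l := l)
    (by omega) (by omega)
  exact hl i hi

theorem IsUnmatched.le (hl : IsUnmatched c n m S l) {i : ℤ} (h : i ≤ column n m l) :
    stepLevel c n m S l ≤ height c n m S i := by
  by_contra hi
  obtain ⟨j, hj⟩ := exists_isMatched h (not_le.1 hi)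
  exact hl j hj

theorem IsUnmatched.ext (hn : 0 < n) (hm : 0 < m) {l l' : ℤ} (hl : IsUnmatched c n m S l)
    (hl' : IsUnmatched c n m S l') (e : stepLevel c n m S l = stepLevel c n m S l') : l = l' := by
  have key : ∀ {l l' : ℤ}, IsUnmatched c n m S l → IsUnmatched c n m S l' →
      stepLevel c n m S l = stepLevel c n m S l' → column n m l' ≤ column n m l := by
    intro l l' hl hl' e
    by_contra h
    have h1 := hl'.le (i := column n m l + 1) (by omega)
    have h2 := height_succ_lt_stepLevel (c := c) (S := S) hn hm l
    omega
  have h := le_antisymm (key hl' hl e.symm) (key hl hl' e)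
  rw [stepLevel, stepLevel, h] at e
  omega

/-- If the path descends over a period, each level is left by exactly one unmatched step. -/
theorem exists_isUnmatched (hn : 0 < n) (hm : 0 < m) (hS : IsPeriodicSet n q S) (h : c * q < m)
    (x : ℤ) : ∃ l, IsUnmatched c n m S l ∧ stepLevel c n m S l = x := by
  have hp := height_add_mul_period (c := c) (m := m) hn hS
  -- The height is at least -m in the first period and drops by m - cq > 0 per period, so heights
  -- below x do not occur arbitrarily far to the left.
  have hlow : ∀ z, height c n m S z < x → -(|x| + m) * n ≤ z := by
    intro z hz
    have h1 := Int.emod_nonneg z hn.ne'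
    have h2 := Int.emod_lt_of_pos z hn
    have h3 := Int.emod_add_mul_ediv z n
    have h4 := hp (z % n) (z / n)
    rw [mul_comm (z / n) n, h3] at h4
    have h5 : -m ≤ height c n m S (z % n) := by
      have h6 := signedCount_nonneg S h1
      have h7 := stair_mono hn hm h2.le
      have h8 : stair n m 0 = 0 := by simp [stair]
      have h10 := stair_add_period (m := m) hn 0
      rw [zero_add, h8, zero_add] at h10
      have h9 : 0 ≤ (c : ℤ) * signedCount S (z % n) := by positivity
      rw [height_eq]
      omega
    have h6 : -(|x| + m) ≤ z / n := by
      by_contra h7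
      push Not at h7
      have := le_abs_self x
      have := abs_nonneg x
      nlinarith
    nlinarith
  have hex : ∃ z, height c n m S z < x := by
    refine ⟨0 + (|x| + 1) * n, ?_⟩
    rw [hp, height_zero]
    have := neg_abs_le x
    have := abs_nonneg x
    nlinarith
  -- The step through level x just before the first point below x has no lower point on its left, so
  -- nothing can match it.
  obtain ⟨k, hk1, hk2⟩ := Int.exists_least_of_bdd ⟨_, hlow⟩ hex
  have h1 : x ≤ height c n m S (k - 1) := by
    by_contra hlt
    have := hk2 (k - 1) (not_le.1 hlt)
    omega
  have hcol : column n m (c * signedCount S k - x) = k - 1 := by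
    rw [height_eq] at h1 hk1
    have h6 := signedCount_le_succ S (k - 1)
    rw [sub_add_cancel] at h6
    apply le_antisymm
    · rw [← Int.lt_add_one_iff, column_lt_iff hn hm, sub_add_cancel]
      omega
    · rw [le_column_iff hn hm]
      nlinarith
  have hlev : stepLevel c n m S (c * signedCount S k - x) = x := by
    rw [stepLevel, hcol, sub_add_cancel, sub_sub_cancel]
  refine ⟨c * signedCount S k - x, fun i hi => ?_, hlev⟩
  obtain ⟨h2, h3, -⟩ := hi
  rw [hlev] at h3
  have := hk2 i h3
  omega

theorem mem_Ico_period_iff (hn : 0 < n) (hm : 0 < m) (l : ℤ) :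
    l ∈ Ico 0 m ↔ 0 ≤ column n m l ∧ column n m l < n := by
  have h0 : stair n m 0 = 0 := by simp [stair]
  have h1 := stair_add_period (m := m) hn 0
  rw [zero_add, h0, zero_add] at h1
  rw [le_column_iff hn hm, column_lt_iff hn hm, h0, h1, mem_Ico]

theorem ncard_matched (hn : 0 < n) (hm : 0 < m)
    (hs : ∀ l ∈ S', ∀ i, IsMatched c n m S i l → i < column n m l) :
    {τ ∈ stepArcs c n m S S' | 0 ≤ τ.2.1 ∧ τ.2.1 < n}.ncard =
      {l ∈ S' ∩ Ico 0 m | ¬ IsUnmatched c n m S l}.ncard := by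
  refine Set.ncard_congr (fun τ _ => arcStep c S τ) ?_ ?_ ?_
  · rintro τ ⟨hτ, h⟩
    rw [← hτ.1.column_arcStep hn hm, ← mem_Ico_period_iff hn hm] at h
    exact ⟨⟨hτ.2, h⟩, fun hu => hu _ (hτ.1.isMatched hn hm)⟩
  · intro τ σ hτ hσ e
    exact hτ.1.1.ext hn hm hσ.1.1 e
  · rintro l ⟨⟨hl, h⟩, hu⟩
    unfold IsUnmatched at hu
    push Not at hu
    obtain ⟨i, hi⟩ := hu
    rw [mem_Ico_period_iff hn hm] at h
    exact ⟨(i, column n m l, stepLevel c n m S l),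
      ⟨⟨hi.isArc hn hm (hs l hl i hi), by rwa [arcStep_mk]⟩, h⟩, arcStep_mk l i⟩

/-- A period moves unmatched steps by m and their negated levels by m - cq, so the orbits can be
counted in either window. Different unmatched steps have different levels. -/
theorem ncard_unmatched (hn : 0 < n) (hm : 0 < m) (hS : IsPeriodicSet n q S)
    (hS' : IsShiftInvariant m S') :
    (unmatchedLevels c n m (m - c * q).toNat S S').card =
      {l ∈ S' ∩ Ico 0 m | IsUnmatched c n m S l}.ncard := by
  rcases le_or_gt m (c * q) with h | h
  · have h0 : (m - c * q).toNat = 0 := by omega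
    simp [unmatchedLevels, not_isUnmatched hn hm hS h]
  · have hX : IsShiftInvariant m {l | l ∈ S' ∧ IsUnmatched c n m S l} := fun l =>
      and_congr (hS' l) (IsUnmatched.shift hn hm hS l)
    have hw := ncard_window_eq hX (f := id) (g := fun l => -stepLevel c n m S l) hm
      (show (0 : ℤ) < m - c * q by omega) (fun _ => rfl)
      (fun l => by simp only [stepLevel_add_period hm hS]; ring)
    have e : {l ∈ S' ∩ Ico 0 m | IsUnmatched c n m S l} =
        {x ∈ {l | l ∈ S' ∧ IsUnmatched c n m S l} | 0 ≤ id x ∧ id x < m} := by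
      ext l
      simp only [mem_ofPred_eq, mem_inter_iff, mem_Ico, id]
      tauto
    rw [e, hw, ← Set.ncard_coe_finset]
    symm
    refine Set.ncard_congr (fun l _ => (-stepLevel c n m S l).toNat) ?_ ?_ ?_
    · rintro l ⟨⟨h1, h2⟩, h3, h4⟩
      simp only [unmatchedLevels, Finset.coe_filter, Finset.mem_range, mem_ofPred_eq]
      exact ⟨by omega, l, h1, h2, by omega⟩
    · rintro l l' ⟨⟨h1, h2⟩, h3, h4⟩ ⟨⟨h1', h2'⟩, h3', h4'⟩ e
      exact h2.ext hn hm h2' (by omega)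
    · intro x hx
      simp only [unmatchedLevels, Finset.coe_filter, Finset.mem_range, mem_ofPred_eq] at hx
      obtain ⟨hx, l, h1, h2, h3⟩ := hx
      exact ⟨l, ⟨⟨h1, h2⟩, by omega, by omega⟩, by omega⟩

theorem signedCount_eq_arcs_add_levels (hn : 0 < n) (hm : 0 < m) (hS : IsPeriodicSet n q S)
    (hS' : IsShiftInvariant m S')
    (hs : ∀ l ∈ S', ∀ i, IsMatched c n m S i l → i < column n m l) :
    signedCount S' m = {τ ∈ stepArcs c n m S S' | 0 ≤ τ.2.1 ∧ τ.2.1 < n}.ncard +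
      (unmatchedLevels c n m (m - c * q).toNat S S').card := by
  rw [signedCount_eq_ncard _ hm.le, ncard_matched hn hm hs, ncard_unmatched hn hm hS hS']
  have hfin : (S' ∩ Ico 0 m).Finite := (finite_Ico _ _).inter_of_right _
  have := Set.ncard_sdiff_add_ncard_of_subset
    (show {l ∈ S' ∩ Ico 0 m | IsUnmatched c n m S l} ⊆ S' ∩ Ico 0 m from fun _ h => h.1) hfin
  rw [← this]
  push_cast
  congr 3
  ext l
  simp only [mem_sdiff, mem_ofPred_eq]
  tauto

/-- The data that encode the compatible pairs with `p` vertical and `q` horizontal steps. -/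
def IsEncoding (b c : ℕ) (n m : ℤ) (p q : ℕ)
    (y : Finset ℕ × (Set ℤ × Set (ℤ × ℤ × ℤ))) : Prop :=
  y.1 ⊆ Finset.range (m - c * q).toNat ∧ ∃ r, y.1.card + r = p ∧ IsArcConfig b c n m r q y.2

/-- The encoding of a compatible pair. -/
def encode (c : ℕ) (n m : ℤ) (q : ℕ) (x : Set ℤ × Set ℤ) :
    Finset ℕ × (Set ℤ × Set (ℤ × ℤ × ℤ)) :=
  (unmatchedLevels c n m (m - c * q).toNat x.1 x.2, (x.1, stepArcs c n m x.1 x.2))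

theorem isEncoding_encode (hn : 0 < n) (hm : 0 < m) (hb : 0 < b) (hc : 0 < c)
    {x : Set ℤ × Set ℤ} (hx : IsCompatiblePair b c n m p q x) :
    IsEncoding b c n m p q (encode c n m q x) := by
  obtain ⟨h1, h2, h3⟩ := (isCompatiblePair_iff hn hm hb hc).1 hx
  have hs := h3.lt_column hn hm hb
  have h4 := signedCount_eq_arcs_add_levels hn hm h1 h2.shift hs
  rw [h2.count] at h4
  refine ⟨fun x hx => Finset.mem_range.2 (mem_unmatchedLevels.1 hx).1, _, ?_, h1, fun τ hτ => hτ.1, stepArcs_shift hn h1 h2.shift,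
    (isSparse_iff_arcs hn hm hs).1 h3, rfl⟩
  simp only [encode]
  omega

theorem encode_injOn (hn : 0 < n) (hm : 0 < m) (hb : 0 < b) (hc : 0 < c) :
    InjOn (encode c n m q) {x | IsCompatiblePair b c n m p q x} := by
  rintro ⟨S, S'⟩ hx ⟨S₁, S₁'⟩ hy e
  simp only [encode, Prod.mk.injEq] at e
  obtain ⟨e1, rfl, e2⟩ := e
  have key : ∀ {S' S₁'}, IsCompatiblePair b c n m p q (S, S') →
      IsCompatiblePair b c n m p q (S, S₁') →
      unmatchedLevels c n m (m - c * q).toNat S S' = unmatchedLevels c n m (m - c * q).toNat S S₁' →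
      stepArcs c n m S S' = stepArcs c n m S S₁' → S' ⊆ S₁' := by
    clear e1 e2 hx hy S' S₁'
    intro S' S₁' hx hy e1 e2 l hl
    obtain ⟨h1, h2, h3⟩ := (isCompatiblePair_iff hn hm hb hc).1 hx
    by_cases hu : IsUnmatched c n m S l
    · rcases le_or_gt m (c * q) with h | h
      · exact absurd hu (not_isUnmatched hn hm h1 h l)
      · obtain ⟨N, hN⟩ : ∃ N : ℤ, N = m - c * q := ⟨_, rfl⟩
        have hN0 : 0 < N := by omega
        -- Translation by -t periods brings the negated level into [0, N), the range recorded by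
        -- `unmatchedLevels`.
        set t := -stepLevel c n m S l / N with ht
        have hlev := map_add_zsmul (f := stepLevel c n m S) (stepLevel_add_period hm h1) (-t) l
        have h4 := Int.emod_nonneg (-stepLevel c n m S l) hN0.ne'
        have h5 := Int.emod_lt_of_pos (-stepLevel c n m S l) hN0
        have h6 := Int.emod_add_mul_ediv (-stepLevel c n m S l) N
        rw [← ht] at h6
        have h7 : -t * (c * q - m) = N * t := by rw [hN]; ring
        rw [h7] at hlev
        have hmem : (-stepLevel c n m S (l + (-t) • m)).toNat ∈
            unmatchedLevels c n m (m - c * q).toNat S S' := by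
          rw [mem_unmatchedLevels]
          exact ⟨by omega, l + (-t) • m, (h2.shift.zsmul _ _).2 hl,
            ((IsUnmatched.shift hn hm h1).zsmul _ _).2 hu, by omega⟩
        rw [e1, mem_unmatchedLevels] at hmem
        obtain ⟨-, l', hl', hu', hll'⟩ := hmem
        have := hu'.ext hn hm (((IsUnmatched.shift hn hm h1).zsmul (-t) l).2 hu) (by omega)
        rw [this] at hl'
        exact (hy.vertical.shift.zsmul _ _).1 hl'
    · unfold IsUnmatched at hu
      push Not at hu
      obtain ⟨i, hi⟩ := hu
      have hmem : (i, column n m l, stepLevel c n m S l) ∈ stepArcs c n m S S' :=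
        ⟨hi.isArc hn hm (h3.lt_column hn hm hb l hl i hi), by rwa [arcStep_mk]⟩
      rw [e2] at hmem
      have := hmem.2
      rwa [arcStep_mk] at this
  exact Prod.ext rfl (Subset.antisymm (key hx hy e1 e2) (key hy hx e1.symm e2.symm))

/-- Surjectivity of the encoding: sparsity refers only to arcs, so any set of free levels may be
added to an arc configuration. -/
theorem encode_stepsOf (hn : 0 < n) (hm : 0 < m) (hb : 0 < b) (hc : 0 < c)
    {y : Finset ℕ × (Set ℤ × Set (ℤ × ℤ × ℤ))} (hy : IsEncoding b c n m p q y) :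
    IsCompatiblePair b c n m p q (y.2.1, stepsOf c n m (m - c * q).toNat y.1 y.2.1 y.2.2) ∧
      encode c n m q (y.2.1, stepsOf c n m (m - c * q).toNat y.1 y.2.1 y.2.2) = y := by
  obtain ⟨F, S, T⟩ := y
  obtain ⟨hF, r, hr, hx⟩ := hy
  dsimp only at *
  have hS := hx.periodic
  dsimp only at hS
  set N := (m - c * q).toNat with hN
  set S' := stepsOf c n m N F S T with hS'
  have harc : ∀ τ, IsArc (height c n m S) τ → (arcStep c S τ ∈ S' ↔ τ ∈ T) := by
    intro τ hτ
    constructor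
    · rintro (⟨σ, hσ, e⟩ | ⟨hu, -⟩)
      · rwa [← (hx.arc σ hσ).ext hn hm hτ e]
      · exact absurd (hτ.isMatched hn hm) (hu _)
    · exact fun h => .inl ⟨τ, h, rfl⟩
  have hT : stepArcs c n m S S' = T := by
    ext τ
    exact ⟨fun h => (harc τ h.1).1 h.2, fun h => ⟨hx.arc τ h, (harc τ (hx.arc τ h)).2 h⟩⟩
  have hs : ∀ l ∈ S', ∀ i, IsMatched c n m S i l → i < column n m l := by
    rintro l (⟨σ, hσ, e⟩ | ⟨hu, -⟩) i hi
    · have hσ' := hx.arc σ hσ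
      rw [← e, hσ'.column_arcStep hn hm]
      rw [← e] at hi
      rw [hi.unique (hσ'.isMatched hn hm)]
      exact hσ'.1
    · exact absurd hi (hu _)
  have hsh : IsShiftInvariant m S' := by
    intro l
    refine or_congr ?_ (and_congr (IsUnmatched.shift hn hm hS l) ?_)
    · constructor
      · rintro ⟨τ, hτ, e⟩
        refine ⟨τ + (-1 : ℤ) • (n, n, (c * q - m : ℤ)), (hx.shift.zsmul _ _).2 hτ, ?_⟩
        have := map_add_zsmul (f := arcStep c S) (arcStep_shift (m := m) (c := c) hS) (-1) τ
        rw [this, e]; ring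
      · rintro ⟨τ, hτ, e⟩
        exact ⟨_, (hx.shift τ).2 hτ, by rw [arcStep_shift hS, e]⟩
    · rw [stepLevel_add_period hm hS]
      -- If m ≤ cq, then N = 0 and reduction modulo N does nothing, but F is empty and the condition
      -- is void.
      rcases le_or_gt m (c * q) with h | h
      · have h0 : F = ∅ := by
          rw [← Finset.subset_empty]
          simpa [show N = 0 by omega] using hF
        simp [h0]
      · rw [show -(stepLevel c n m S l + (c * q - m)) = -stepLevel c n m S l + N by omega,
          Int.add_emod_right]
  have hlevels : unmatchedLevels c n m N S S' = F := by
    ext x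
    rw [mem_unmatchedLevels]
    have hmod : ∀ x : ℕ, x < N → (- -(x : ℤ) % N).toNat = x := fun x hx => by
      rw [neg_neg, Int.emod_eq_of_lt (by omega) (by omega), Int.toNat_natCast]
    constructor
    · rintro ⟨hxN, l, (⟨σ, hσ, e⟩ | ⟨-, h1⟩), hu, hl⟩
      · rw [← e] at hu
        exact absurd ((hx.arc σ hσ).isMatched hn hm) (hu _)
      · rw [hl, hmod x hxN] at h1
        exact h1
    · intro hxF
      have hxN := Finset.mem_range.1 (hF hxF)
      obtain ⟨l, hu, hl⟩ := exists_isUnmatched (c := c) hn hm hS (by omega) (-(x : ℤ))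
      exact ⟨hxN, l, .inr ⟨hu, by rwa [hl, hmod x hxN]⟩, hu, hl⟩
  refine ⟨?_, by simp only [encode, hT, hlevels, ← hN]⟩
  refine (isCompatiblePair_iff hn hm hb hc).2 ⟨hS, ⟨hsh, ?_⟩, ?_⟩
  · rw [signedCount_eq_arcs_add_levels hn hm hS hsh hs, hT, ← hN, hlevels, hx.count]
    omega
  · rw [isSparse_iff_arcs hn hm hs, hT]
    exact hx.sparse

/-- The encoding is a bijection, and its two components are independent apart from the total p. The
truncation of m - cq at zero covers the paths on which every vertical step is matched. -/
theorem pairCount_eq_sum (hn : 0 < n) (hm : 0 < m) (hb : 0 < b) (hc : 0 < c) :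
    pairCount b c n m p q = ∑ kr ∈ Finset.HasAntidiagonal.antidiagonal p,
      (m - c * q).toNat.choose kr.1 * arcCount b c n m kr.2 q := by
  have h1 : pairCount b c n m p q = {y | IsEncoding b c n m p q y}.ncard :=
    Set.ncard_congr (fun x _ => encode c n m q x) (fun x hx => isEncoding_encode hn hm hb hc hx)
      (fun x y hx hy e => encode_injOn hn hm hb hc hx hy e)
      (fun y hy => have h := encode_stepsOf hn hm hb hc hy; ⟨_, h.1, h.2⟩)
  set N := (m - c * q).toNat with hN
  have hfin : ∀ r, {x | IsArcConfig b c n m r q x}.Finite := fun r => finite_arcConfig hn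
  classical
  have h2 : {y | IsEncoding b c n m p q y} = ↑((Finset.HasAntidiagonal.antidiagonal p).biUnion fun kr =>
      (Finset.range N).powersetCard kr.1 ×ˢ (hfin kr.2).toFinset) := by
    ext ⟨F, x⟩
    simp only [IsEncoding, mem_ofPred_eq, Finset.coe_biUnion, mem_iUnion, Finset.mem_coe,
      Finset.mem_product, Finset.mem_powersetCard, Set.Finite.mem_toFinset, Finset.HasAntidiagonal.mem_antidiagonal,
      exists_prop, Prod.exists, ← hN]
    constructor
    · rintro ⟨h3, r, h4, h5⟩
      exact ⟨F.card, r, h4, ⟨h3, rfl⟩, h5⟩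
    · rintro ⟨k, r, h4, ⟨h3, rfl⟩, h5⟩
      exact ⟨h3, r, h4, h5⟩
  rw [h1, h2, Set.ncard_coe_finset, Finset.card_biUnion]
  · refine Finset.sum_congr rfl fun kr _ => ?_
    rw [Finset.card_product, Finset.card_powersetCard, Finset.card_range, arcCount,
      Set.ncard_eq_toFinset_card _ (hfin kr.2)]
  · intro a ha a' ha' hne
    rw [Function.onFun, Finset.disjoint_left]
    rintro ⟨F, x⟩ h3 h4
    rw [Finset.mem_product, Finset.mem_powersetCard] at h3 h4
    rw [Finset.mem_coe, Finset.HasAntidiagonal.mem_antidiagonal] at ha ha'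
    exact hne (Prod.ext (by have := h3.1.2; have := h4.1.2; omega)
      (by have := h3.1.2; have := h4.1.2; omega))

end

/-! ### The slope inequality for sparse arcs -/

section

variable {b c : ℕ} {n m : ℤ} {p q : ℕ}

/-- The height gains at least 1 along the arc, so its rises beat the slope by that much. As the arc
is shorter than n, this gain is worth more than 1/n per horizontal step, whence the factor nm + 1 in
place of nm. -/
theorem IsMatched.signedCount_lt (hn : 0 < n) (hm : 0 < m) {S : Set ℤ} {i l : ℤ}
    (hS : IsPeriodicSet n q S) (hi : IsMatched c n m S i l) (hlt : i < column n m l) :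
    (n * m + 1) * (column n m l - i) ≤
      n ^ 2 * c * signedCount S (column n m l) - n ^ 2 * c * signedCount S i := by
  have hlen := (hi.isArc hn hm hlt).length_lt hn hS
  dsimp only at hlen
  have h1 := hi.2.2 _ hlt le_rfl
  have h2 := hi.2.1
  rw [height_eq] at h1 h2
  have h3 : i * m < (stair n m i + 1) * n := Int.lt_ediv_add_one_mul_self _ hn
  have h4 : stair n m i * n ≤ i * m := Int.ediv_mul_le _ hn.ne'
  have h5 : column n m l * m < (stair n m (column n m l) + 1) * n :=
    Int.lt_ediv_add_one_mul_self _ hn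
  have h6 : (c * signedCount S (column n m l) - c * signedCount S i) ≥
    stair n m (column n m l) - stair n m i + 1 := by omega
  have h7 : n * (c * signedCount S (column n m l) - c * signedCount S i) ≥
      m * (column n m l - i) + 1 := by nlinarith
  nlinarith

/-- Sparsity bounds b times the number of arcs by lengths, and lengths are bounded by the number of
rises. Both are summed over t periods; boundary effects disappear as t grows. -/
theorem slope_le_of_arcCount_ne_zero (hn : 0 < n) (hm : 0 < m) (hb : 0 < b) (hc : 0 < c)
    (h : arcCount b c n m p q ≠ 0) : (n * m + 1) * (b * p) ≤ n ^ 2 * (c * q) := by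
  obtain ⟨⟨S, T⟩, hx⟩ := Set.nonempty_of_ncard_ne_zero h
  -- With no free levels, all chosen vertical steps are matched.
  obtain ⟨hpair, henc⟩ := encode_stepsOf hn hm hb hc (p := p) (q := q) (y := (∅, (S, T)))
    ⟨Finset.empty_subset _, p, by simp, hx⟩
  set S' := stepsOf c n m (m - c * q).toNat ∅ S T with hS'
  dsimp only at hpair
  obtain ⟨hS, hSp, hsp⟩ := (isCompatiblePair_iff hn hm hb hc).1 hpair
  dsimp only at hS hSp hsp
  have hlt := hsp.lt_column hn hm hb
  have hmat : ∀ l ∈ S', ∃ i, IsMatched c n m S i l := by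
    rintro l (⟨τ, hτ, rfl⟩ | ⟨-, h⟩)
    · exact ⟨_, (hx.arc τ hτ).isMatched hn hm⟩
    · simp at h
  -- The summation needs left ends at or after the base point 0. Arcs are shorter than a period, so
  -- restricting to them loses only steps of the first period.
  set G : Set ℤ := {l ∈ S' | ∃ i, 0 ≤ i ∧ IsMatched c n m S i l} with hG
  set Φ : ℤ → ℤ := fun k => n ^ 2 * c * signedCount S k with hΦ
  have hmono : Monotone Φ := fun k l hkl =>
    mul_le_mul_of_nonneg_left (signedCount_mono S hkl) (by positivity)
  have hbound := ncard_inter_Ico_le_of_sparse hn hm (G := G) (κ := (n * m + 1) * b) (u := 0) hmono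
    (by
      rintro l ⟨hl, i, h0, hi⟩
      refine ⟨i, h0, hi.1, ?_⟩
      have h1 := hsp l hl i hi
      have h2 := hi.signedCount_lt hn hm hS (hlt l hl i hi)
      have h3 : ((G ∩ Icc (stair n m i) l).ncard : ℤ) ≤ (S' ∩ Icc (stair n m i) l).ncard := by
        exact_mod_cast Set.ncard_le_ncard (inter_subset_inter_left _ (sep_subset _ _))
          ((finite_Icc _ _).inter_of_right _)
      have h4 : (b * (G ∩ Icc (stair n m i) l).ncard : ℤ) ≤ column n m l - i :=
        (mul_le_mul_of_nonneg_left h3 (by positivity)).trans h1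
      have h5 : 0 ≤ n * m + 1 := by positivity
      calc (n * m + 1) * b * (G ∩ Icc (stair n m i) l).ncard
          = (n * m + 1) * (b * (G ∩ Icc (stair n m i) l).ncard) := by ring
        _ ≤ (n * m + 1) * (column n m l - i) := mul_le_mul_of_nonneg_left h4 h5
        _ ≤ _ := h2)
  have hst0 : stair n m 0 = 0 := by simp [stair]
  have hst : ∀ t : ℤ, stair n m (t * n) = t * m := fun t => by
    have := map_add_zsmul (f := stair n m) (stair_add_period (m := m) hn) t 0
    simpa [hst0] using this
  have hcount : ∀ t : ℤ, signedCount S (t * n) = t * q := fun t => by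
    have := map_add_zsmul (f := signedCount S) (n := q) (fun k => by
      rw [signedCount_add_period hS.shift, hS.count]) t 0
    simpa using this
  have hcount' : ∀ t : ℤ, signedCount S' (t * m) = t * p := fun t => by
    have := map_add_zsmul (f := signedCount S') (n := p) (fun k => by
      rw [signedCount_add_period hSp.shift, hSp.count]) t 0
    simpa using this
  have key : ∀ t : ℤ, 1 ≤ t → (n * m + 1) * b * ((t - 1) * p) ≤ t * (n ^ 2 * (c * q)) := by
    intro t ht
    have h1 := hbound (t * m)
    rw [hst0] at h1
    have h2 : max 0 (column n m (t * m - 1)) ≤ t * n := by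
      refine max_le (by positivity) ?_
      have := (column_lt_iff hn hm (k := t * n) (l := t * m - 1)).2 (by rw [hst]; omega)
      exact this.le
    have h3 := hmono h2
    simp only [hΦ] at h1 h3
    rw [hcount] at h3
    rw [signedCount_zero] at h1
    have h4 : S' ∩ Ico m (t * m) ⊆ G ∩ Ico 0 (t * m) := by
      rintro l ⟨hl, h5, h6⟩
      obtain ⟨i, hi⟩ := hmat l hl
      refine ⟨⟨hl, i, ?_, hi⟩, by omega, h6⟩
      have h7 := ((hi.isArc hn hm (hlt l hl i hi)).length_lt hn hS)
      have h8 : n ≤ column n m l := by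
        rw [le_column_iff hn hm, ← one_mul n]
        have := hst 1
        rw [one_mul, one_mul] at this
        rw [one_mul, this]
        exact h5
      dsimp only at h7
      omega
    have h5 : ((S' ∩ Ico m (t * m)).ncard : ℤ) ≤ (G ∩ Ico 0 (t * m)).ncard := by
      exact_mod_cast Set.ncard_le_ncard h4 ((finite_Ico _ _).inter_of_right _)
    rw [← signedCount_sub S' (by nlinarith), hcount', hSp.count] at h5
    have h6 : 0 ≤ (n * m + 1) * (b : ℤ) := by positivity
    have h7 := mul_le_mul_of_nonneg_left h5 h6
    calc (n * m + 1) * b * ((t - 1) * p) = (n * m + 1) * b * (t * p - p) := by ring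
      _ ≤ _ := h7
      _ ≤ _ := h1
      _ ≤ n ^ 2 * c * (t * q) := by linarith
      _ = _ := by ring
  by_contra hcon
  push Not at hcon
  have h1 : 0 ≤ n ^ 2 * ((c : ℤ) * q) := by positivity
  -- Let R and L be the two sides, with L ≥ R + 1. Then (t-1)L ≤ tR already fails at t = R + 2.
  have h2 := key (n ^ 2 * (c * q) + 2) (by omega)
  nlinarith

end

/-! ### The greedy coefficients and their row quotients -/

/-- The coefficients of the Laurent expansion of the greedy element at `a` along the exchange of
the second variable, up to powers of the first variable. -/
def greedyQuot (b c : ℕ) (a : ℤ × ℤ) (p q : ℕ) : ℕ :=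
  -- For a₁ ≤ 0 there is no path; the element has a single row, a power of a binomial, with quotient
  -- 1.
  if 0 < a.1 then arcCount b c a.1 a.2 p q else if p = 0 ∧ q = 0 then 1 else 0

/-- The coefficients of the greedy element at `a`. -/
def greedyCoeff (b c : ℕ) (a : ℤ × ℤ) (p q : ℕ) : ℕ :=
  ∑ kr ∈ Finset.HasAntidiagonal.antidiagonal p, (a.2 - c * q).toNat.choose kr.1 * greedyQuot b c a kr.2 q

section

variable {b c : ℕ} {a : ℤ × ℤ} {p q : ℕ}

theorem greedyQuot_zero_left : greedyQuot b c a 0 q = a.1.toNat.choose q := by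
  unfold greedyQuot
  split_ifs with h1 h2
  · exact arcCount_zero h1
  · simp [h2.2]
  · have h3 : a.1.toNat = 0 := by omega
    rw [h3, Nat.choose_eq_zero_of_lt]
    omega

theorem greedyQuot_of_nonpos (h : a.2 ≤ 0) (hp : p ≠ 0) : greedyQuot b c a p q = 0 := by
  unfold greedyQuot
  split_ifs with h1 h2
  · exact arcCount_of_nonpos h1 h hp
  · exact absurd h2.1 hp
  · rfl

theorem greedyQuot_of_nonpos_left (h : a.1 ≤ 0) :
    greedyQuot b c a p q = if p = 0 ∧ q = 0 then 1 else 0 := by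
  rw [greedyQuot, if_neg (by omega)]

theorem greedyQuot_eq_zero_of_lt (h : a.1.toNat < q) : greedyQuot b c a p q = 0 := by
  unfold greedyQuot
  split_ifs with h1 h2
  · exact arcCount_eq_zero h1 h
  · omega
  · rfl

theorem greedyQuot_reflect (hq : q ≤ a.1.toNat) : greedyQuot b c a p q =
    greedyQuot b c (a.1, c * a.1.toNat - a.2) p (a.1.toNat - q) := by
  unfold greedyQuot
  dsimp only
  by_cases h1 : 0 < a.1
  · rw [if_pos h1, if_pos h1, arcCount_reflect h1 hq, Int.toNat_of_nonneg h1.le]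
  · rw [if_neg h1, if_neg h1, show a.1.toNat - q = q by omega]

theorem greedyQuot_le_greedyCoeff : greedyQuot b c a p q ≤ greedyCoeff b c a p q := by
  have := Finset.single_le_sum (s := Finset.HasAntidiagonal.antidiagonal p)
    (f := fun kr : ℕ × ℕ => (a.2 - c * q).toNat.choose kr.1 * greedyQuot b c a kr.2 q)
    (fun _ _ => Nat.zero_le _) (a := (0, p)) (by simp)
  simpa [greedyCoeff] using this

theorem greedyCoeff_eq_zero_of_lt (h : a.1.toNat < q) : greedyCoeff b c a p q = 0 :=
  Finset.sum_eq_zero fun kr _ => by rw [greedyQuot_eq_zero_of_lt h, mul_zero]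

theorem greedyCoeff_of_toNat_eq_zero (h : a.2 ≤ c * q) :
    greedyCoeff b c a p q = greedyQuot b c a p q := by
  rw [greedyCoeff, Finset.sum_eq_single (0, p)]
  · simp
  · rintro ⟨k, r⟩ hkr hne
    rw [Finset.HasAntidiagonal.mem_antidiagonal] at hkr
    dsimp only at hkr
    have hk : k ≠ 0 := by rintro rfl; exact hne (by simp_all)
    rw [show (a.2 - c * q).toNat = 0 by omega, Nat.choose_eq_zero_of_lt (by omega), zero_mul]
  · simp

theorem greedyCoeff_of_nonpos_left (h : a.1 ≤ 0) :
    greedyCoeff b c a p q = if q = 0 then a.2.toNat.choose p else 0 := by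
  split_ifs with hq
  · rw [greedyCoeff, Finset.sum_eq_single (p, 0)]
    · simp [greedyQuot_of_nonpos_left h, hq]
    · rintro ⟨k, r⟩ hkr hne
      rw [Finset.HasAntidiagonal.mem_antidiagonal] at hkr
      dsimp only at hkr
      have hr : r ≠ 0 := by rintro rfl; exact hne (by simp_all)
      simp [greedyQuot_of_nonpos_left h, hr]
    · simp
  · exact greedyCoeff_eq_zero_of_lt (by omega)

theorem greedyCoeff_of_nonpos_right (h : a.2 ≤ 0) :
    greedyCoeff b c a p q = if p = 0 then a.1.toNat.choose q else 0 := by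
  rw [greedyCoeff_of_toNat_eq_zero (h.trans (by positivity))]
  split_ifs with hp
  · rw [hp, greedyQuot_zero_left]
  · exact greedyQuot_of_nonpos h hp

/-- For a₁, a₂ > 0 the coefficients count compatible pairs, where the axes are interchangeable;
otherwise both sides are explicit binomial coefficients. -/
theorem greedyCoeff_swap (hb : 0 < b) (hc : 0 < c) :
    greedyCoeff b c a p q = greedyCoeff c b a.swap q p := by
  rcases le_or_gt a.1 0 with h1 | h1
  · rw [greedyCoeff_of_nonpos_left h1, greedyCoeff_of_nonpos_right (a := a.swap) h1]
    rfl
  rcases le_or_gt a.2 0 with h2 | h2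
  · rw [greedyCoeff_of_nonpos_right h2, greedyCoeff_of_nonpos_left (a := a.swap) h2]
    rfl
  have key : ∀ {b c : ℕ} {a : ℤ × ℤ} {p q : ℕ}, 0 < b → 0 < c → 0 < a.1 → 0 < a.2 →
      greedyCoeff b c a p q = pairCount b c a.1 a.2 p q := by
    intro b c a p q hb hc h1 h2
    rw [pairCount_eq_sum h1 h2 hb hc, greedyCoeff]
    simp only [greedyQuot, if_pos h1]
  rw [key hb hc h1 h2, key hc hb (a := a.swap) h2 h1, pairCount_swap h1 h2]
  rfl

theorem greedyCoeff_eq_zero_of_lt_left (hb : 0 < b) (hc : 0 < c) (h : a.2.toNat < p) :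
    greedyCoeff b c a p q = 0 := by
  rw [greedyCoeff_swap hb hc]
  exact greedyCoeff_eq_zero_of_lt h

theorem greedyQuot_eq_zero_of_lt_left (hb : 0 < b) (hc : 0 < c) (h : a.2.toNat < p) :
    greedyQuot b c a p q = 0 := by
  have := greedyQuot_le_greedyCoeff (b := b) (c := c) (a := a) (p := p) (q := q)
  rw [greedyCoeff_eq_zero_of_lt_left hb hc h] at this
  omega

/-- Without rises there are no arcs: for q = 0 the slope inequality forces p = 0. -/
theorem greedyQuot_zero_right (hb : 0 < b) (hc : 0 < c) :
    greedyQuot b c a p 0 = if p = 0 then 1 else 0 := by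
  split_ifs with hp
  · simp [hp, greedyQuot_zero_left]
  rcases le_or_gt a.1 0 with h1 | h1
  · simp [greedyQuot_of_nonpos_left h1, hp]
  rcases le_or_gt a.2 0 with h2 | h2
  · exact greedyQuot_of_nonpos h2 hp
  · rw [greedyQuot, if_pos h1]
    by_contra h
    have h3 := slope_le_of_arcCount_ne_zero h1 h2 hb hc h
    have h4 : 0 < (a.1 * a.2 + 1) * ((b : ℤ) * p) := by
      have : 0 < p := Nat.pos_of_ne_zero hp
      positivity
    simp at h3
    linarith

theorem greedyCoeff_zero_zero (hb : 0 < b) (hc : 0 < c) : greedyCoeff b c a 0 0 = 1 := by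
  simp [greedyCoeff, greedyQuot_zero_right hb hc]

/-- Chaining the slope inequalities of the two axes gives (a₁a₂+1)²bp ≤ (a₁a₂)²bp, hence p = 0, and
then q = 0. The strict excess of 1 is what excludes points on the diagonal a₂bp = a₁cq. -/
theorem greedyQuot_eq_zero_or (hb : 0 < b) (hc : 0 < c) (hpq : (p, q) ≠ (0, 0)) :
    greedyQuot b c a p q = 0 ∨ greedyQuot c b a.swap q p = 0 := by
  rcases le_or_gt a.1 0 with h1 | h1
  · left
    rw [greedyQuot_of_nonpos_left h1, if_neg]
    simpa using hpq
  rcases le_or_gt a.2 0 with h2 | h2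
  · right
    rw [greedyQuot_of_nonpos_left (a := a.swap) h2, if_neg]
    simpa [and_comm] using hpq
  by_contra! h
  obtain ⟨h3, h4⟩ := h
  rw [greedyQuot, if_pos h1] at h3
  rw [greedyQuot, if_pos (show 0 < a.swap.1 from h2)] at h4
  have h5 := slope_le_of_arcCount_ne_zero h1 h2 hb hc h3
  have h6 := slope_le_of_arcCount_ne_zero (n := a.swap.1) (m := a.swap.2) h2 h1 hc hb h4
  simp only [Prod.fst_swap, Prod.snd_swap] at h6
  have hp : 0 ≤ (b : ℤ) * p := by positivity
  have hq : 0 ≤ (c : ℤ) * q := by positivity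
  have ha : 0 < a.1 * a.2 := by positivity
  have h7 : (a.1 * a.2 + 1) ^ 2 * (b * p) ≤ (a.1 * a.2) ^ 2 * (b * p) :=
    calc (a.1 * a.2 + 1) ^ 2 * (b * p) = (a.1 * a.2 + 1) * ((a.1 * a.2 + 1) * (b * p)) := by ring
      _ ≤ (a.1 * a.2 + 1) * (a.1 ^ 2 * (c * q)) :=
          mul_le_mul_of_nonneg_left h5 (by positivity)
      _ = a.1 ^ 2 * ((a.2 * a.1 + 1) * (c * q)) := by ring
      _ ≤ a.1 ^ 2 * (a.2 ^ 2 * (b * p)) := mul_le_mul_of_nonneg_left h6 (by positivity)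
      _ = _ := by ring
  have h8 : (b : ℤ) * p = 0 := by nlinarith
  rw [h8, mul_zero] at h6
  have h9 : (c : ℤ) * q = 0 := by nlinarith
  apply hpq
  have hp0 : p = 0 := by
    rcases mul_eq_zero.1 h8 with h | h
    · omega
    · exact_mod_cast h
  have hq0 : q = 0 := by
    rcases mul_eq_zero.1 h9 with h | h
    · omega
    · exact_mod_cast h
  rw [hp0, hq0]

end

/-! ### The recurrence, and mutation of greedy elements -/

/-- For v ≤ 0 and k ≥ 1 the convention makes `binom (v + k - 1) k` vanish, so the recurrence sees
only the positive part of v. Its signed binomials are the coefficients of a negative power of 1 + X.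
-/
theorem ringChoose_neg_toNat (v : ℤ) {k : ℕ} (hk : 1 ≤ k) :
    Ring.choose (-(v.toNat : ℤ)) k = (-1) ^ k * binom (v + k - 1) k := by
  rcases le_or_gt v 0 with h | h
  · rw [show (v.toNat : ℤ) = 0 by omega, neg_zero, Ring.choose_zero_pos _ (by omega), binom]
    split_ifs with h1
    · rw [Nat.choose_eq_zero_of_lt (by omega)]; simp
    · simp
  · rw [Ring.choose_neg, binom, if_pos (by omega)]
    rw [show ((v.toNat : ℤ) + k - 1) = ((v + k - 1).toNat : ℕ) by omega, Ring.choose_natCast]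
    simp [Units.smul_def, Int.negOnePow_def]

/-- Inversion of the convolution with the binomial coefficients. -/
theorem sum_binom_eq_sub {C D : ℕ → ℤ} (v : ℤ)
    (h : ∀ p, C p = ∑ kr ∈ Finset.HasAntidiagonal.antidiagonal p, (v.toNat.choose kr.1 : ℤ) * D kr.2) (p : ℕ) :
    ∑ k ∈ Finset.Icc 1 p, (-1) ^ (k - 1) * C (p - k) * binom (v + k - 1) k = C p - D p := by
  set A : PowerSeries ℤ := PowerSeries.mk fun k => Ring.choose (-(v.toNat : ℤ)) k
  set B : PowerSeries ℤ := PowerSeries.mk fun k => (v.toNat.choose k : ℤ)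
  -- Vandermonde's identity for -v⁺ + v⁺ = 0, where v⁺ is the positive part of v.
  have hAB : A * B = 1 := by
    ext k
    rw [PowerSeries.coeff_mul]
    simp only [A, B, PowerSeries.coeff_mk]
    have := Ring.add_choose_eq k (Commute.all (-(v.toNat : ℤ)) (v.toNat : ℤ))
    simp only [Ring.choose_natCast] at this
    rw [← this, neg_add_cancel, PowerSeries.coeff_one]
    split_ifs with hk
    · simp [hk]
    · exact Ring.choose_zero_pos _ (Nat.pos_of_ne_zero hk)
  have hC : PowerSeries.mk C = B * PowerSeries.mk D := by
    ext k
    rw [PowerSeries.coeff_mul]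
    simp only [B, PowerSeries.coeff_mk, h k]
  have hD : PowerSeries.mk D = A * PowerSeries.mk C := by rw [hC, ← mul_assoc, hAB, one_mul]
  have hp := congrArg (PowerSeries.coeff p) hD
  rw [PowerSeries.coeff_mul, Finset.Nat.sum_antidiagonal_eq_sum_range_succ_mk] at hp
  simp only [A, PowerSeries.coeff_mk] at hp
  rw [Finset.sum_range_succ', Ring.choose_zero_right, one_mul, Nat.sub_zero] at hp
  have e : ∑ k ∈ Finset.Icc 1 p, (-1) ^ (k - 1) * C (p - k) * binom (v + k - 1) k =
      ∑ k ∈ Finset.range p, -(Ring.choose (-(v.toNat : ℤ)) (k + 1) * C (p - (k + 1))) := by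
    rw [← Finset.Ico_add_one_right_eq_Icc, Finset.sum_Ico_eq_sum_range, Nat.add_sub_cancel]
    refine Finset.sum_congr rfl fun k _ => ?_
    rw [ringChoose_neg_toNat v (by omega), add_comm 1 k, Nat.add_sub_cancel, pow_succ]
    ring
  rw [e, Finset.sum_neg_distrib]
  linarith

section

variable {b c : ℕ} {a : ℤ × ℤ}

/-- The coefficients of the greedy element at `a`, as a finitely supported function. -/
def greedyFinsupp (b c : ℕ) (hb : 0 < b) (hc : 0 < c) (a : ℤ × ℤ) : ℕ × ℕ →₀ ℤ :=
  Finsupp.onFinset (Finset.range (a.2.toNat + 1) ×ˢ Finset.range (a.1.toNat + 1))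
    (fun i => (greedyCoeff b c a i.1 i.2 : ℤ)) (by
      rintro ⟨p, q⟩ h
      rw [Finset.mem_product, Finset.mem_range, Finset.mem_range]
      by_contra hcon
      rw [not_and_or, not_lt, not_lt] at hcon
      rcases hcon with h1 | h1
      · exact h (by simp [greedyCoeff_eq_zero_of_lt_left hb hc (Nat.lt_of_succ_le h1)])
      · exact h (by simp [greedyCoeff_eq_zero_of_lt (Nat.lt_of_succ_le h1)]))

/-- The two sums equal the coefficient minus its row quotient and minus its column quotient. Both
quotients are non-negative and one is zero, so the maximum is the coefficient. -/
theorem greedyRecurrence_greedyFinsupp (hb : 0 < b) (hc : 0 < c) :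
    GreedyRecurrence b c a (greedyFinsupp b c hb hc a) := by
  intro p q hpq
  simp only [greedyFinsupp, Finsupp.onFinset_apply]
  rw [sum_binom_eq_sub (C := fun p => (greedyCoeff b c a p q : ℤ))
    (D := fun p => (greedyQuot b c a p q : ℤ)) (a.2 - c * q)
    (fun p => by rw [greedyCoeff]; push_cast; rfl)]
  rw [sum_binom_eq_sub (C := fun q => (greedyCoeff b c a p q : ℤ))
    (D := fun q => (greedyQuot c b a.swap q p : ℤ)) (a.1 - b * p)
    (fun q => by rw [greedyCoeff_swap hb hc, greedyCoeff]; push_cast; rfl)]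
  rcases greedyQuot_eq_zero_or (a := a) hb hc hpq with h | h
  · rw [h, max_eq_left] <;> simp
  · rw [h, max_eq_right] <;> simp

/-- The greedy recurrence determines the coefficients. -/
theorem GreedyRecurrence.unique {f g : ℕ × ℕ →₀ ℤ} (hf : GreedyRecurrence b c a f)
    (hg : GreedyRecurrence b c a g) (h0 : f (0, 0) = g (0, 0)) : f = g := by
  have key : ∀ s p q, p + q = s → f (p, q) = g (p, q) := by
    intro s
    induction s using Nat.strong_induction_on with
    | _ s ih =>
      intro p q hs
      by_cases hpq : (p, q) = (0, 0)
      · rw [hpq, h0]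
      rw [hf p q hpq, hg p q hpq]
      congr 1
      · refine Finset.sum_congr rfl fun k hk => ?_
        rw [Finset.mem_Icc] at hk
        rw [ih (p - k + q) (by omega) _ _ rfl]
      · refine Finset.sum_congr rfl fun k hk => ?_
        rw [Finset.mem_Icc] at hk
        rw [ih (p + (q - k)) (by omega) _ _ rfl]
  ext ⟨p, q⟩
  exact key _ p q rfl

/-- A row of the coefficients `greedyQuot`, as a polynomial. -/
def greedyRow (b c : ℕ) (a : ℤ × ℤ) (q : ℕ) : ℕ[X] :=
  ∑ p ∈ Finset.range (a.2.toNat + 1), monomial p (greedyQuot b c a p q)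

theorem coeff_greedyRow (hb : 0 < b) (hc : 0 < c) (p q : ℕ) :
    (greedyRow b c a q).coeff p = greedyQuot b c a p q := by
  rw [greedyRow, finsetSum_coeff]
  simp only [coeff_monomial]
  rw [Finset.sum_ite_eq']
  split_ifs with h
  · rfl
  · rw [Finset.mem_range, not_lt] at h
    rw [greedyQuot_eq_zero_of_lt_left hb hc (Nat.lt_of_succ_le h)]

theorem greedyRow_reflect (hb : 0 < b) (hc : 0 < c) {q : ℕ} (hq : q ≤ a.1.toNat) :
    greedyRow b c a q = greedyRow b c (a.1, c * a.1.toNat - a.2) (a.1.toNat - q) := by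
  ext p
  rw [coeff_greedyRow hb hc, coeff_greedyRow hb hc, greedyQuot_reflect hq]

theorem greedyRow_zero (hb : 0 < b) (hc : 0 < c) : greedyRow b c a 0 = 1 := by
  ext p
  rw [coeff_greedyRow hb hc, greedyQuot_zero_right hb hc, coeff_one]

theorem sum_greedyCoeff (hb : 0 < b) (hc : 0 < c) (q : ℕ) :
    ∑ p ∈ Finset.range (a.2.toNat + 1), monomial p (greedyCoeff b c a p q) =
      (1 + X) ^ (a.2 - c * q).toNat * greedyRow b c a q := by
  ext p
  rw [finsetSum_coeff, coeff_mul]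
  simp only [coeff_monomial, coeff_greedyRow hb hc, coeff_one_add_X_pow, Nat.cast_id]
  rw [Finset.sum_ite_eq']
  split_ifs with h
  · rfl
  · rw [Finset.mem_range, not_lt] at h
    have := greedyCoeff_eq_zero_of_lt_left (a := a) (q := q) hb hc (Nat.lt_of_succ_le h)
    exact this.symm

variable {K : Type*} [Field K]

/-- The greedy element at `a` in terms of the variables `u` and `v`. -/
def greedyElement (b c : ℕ) (a : ℤ × ℤ) (u v : K) : K :=
  u ^ (-a.1) * v ^ (-a.2) * ∑ q ∈ Finset.range (a.1.toNat + 1),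
    ∑ p ∈ Finset.range (a.2.toNat + 1), (greedyCoeff b c a p q : K) * u ^ (b * p) * v ^ (c * q)

theorem greedyElement_swap (hb : 0 < b) (hc : 0 < c) (u v : K) :
    greedyElement b c a u v = greedyElement c b a.swap v u := by
  rw [greedyElement, greedyElement, Finset.sum_comm, Prod.fst_swap, Prod.snd_swap,
    mul_comm (u ^ _)]
  congr 1
  refine Finset.sum_congr rfl fun p _ => Finset.sum_congr rfl fun q _ => ?_
  rw [greedyCoeff_swap hb hc]
  ring

theorem greedyElement_eq_rows (hb : 0 < b) (hc : 0 < c) {u v : K} (hv : v ≠ 0) :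
    greedyElement b c a u v = ∑ q ∈ Finset.range (a.1.toNat + 1),
      u ^ (-a.1) * v ^ (-(a.2 - c * q)) * (1 + u ^ b) ^ (a.2 - c * q).toNat *
        aeval (u ^ b) (greedyRow b c a q) := by
  rw [greedyElement, Finset.mul_sum]
  refine Finset.sum_congr rfl fun q _ => ?_
  have h := congrArg (aeval (u ^ b)) (sum_greedyCoeff (a := a) hb hc q)
  simp only [map_sum, map_mul, map_pow, map_add, map_one, aeval_X, aeval_monomial] at h
  rw [mul_assoc _ _ (aeval _ _), ← h, show -(a.2 - c * q) = -a.2 + ((c * q : ℕ) : ℤ) by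
    push_cast; ring, zpow_add₀ hv, zpow_natCast, Finset.mul_sum, Finset.mul_sum]
  refine Finset.sum_congr rfl fun p _ => ?_
  rw [← pow_mul]
  simp only [eq_natCast]
  ring

theorem zpow_mul_pow_toNat {v w : K} (hv : v ≠ 0) (hw : w ≠ 0) (e : ℤ) :
    v ^ (-e) * (w * v) ^ e.toNat = w ^ e * (w * v) ^ (-e).toNat := by
  rcases le_total 0 e with h | h
  · rw [show (-e).toNat = 0 by omega, pow_zero, mul_one, ← zpow_natCast, Int.toNat_of_nonneg h,
      mul_zpow, mul_left_comm, ← zpow_add₀ hv, neg_add_cancel, zpow_zero, mul_one]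
  · rw [show e.toNat = 0 by omega, pow_zero, mul_one, ← zpow_natCast,
      Int.toNat_of_nonneg (by omega), mul_zpow, ← mul_assoc, ← zpow_add₀ hw, add_neg_cancel,
      zpow_zero, one_mul]

/-- Invariance of greedy elements under mutation. -/
theorem greedyElement_mutate (hb : 0 < b) (hc : 0 < c) {u v w : K} (hv : v ≠ 0) (hw : w ≠ 0)
    (h : w * v = u ^ b + 1) :
    greedyElement b c a u v = greedyElement b c (a.1, c * a.1.toNat - a.2) u w := by
  -- Row a₁⁺ - q at v corresponds to row q at w, so one of the sums is reversed. The exponent a₂ -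
  -- cq changes sign, and `zpow_mul_pow_toNat` trades powers of v for powers of w.
  rw [greedyElement_eq_rows hb hc hv, greedyElement_eq_rows hb hc hw,
    ← Finset.sum_range_reflect]
  refine Finset.sum_congr rfl fun q hq => ?_
  rw [Finset.mem_range] at hq
  rw [show a.1.toNat + 1 - 1 - q = a.1.toNat - q by omega,
    greedyRow_reflect hb hc (Nat.sub_le _ _), Nat.sub_sub_self (by omega)]
  congr 1
  have e : (c * a.1.toNat - a.2 : ℤ) - c * q = -(a.2 - c * ((a.1.toNat - q : ℕ) : ℤ)) := by
    rw [Nat.cast_sub (by omega)]; ring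
  rw [add_comm 1, ← h, mul_assoc, mul_assoc, e, zpow_mul_pow_toNat hv hw, neg_neg]

end

/-! ### Reading off Laurent coefficients -/

/-- A ring homomorphism to iterated Laurent series that sends `u` to the inner and `v` to the
outer variable. -/
structure IsRowHom {K : Type*} [Field K] (u v : K)
    (Ψ : K →+* LaurentSeries (LaurentSeries ℚ)) : Prop where
  map_left : Ψ u = HahnSeries.C (HahnSeries.single 1 1)
  map_right : Ψ v = HahnSeries.single 1 1

/-- Polynomial coefficients can be recovered from the iterated series, so the map on polynomials is
injective and extends to the fraction field. The outer variable separates rows, the inner one the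
entries of a row. -/
theorem exists_isRowHom_aux {i j : Fin 2} (hij : i ≠ j) :
    ∃ Ψ : AmbientField →+* LaurentSeries (LaurentSeries ℚ),
      IsRowHom (algebraMap (MvPolynomial (Fin 2) ℚ) AmbientField (MvPolynomial.X i))
        (algebraMap (MvPolynomial (Fin 2) ℚ) AmbientField (MvPolynomial.X j)) Ψ := by
  set f : Fin 2 → LaurentSeries (LaurentSeries ℚ) := fun k =>
    if k = i then HahnSeries.C (HahnSeries.single 1 1) else HahnSeries.single 1 1 with hf
  set φ : MvPolynomial (Fin 2) ℚ →+* LaurentSeries (LaurentSeries ℚ) :=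
    MvPolynomial.eval₂Hom (HahnSeries.C.comp HahnSeries.C) f with hφ
  have hprod : ∀ g : Fin 2 → LaurentSeries (LaurentSeries ℚ), ∏ k, g k = g i * g j := by
    intro g
    rw [Fin.prod_univ_two]
    obtain ⟨rfl, rfl⟩ | ⟨rfl, rfl⟩ : (i = 0 ∧ j = 1) ∨ (i = 1 ∧ j = 0) := by omega
    · rfl
    · exact mul_comm _ _
  have hcoeff : ∀ (p : MvPolynomial (Fin 2) ℚ) (s : Fin 2 →₀ ℕ),
      ((φ p).coeff (s j)).coeff (s i) = p.coeff s := by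
    intro p s
    induction p using MvPolynomial.induction_on' with
    | monomial t r =>
      rw [hφ, MvPolynomial.coe_eval₂Hom, MvPolynomial.eval₂_monomial,
        Finsupp.prod_fintype _ _ (by simp), hprod, MvPolynomial.coeff_monomial]
      simp only [hf, if_true, if_neg hij.symm, HahnSeries.single_pow, ← map_pow, ← mul_assoc,
        RingHom.comp_apply, ← map_mul]
      rw [HahnSeries.C_apply, HahnSeries.C_apply, HahnSeries.single_mul_single,
        HahnSeries.single_mul_single]
      simp only [one_pow, mul_one, zero_add, nsmul_eq_mul]
      have hts : t = s ↔ (s j : ℤ) = t j ∧ (s i : ℤ) = t i := by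
        constructor
        · rintro rfl; simp
        · rintro ⟨h1, h2⟩
          ext k
          obtain rfl | rfl : k = i ∨ k = j := by omega
          · exact_mod_cast h2.symm
          · exact_mod_cast h1.symm
      by_cases h1 : (s j : ℤ) = t j
      · rw [h1, HahnSeries.coeff_single_same]
        by_cases h2 : (s i : ℤ) = t i
        · rw [h2, HahnSeries.coeff_single_same, if_pos (hts.2 ⟨h1, h2⟩)]
        · rw [HahnSeries.coeff_single_of_ne h2, if_neg (fun h => h2 (hts.1 h).2)]
      · rw [HahnSeries.coeff_single_of_ne h1, if_neg (fun h => h1 (hts.1 h).1)]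
        rfl
    | add p q hp hq =>
      rw [map_add, HahnSeries.coeff_add, HahnSeries.coeff_add, hp, hq, MvPolynomial.coeff_add]
  have hinj : Function.Injective φ := by
    rw [injective_iff_map_eq_zero]
    intro p hp
    ext s
    rw [← hcoeff, hp]
    simp
  let Ψ : AmbientField →+* LaurentSeries (LaurentSeries ℚ) :=
    IsFractionRing.lift (A := MvPolynomial (Fin 2) ℚ) (K := AmbientField)
      (L := LaurentSeries (LaurentSeries ℚ)) (g := φ) hinj
  have hΨ : ∀ p, Ψ (algebraMap _ _ p) = φ p := fun p => IsFractionRing.lift_algebraMap hinj p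
  refine ⟨Ψ, ?_, ?_⟩
  · rw [hΨ, hφ, MvPolynomial.coe_eval₂Hom, MvPolynomial.eval₂_X]
    simp [hf]
  · rw [hΨ, hφ, MvPolynomial.coe_eval₂Hom, MvPolynomial.eval₂_X]
    simp [hf, hij.symm]

theorem exists_isRowHom : ∃ Ψ, IsRowHom x₁ x₂ Ψ := exists_isRowHom_aux (by decide)

theorem exists_isRowHom_swap : ∃ Ψ, IsRowHom x₂ x₁ Ψ := exists_isRowHom_aux (by decide)

section

variable {K : Type*} [Field K] {u v : K} {Ψ : K →+* LaurentSeries (LaurentSeries ℚ)}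

theorem single_one_zpow {R : Type*} [Field R] (j : ℤ) :
    (HahnSeries.single 1 1 : LaurentSeries R) ^ j = HahnSeries.single j 1 := by
  exact (RatFunc.single_zpow j).symm

theorem IsRowHom.map_left_zpow (h : IsRowHom u v Ψ) (i : ℤ) :
    Ψ (u ^ i) = HahnSeries.C (HahnSeries.single i 1) := by
  rw [map_zpow₀, h.map_left, ← map_zpow₀, single_one_zpow]

theorem IsRowHom.map_right_zpow (h : IsRowHom u v Ψ) (j : ℤ) :
    Ψ (v ^ j) = HahnSeries.single j 1 := by
  rw [map_zpow₀, h.map_right, single_one_zpow]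

theorem IsRowHom.left_ne_zero (h : IsRowHom u v Ψ) : u ≠ 0 := by
  rintro rfl
  have := h.map_left
  rw [map_zero] at this
  have h2 := congrArg (fun f => (HahnSeries.coeff f 0).coeff 1) this
  simp [HahnSeries.C_apply] at h2

theorem IsRowHom.right_ne_zero (h : IsRowHom u v Ψ) : v ≠ 0 := by
  rintro rfl
  have := h.map_right
  rw [map_zero] at this
  have h2 := congrArg (fun f => HahnSeries.coeff f 1) this
  simp at h2

theorem IsRowHom.map_monomial (h : IsRowHom u v Ψ) (i j : ℤ) :
    Ψ (u ^ i * v ^ j) = HahnSeries.single j (HahnSeries.single i 1) := by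
  rw [map_mul, h.map_left_zpow, h.map_right_zpow, HahnSeries.C_apply,
    HahnSeries.single_mul_single, zero_add, mul_one]

end

/-! ### Intersections of Laurent polynomial rings -/

section

variable {K : Type*} [Field K]

/-- The `ℤ`-span of the Laurent monomials `u ^ i * v ^ j` with `i ∈ I` and `j ∈ J`. -/
def monomialSpan (I J : Set ℤ) (u v : K) : Submodule ℤ K :=
  Submodule.span ℤ {x | ∃ i ∈ I, ∃ j ∈ J, x = u ^ i * v ^ j}

variable {I I' I'' J J' J'' : Set ℤ} {u v w : K}

theorem monomial_mem {i j : ℤ} (hi : i ∈ I) (hj : j ∈ J) :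
    u ^ i * v ^ j ∈ monomialSpan I J u v :=
  Submodule.subset_span ⟨i, hi, j, hj, rfl⟩

theorem zpow_left_mem {i : ℤ} (hi : i ∈ I) (hj : 0 ∈ J) : u ^ i ∈ monomialSpan I J u v := by
  simpa using monomial_mem (u := u) (v := v) hi hj

theorem one_mem_monomialSpan (hi : 0 ∈ I) (hj : 0 ∈ J) : 1 ∈ monomialSpan I J u v := by
  simpa using monomial_mem (u := u) (v := v) hi hj

theorem monomialSpan_mono (hI : I ⊆ I') (hJ : J ⊆ J') :
    monomialSpan I J u v ≤ monomialSpan I' J' u v :=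
  Submodule.span_mono fun _ ⟨i, hi, j, hj, e⟩ => ⟨i, hI hi, j, hJ hj, e⟩

theorem monomialSpan_swap : monomialSpan I J u v = monomialSpan J I v u := by
  unfold monomialSpan
  congr 1
  ext x
  constructor <;> rintro ⟨i, hi, j, hj, rfl⟩ <;> exact ⟨j, hj, i, hi, mul_comm _ _⟩

theorem monomialSpan_induction {p : K → Prop} (hmon : ∀ i ∈ I, ∀ j ∈ J, p (u ^ i * v ^ j))
    (hzero : p 0) (hadd : ∀ x y, p x → p y → p (x + y)) (hneg : ∀ x, p x → p (-x)) {x : K}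
    (hx : x ∈ monomialSpan I J u v) : p x := by
  refine Submodule.span_induction ?_ hzero (fun x y _ _ => hadd x y) (fun n x _ h => ?_) hx
  · rintro x ⟨i, hi, j, hj, rfl⟩
    exact hmon i hi j hj
  · have hnat : ∀ n : ℕ, p (n • x) := fun n => by
      induction n with
      | zero => simpa using hzero
      | succ n ih => rw [succ_nsmul]; exact hadd _ _ ih h
    obtain ⟨m, rfl | rfl⟩ := Int.eq_nat_or_neg n
    · rw [natCast_zsmul]; exact hnat m
    · rw [neg_smul, natCast_zsmul]; exact hneg _ (hnat m)

theorem mul_mem_monomialSpan (hu : u ≠ 0) (hv : v ≠ 0)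
    (hI : ∀ i ∈ I, ∀ i' ∈ I', i + i' ∈ I'') (hJ : ∀ j ∈ J, ∀ j' ∈ J', j + j' ∈ J'') {x y : K}
    (hx : x ∈ monomialSpan I J u v) (hy : y ∈ monomialSpan I' J' u v) :
    x * y ∈ monomialSpan I'' J'' u v := by
  refine monomialSpan_induction (p := fun x => x * y ∈ monomialSpan I'' J'' u v) ?_ (by simp)
    (fun x x' h h' => by rw [add_mul]; exact add_mem h h')
    (fun x h => by rw [neg_mul]; exact neg_mem h) hx
  intro i hi j hj
  refine monomialSpan_induction
    (p := fun y => u ^ i * v ^ j * y ∈ monomialSpan I'' J'' u v) ?_ (by simp)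
    (fun x x' h h' => by rw [mul_add]; exact add_mem h h')
    (fun x h => by rw [mul_neg]; exact neg_mem h) hy
  intro i' hi' j' hj'
  rw [mul_mul_mul_comm, ← zpow_add₀ hu, ← zpow_add₀ hv]
  exact monomial_mem (hI i hi i' hi') (hJ j hj j' hj')

theorem pow_mem_monomialSpan (hu : u ≠ 0) (hv : v ≠ 0) (hI : ∀ i ∈ I, ∀ i' ∈ I, i + i' ∈ I)
    (hJ : ∀ j ∈ J, ∀ j' ∈ J, j + j' ∈ J) (hI0 : 0 ∈ I) (hJ0 : 0 ∈ J) {x : K}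
    (hx : x ∈ monomialSpan I J u v) (N : ℕ) : x ^ N ∈ monomialSpan I J u v := by
  induction N with
  | zero => rw [pow_zero]; exact one_mem_monomialSpan hI0 hJ0
  | succ N ih => rw [pow_succ]; exact mul_mem_monomialSpan hu hv hI hJ ih hx

theorem one_add_pow_mem (hu : u ≠ 0) (hv : v ≠ 0) (b N : ℕ) :
    (1 + u ^ b) ^ N ∈ monomialSpan (Ici 0) {0} u v := by
  refine pow_mem_monomialSpan hu hv (I := Ici 0) (J := {0}) (fun i hi i' hi' => ?_) (by simp) (by simp)
    (by simp) (add_mem (one_mem_monomialSpan (by simp) (by simp)) ?_) N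
  · simp only [mem_Ici] at *
    omega
  rw [← zpow_natCast]
  exact zpow_left_mem (by simp) (by simp)

/-- The higher terms of `(1 + u ^ b) ^ N`. -/
theorem one_add_pow_sub_one_mem (hu : u ≠ 0) (hv : v ≠ 0) {b : ℕ} (hb : 0 < b) (N : ℕ) :
    (1 + u ^ b) ^ N - 1 ∈ monomialSpan (Ici 1) {0} u v := by
  induction N with
  | zero => simp
  | succ N ih =>
    rw [show (1 + u ^ b) ^ (N + 1) - 1 = ((1 + u ^ b) ^ N - 1) + (1 + u ^ b) ^ N * u ^ b by ring]
    refine add_mem ih (mul_mem_monomialSpan hu hv (I := Ici 0) (I' := Ici 1) (J := {0}) (J' := {0})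
      ?_ (by simp) (one_add_pow_mem hu hv b N) ?_)
    · intro i hi i' hi'
      simp only [mem_Ici] at *
      omega
    · rw [← zpow_natCast]
      exact zpow_left_mem (by simp only [mem_Ici]; omega) (by simp)

theorem exists_bottom_row {N : ℤ} {x : K}
    (hx : x ∈ monomialSpan I (Ici N) u v) :
    ∃ P ∈ monomialSpan I {0} u v, x - P * v ^ N ∈ monomialSpan I (Ici (N + 1)) u v := by
  refine monomialSpan_induction (p := fun x => ∃ P ∈ monomialSpan I {0} u v,
    x - P * v ^ N ∈ monomialSpan I (Ici (N + 1)) u v) ?_ ⟨0, zero_mem _, by simp⟩ ?_ ?_ hx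
  · intro i hi j hj
    rcases eq_or_ne j N with rfl | hne
    · exact ⟨u ^ i, zpow_left_mem hi (by simp), by simp⟩
    · refine ⟨0, zero_mem _, ?_⟩
      rw [zero_mul, sub_zero]
      exact monomial_mem hi (by simp only [mem_Ici] at *; omega)
  · rintro x y ⟨P, hP, h⟩ ⟨Q, hQ, h'⟩
    refine ⟨P + Q, add_mem hP hQ, ?_⟩
    rw [show x + y - (P + Q) * v ^ N = (x - P * v ^ N) + (y - Q * v ^ N) by ring]
    exact add_mem h h'
  · rintro x ⟨P, hP, h⟩
    refine ⟨-P, neg_mem hP, ?_⟩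
    rw [show -x - -P * v ^ N = -(x - P * v ^ N) by ring]
    exact neg_mem h

theorem exists_mem_Ici {x : K} (hx : x ∈ monomialSpan I univ u v) :
    ∃ N : ℕ, x ∈ monomialSpan I (Ici (-(N : ℤ))) u v := by
  refine monomialSpan_induction (p := fun x => ∃ N : ℕ, x ∈ monomialSpan I (Ici (-(N : ℤ))) u v)
    ?_ ⟨0, zero_mem _⟩ ?_ (fun x ⟨N, h⟩ => ⟨N, neg_mem h⟩) hx
  · intro i hi j _
    exact ⟨j.natAbs, monomial_mem hi (by simp only [mem_Ici]; omega)⟩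
  · rintro x y ⟨N, h⟩ ⟨M, h'⟩
    refine ⟨max N M, add_mem (monomialSpan_mono le_rfl ?_ h) (monomialSpan_mono le_rfl ?_ h')⟩ <;>
    · apply Ici_subset_Ici.2
      push_cast
      omega

variable {Ψ : K →+* LaurentSeries (LaurentSeries ℚ)}

/-- The coefficient of `u ^ i * v ^ j`. -/
def biCoeff (i j : ℤ) : LaurentSeries (LaurentSeries ℚ) →+ ℚ where
  toFun f := (f.coeff j).coeff i
  map_zero' := rfl
  map_add' _ _ := rfl

theorem IsRowHom.coeff_eq_zero (h : IsRowHom u v Ψ) {x : K} (hx : x ∈ monomialSpan I J u v)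
    {i j : ℤ} (hij : i ∉ I ∨ j ∉ J) : ((Ψ x).coeff j).coeff i = 0 := by
  refine monomialSpan_induction (p := fun x => ((Ψ x).coeff j).coeff i = 0) ?_ (by simp)
    (fun x y hx hy => by simp [hx, hy]) (fun x hx => by simp [hx]) hx
  intro i' hi' j' hj'
  rw [h.map_monomial]
  rcases eq_or_ne j j' with rfl | hj
  · rw [HahnSeries.coeff_single_same]
    rcases eq_or_ne i i' with rfl | hi
    · tauto
    · exact HahnSeries.coeff_single_of_ne hi
  · rw [HahnSeries.coeff_single_of_ne hj]
    rfl

theorem IsRowHom.row_eq_zero (h : IsRowHom u v Ψ) {x : K} (hx : x ∈ monomialSpan I J u v)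
    {j : ℤ} (hj : j ∉ J) : (Ψ x).coeff j = 0 := by
  ext i
  exact h.coeff_eq_zero hx (.inr hj)

/-- Laurent polynomials in `u` are constant series. -/
theorem IsRowHom.map_row (h : IsRowHom u v Ψ) {x : K} (hx : x ∈ monomialSpan I {0} u v) :
    ∃ p, Ψ x = HahnSeries.C p := by
  refine monomialSpan_induction (p := fun x => ∃ p, Ψ x = HahnSeries.C p) ?_ ⟨0, by simp⟩
    (fun x y ⟨p, hp⟩ ⟨q, hq⟩ => ⟨p + q, by simp [hp, hq]⟩)
    (fun x ⟨p, hp⟩ => ⟨-p, by simp [hp]⟩) hx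
  rintro i - j rfl
  exact ⟨HahnSeries.single i 1, by rw [h.map_monomial, HahnSeries.C_apply]⟩

/-- The expansion of `u ^ i * w ^ k`, where `w` is obtained from `v` by mutation. -/
theorem IsRowHom.map_mutated_monomial (h : IsRowHom u v Ψ) {b : ℕ} (hw : w * v = u ^ b + 1)
    (i k : ℤ) : Ψ (u ^ i * w ^ k) = HahnSeries.single (-k)
      ((1 + HahnSeries.single 1 1 ^ b) ^ k * HahnSeries.single i 1) := by
  have e : w = (1 + u ^ b) * v ^ (-1 : ℤ) := by
    rw [zpow_neg_one, eq_mul_inv_iff_mul_eq₀ h.right_ne_zero, hw, add_comm]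
  have h1 : Ψ (1 + u ^ b) = HahnSeries.C (1 + HahnSeries.single 1 1 ^ b) := by
    rw [RingHom.map_add, RingHom.map_one, RingHom.map_pow, h.map_left, RingHom.map_add,
      RingHom.map_one, RingHom.map_pow]
  rw [e, mul_zpow, ← zpow_mul, map_mul, map_mul, h.map_left_zpow, h.map_right_zpow, map_zpow₀, h1,
    ← map_zpow₀, ← mul_assoc, ← map_mul, HahnSeries.C_apply, HahnSeries.single_mul_single, zero_add,
    mul_one, neg_one_mul, mul_comm]

/-- Since w = (1+u^b)v⁻¹, only the monomials with w^N contribute to the row of v^(-N), so that row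
is divisible by (1+u^b)^N. -/
theorem IsRowHom.exists_row_eq (h : IsRowHom u v Ψ) {b : ℕ} (hw : w * v = u ^ b + 1) {x : K}
    (hx : x ∈ monomialSpan univ univ u w) (N : ℕ) :
    ∃ G ∈ monomialSpan univ {0} u v,
      HahnSeries.C ((Ψ x).coeff (-N)) = Ψ ((1 + u ^ b) ^ N * G) := by
  refine monomialSpan_induction (p := fun x => ∃ G ∈ monomialSpan univ {0} u v,
    HahnSeries.C ((Ψ x).coeff (-N)) = Ψ ((1 + u ^ b) ^ N * G)) ?_ ⟨0, zero_mem _, by simp⟩ ?_ ?_ hx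
  · intro i _ k _
    rw [h.map_mutated_monomial hw]
    rcases eq_or_ne (-(N : ℤ)) (-k) with e | hne
    · obtain rfl : k = N := by omega
      refine ⟨u ^ i, zpow_left_mem (by simp) (by simp), ?_⟩
      rw [HahnSeries.coeff_single_same, zpow_natCast, RingHom.map_mul, RingHom.map_mul,
        h.map_left_zpow, RingHom.map_pow, RingHom.map_pow, RingHom.map_add, RingHom.map_add,
        RingHom.map_one, RingHom.map_one, RingHom.map_pow, RingHom.map_pow, h.map_left]
    · exact ⟨0, zero_mem _, by rw [HahnSeries.coeff_single_of_ne hne]; simp⟩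
  · rintro x y ⟨G, hG, e⟩ ⟨G', hG', e'⟩
    exact ⟨G + G', add_mem hG hG', by
      rw [map_add, HahnSeries.coeff_add, map_add, e, e', mul_add, map_add]⟩
  · rintro x ⟨G, hG, e⟩
    exact ⟨-G, neg_mem hG, by rw [map_neg, HahnSeries.coeff_neg, map_neg, e, mul_neg, map_neg]⟩

/-- A Laurent polynomial in `u` is a polynomial if its product with `(1 + u ^ b) ^ N` is. -/
theorem IsRowHom.mem_of_mul_mem (h : IsRowHom u v Ψ) {b : ℕ} (hb : 0 < b) (N : ℕ) {G : K}
    (hG : G ∈ monomialSpan univ {0} u v)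
    (hmul : (1 + u ^ b) ^ N * G ∈ monomialSpan (Ici 0) {0} u v) :
    G ∈ monomialSpan (Ici 0) {0} u v := by
  have hu := h.left_ne_zero
  have hv := h.right_ne_zero
  rw [monomialSpan_swap] at hG
  obtain ⟨k, hk⟩ := exists_mem_Ici hG
  clear hG
  induction k with
  | zero => rw [monomialSpan_swap]; simpa using hk
  | succ k ih =>
    apply ih
    obtain ⟨P, hP, hrest⟩ := exists_bottom_row hk
    obtain ⟨e, he⟩ : ∃ e : ℤ, P = (e : K) := by
      refine monomialSpan_induction (p := fun P => ∃ e : ℤ, P = (e : K)) ?_ ⟨0, by simp⟩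
        (fun x y ⟨p, hp⟩ ⟨q, hq⟩ => ⟨p + q, by simp [hp, hq]⟩)
        (fun x ⟨p, hp⟩ => ⟨-p, by simp [hp]⟩) hP
      rintro i rfl j rfl
      exact ⟨1, by simp⟩
    set M : ℤ := -((k + 1 : ℕ) : ℤ) with hM
    rw [monomialSpan_swap] at hrest
    -- As (1+u^b)^N has constant term 1, the product has the same lowest coefficient e as G. Its
    -- exponent M is negative, so e = 0.
    have h1 : (1 + u ^ b) ^ N * G - e * u ^ M ∈ monomialSpan (Ici (M + 1)) {0} u v := by
      have e1 : (1 + u ^ b) ^ N * G - e * u ^ M = (1 + u ^ b) ^ N * (G - P * u ^ M) +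
          ((1 + u ^ b) ^ N - 1) * (e * u ^ M) := by rw [he]; ring
      rw [e1]
      refine add_mem (mul_mem_monomialSpan hu hv (I := Ici 0) (J := {0}) ?_ (by simp)
        (one_add_pow_mem hu hv b N) hrest)
        (mul_mem_monomialSpan hu hv (I := Ici 1) (J := {0}) (I' := Ici M) (J' := {0}) ?_ (by simp)
          (one_add_pow_sub_one_mem hu hv hb N) ?_)
      · intro i hi i' hi'
        simp only [mem_Ici] at *
        omega
      · intro i hi i' hi'
        simp only [mem_Ici] at *
        omega
      · rw [← zsmul_eq_mul]
        exact Submodule.smul_mem _ _ (zpow_left_mem (by simp) (by simp))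
    have h2 := h.coeff_eq_zero h1 (i := M) (j := 0) (.inl (by simp))
    have h3 := h.coeff_eq_zero hmul (i := M) (j := 0) (.inl (by simp only [mem_Ici]; omega))
    rw [map_sub, HahnSeries.coeff_sub, HahnSeries.coeff_sub, h3, ← zsmul_eq_mul, map_zsmul,
      h.map_left_zpow, HahnSeries.C_apply] at h2
    have h4 : e = 0 := by
      have h5 := map_zsmul (biCoeff M 0) e (HahnSeries.single 0 (HahnSeries.single M 1))
      simp only [biCoeff, AddMonoidHom.coe_mk, ZeroHom.coe_mk] at h5
      rw [h5, HahnSeries.coeff_single_same, HahnSeries.coeff_single_same] at h2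
      simpa using h2
    rw [he, h4, Int.cast_zero, zero_mul, sub_zero, monomialSpan_swap] at hrest
    convert hrest using 3
    omega

/-- Rows with negative powers of v are removed from the bottom. The lowest row is (1+u^b)^(N+1)
times some G with exponents in I, and `hV` provides elements of V with every such lowest row; they
also lie in U, so the difference stays in U. -/
theorem le_of_rows (h : IsRowHom u v Ψ) {b : ℕ} (hw : w * v = u ^ b + 1) {U V : Submodule ℤ K}
    (hU : U ≤ monomialSpan univ univ u w) (hI : ∀ (N : ℕ), ∀ G ∈ monomialSpan univ {0} u v,
      (1 + u ^ b) ^ N * G ∈ monomialSpan I {0} u v → G ∈ monomialSpan I {0} u v)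
    (hV : ∀ i ∈ I, ∀ N : ℕ, ∃ y ∈ V ⊓ U, y - (1 + u ^ b) ^ (N + 1) * u ^ i * v ^ (-(N + 1 : ℤ)) ∈
      monomialSpan I (Ici (-(N : ℤ))) u v)
    (hbase : monomialSpan I (Ici 0) u v ⊓ U ≤ V) :
    monomialSpan I univ u v ⊓ U ≤ V := by
  have hu := h.left_ne_zero
  have hv := h.right_ne_zero
  rintro x ⟨hx, hxU⟩
  obtain ⟨N, hN⟩ := exists_mem_Ici hx
  clear hx
  induction N generalizing x with
  | zero => exact hbase ⟨by simpa using hN, hxU⟩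
  | succ N ih =>
    have e1 : (-((N + 1 : ℕ) : ℤ)) = -(N + 1 : ℤ) := by push_cast; ring
    rw [e1] at hN
    obtain ⟨P, hP, hrest⟩ := exists_bottom_row hN
    rw [show -(N + 1 : ℤ) + 1 = -N by ring] at hrest
    obtain ⟨G, hG, hrow⟩ := h.exists_row_eq hw (hU hxU) (N + 1)
    rw [e1] at hrow
    obtain ⟨r, hr⟩ := h.map_row hP
    have h1 := h.row_eq_zero hrest (j := -(N + 1 : ℤ)) (by simp only [mem_Ici]; omega)
    rw [map_sub, map_mul, h.map_right_zpow, hr, HahnSeries.C_apply, HahnSeries.single_mul_single,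
      HahnSeries.coeff_sub, zero_add, HahnSeries.coeff_single_same, mul_one, sub_eq_zero] at h1
    rw [h1, ← hr] at hrow
    have hPG := Ψ.injective hrow
    have hGI := hI (N + 1) G hG (by rwa [← hPG])
    obtain ⟨y, hy, hyG⟩ : ∃ y ∈ V ⊓ U, y - (1 + u ^ b) ^ (N + 1) * G * v ^ (-(N + 1 : ℤ)) ∈
        monomialSpan I (Ici (-(N : ℤ))) u v := by
      refine monomialSpan_induction (p := fun G => ∃ y ∈ V ⊓ U,
        y - (1 + u ^ b) ^ (N + 1) * G * v ^ (-(N + 1 : ℤ)) ∈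
          monomialSpan I (Ici (-(N : ℤ))) u v) ?_ ⟨0, zero_mem _, by simp⟩ ?_ ?_ hGI
      · rintro i hi j rfl
        simpa using hV i hi N
      · rintro x x' ⟨y, hy, h1⟩ ⟨y', hy', h1'⟩
        refine ⟨y + y', add_mem hy hy', ?_⟩
        convert add_mem h1 h1' using 1
        ring
      · rintro x ⟨y, hy, h1⟩
        refine ⟨-y, neg_mem hy, ?_⟩
        convert neg_mem h1 using 1
        ring
    have h2 : x - y ∈ monomialSpan I (Ici (-(N : ℤ))) u v := by
      convert sub_mem hrest hyG using 1
      rw [hPG]; ring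
    have h3 := ih (sub_mem hxU hy.2) h2
    simpa using add_mem h3 hy.1

/-- A criterion for a module `V` to contain all elements `x` that are Laurent polynomials at
three consecutive clusters. -/
theorem le_of_standard {u' : K} {Ψ' : K →+* LaurentSeries (LaurentSeries ℚ)}
    (h : IsRowHom u v Ψ) (h' : IsRowHom v u Ψ') {b c : ℕ} (hc : 0 < c)
    (hw : w * v = u ^ b + 1) (hu' : u' * u = v ^ c + 1) {U V : Submodule ℤ K}
    (hU₀ : U ≤ monomialSpan univ univ u w) (hU₁ : U ≤ monomialSpan univ univ u v)
    (hU₂ : U ≤ monomialSpan univ univ v u')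
    (hrow : ∀ (i : ℤ) (N : ℕ), ∃ y ∈ V ⊓ U,
      y - (1 + u ^ b) ^ (N + 1) * u ^ i * v ^ (-(N + 1 : ℤ)) ∈
        monomialSpan univ (Ici (-(N : ℤ))) u v)
    (hcol : ∀ (j N : ℕ), (1 + v ^ c) ^ (N + 1) * v ^ j * u ^ (-(N + 1 : ℤ)) ∈ V ⊓ U)
    (hmon : ∀ i j : ℕ, u ^ i * v ^ j ∈ V) : U ≤ V := by
  -- Elements polynomial in v come first: their columns with negative powers of u are removed, and
  -- by `IsRowHom.mem_of_mul_mem` the quotients stay polynomial in v. This is the base case for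
  -- removing the negative rows of general elements.
  have hcols : monomialSpan (Ici 0) univ v u ⊓ U ≤ V := by
    refine le_of_rows h' hu' hU₂ (fun N G hG hmul => h'.mem_of_mul_mem hc N hG hmul) ?_ ?_
    · intro i hi N
      refine ⟨_, hcol i.toNat N, ?_⟩
      rw [← zpow_natCast v i.toNat, Int.toNat_of_nonneg hi, sub_self]
      exact zero_mem _
    · rintro x ⟨hx, -⟩
      refine Submodule.span_le.2 ?_ hx
      rintro _ ⟨i, hi, j, hj, rfl⟩
      have := hmon j.toNat i.toNat
      rw [← zpow_natCast, ← zpow_natCast, Int.toNat_of_nonneg hi, Int.toNat_of_nonneg hj,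
        mul_comm] at this
      exact this
  rw [monomialSpan_swap] at hcols
  exact fun x hx => le_of_rows h hw hU₀ (fun N G hG _ => hG) (fun i _ N => hrow i N) hcols
    ⟨hU₁ hx, hx⟩

end

/-! ### Pointedness, positivity and indecomposability -/

section

variable {K : Type*} [Field K] {u v w : K} {b c : ℕ} {a : ℤ × ℤ}

theorem greedyElement_of_nonpos (hb : 0 < b) (hc : 0 < c) (hv : v ≠ 0) (ha : a.1 ≤ 0) :
    greedyElement b c a u v = (1 + u ^ b) ^ a.2.toNat * u ^ (-a.1) * v ^ (-a.2) := by
  rw [greedyElement_eq_rows hb hc hv, show a.1.toNat = 0 by omega, zero_add,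
    Finset.sum_range_one, greedyRow_zero hb hc, map_one, Nat.cast_zero, mul_zero, sub_zero]
  ring

theorem greedyElement_neg (hb : 0 < b) (hc : 0 < c) (hv : v ≠ 0) (d₁ d₂ : ℕ) :
    greedyElement b c (-(d₁ : ℤ), -(d₂ : ℤ)) u v = u ^ d₁ * v ^ d₂ := by
  rw [greedyElement_of_nonpos hb hc hv (by simp)]
  simp

theorem greedyElement_eq_sum (hu : u ≠ 0) (hv : v ≠ 0) :
    greedyElement b c a u v = ∑ q ∈ Finset.range (a.1.toNat + 1),
      ∑ p ∈ Finset.range (a.2.toNat + 1),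
        (greedyCoeff b c a p q : K) * (u ^ (-a.1 + b * p) * v ^ (-a.2 + c * q)) := by
  rw [greedyElement, Finset.mul_sum]
  refine Finset.sum_congr rfl fun q _ => ?_
  rw [Finset.mul_sum]
  refine Finset.sum_congr rfl fun p _ => ?_
  rw [zpow_add₀ hu, zpow_add₀ hv, ← Nat.cast_mul, ← Nat.cast_mul, zpow_natCast, zpow_natCast]
  ring

theorem greedyElement_mem (hu : u ≠ 0) (hv : v ≠ 0) :
    greedyElement b c a u v ∈ monomialSpan univ univ u v := by
  rw [greedyElement_eq_sum hu hv]
  refine sum_mem fun q _ => sum_mem fun p _ => ?_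
  rw [← nsmul_eq_mul]
  exact nsmul_mem (monomial_mem (mem_univ _) (mem_univ _)) _

theorem aeval_mem_monomialSpan (u v : K) (b : ℕ) (P : Polynomial ℕ) :
    Polynomial.aeval (u ^ b) P ∈ monomialSpan univ {0} u v := by
  induction P using Polynomial.induction_on' with
  | add P Q hP hQ => rw [map_add]; exact add_mem hP hQ
  | monomial n r =>
    rw [Polynomial.aeval_monomial, eq_natCast, ← nsmul_eq_mul, ← pow_mul, ← zpow_natCast]
    exact nsmul_mem (zpow_left_mem (mem_univ _) (by simp)) _

/-- The bottom row of a greedy element. -/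
theorem greedyElement_sub_mem (hb : 0 < b) (hc : 0 < c) (hu : u ≠ 0) (hv : v ≠ 0) (i : ℤ)
    (N : ℕ) : greedyElement b c (-i, N + 1) u v -
      (1 + u ^ b) ^ (N + 1) * u ^ i * v ^ (-(N + 1 : ℤ)) ∈
        monomialSpan univ (Ici (-(N : ℤ))) u v := by
  rw [greedyElement_eq_rows hb hc hv, Finset.sum_range_succ', greedyRow_zero hb hc, map_one,
    Nat.cast_zero, mul_zero, sub_zero, neg_neg]
  have e : ((N + 1 : ℤ)).toNat = N + 1 := by omega
  rw [e, add_sub_assoc]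
  refine add_mem (sum_mem fun q _ => ?_) ?_
  · refine mul_mem_monomialSpan hu hv (I := univ) (J := Ici (-(N : ℤ))) (I' := univ) (J' := {0})
      (by simp) (by simp) (mul_mem_monomialSpan hu hv (I := univ) (J := Ici (-(N : ℤ)))
        (I' := univ) (J' := {0}) (by simp) (by simp) (monomial_mem (mem_univ _) ?_)
        (monomialSpan_mono (subset_univ _) le_rfl (one_add_pow_mem hu hv b _)))
      (aeval_mem_monomialSpan u v b _)
    simp only [mem_Ici]
    push_cast
    have : (1 : ℤ) ≤ c := by exact_mod_cast hc
    nlinarith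
  · convert zero_mem (monomialSpan univ (Ici (-(N : ℤ))) u v) using 1
    ring

/-- An element with non-negative coefficients in its Laurent expansion. -/
def IsNonnegLaurent (u v x : K) : Prop :=
  ∃ f : ℤ × ℤ →₀ ℤ, (∀ i, 0 ≤ f i) ∧
    x = f.sum fun i n => (n : K) * u ^ i.1 * v ^ i.2

theorem IsNonnegLaurent.add {x y : K} (hx : IsNonnegLaurent u v x) (hy : IsNonnegLaurent u v y) :
    IsNonnegLaurent u v (x + y) := by
  obtain ⟨f, hf, rfl⟩ := hx
  obtain ⟨g, hg, rfl⟩ := hy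
  refine ⟨f + g, fun i => add_nonneg (hf i) (hg i), ?_⟩
  rw [Finsupp.sum_add_index' (by simp) (fun i m n => by push_cast; ring)]

theorem isNonnegLaurent_zero : IsNonnegLaurent u v 0 := ⟨0, by simp, by simp⟩

theorem isNonnegLaurent_monomial (n : ℕ) (i j : ℤ) :
    IsNonnegLaurent u v ((n : K) * (u ^ i * v ^ j)) := by
  refine ⟨Finsupp.single (i, j) n, fun k => ?_, ?_⟩
  · rw [Finsupp.single_apply]
    split_ifs <;> simp
  · rw [Finsupp.sum_single_index (by simp)]
    push_cast
    ring

theorem isNonnegLaurent_greedyElement (hu : u ≠ 0) (hv : v ≠ 0) :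
    IsNonnegLaurent u v (greedyElement b c a u v) := by
  rw [greedyElement_eq_sum hu hv]
  exact Finset.sum_induction _ _ (fun _ _ => IsNonnegLaurent.add) isNonnegLaurent_zero fun q _ =>
    Finset.sum_induction _ _ (fun _ _ => IsNonnegLaurent.add) isNonnegLaurent_zero fun p _ =>
      isNonnegLaurent_monomial _ _ _

theorem IsNonnegLaurent.induction {p : K → Prop} (hzero : p 0)
    (hadd : ∀ x y, p x → p y → p (x + y)) (hmon : ∀ i j : ℤ, p (u ^ i * v ^ j)) {x : K}
    (hx : IsNonnegLaurent u v x) : p x := by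
  obtain ⟨f, hf, rfl⟩ := hx
  refine Finset.sum_induction _ p hadd hzero fun i _ => ?_
  obtain ⟨n, hn⟩ := Int.eq_ofNat_of_zero_le (hf i)
  simp only [hn, Int.cast_natCast]
  rw [mul_assoc, ← nsmul_eq_mul]
  clear hn
  induction n with
  | zero => simpa using hzero
  | succ n ih => rw [succ_nsmul]; exact hadd _ _ ih (hmon _ _)

variable {Ψ : K →+* LaurentSeries (LaurentSeries ℚ)}

theorem IsRowHom.biCoeff_monomial (h : IsRowHom u v Ψ) (n : ℤ) (i j i' j' : ℤ) :
    biCoeff i j (Ψ ((n : K) * (u ^ i' * v ^ j'))) = if i = i' ∧ j = j' then (n : ℚ) else 0 := by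
  rw [← zsmul_eq_mul, map_zsmul, map_zsmul, h.map_monomial]
  simp only [biCoeff, AddMonoidHom.coe_mk, ZeroHom.coe_mk]
  by_cases h1 : j = j'
  · by_cases h2 : i = i'
    · simp [h1, h2]
    · simp [h1, h2]
  · simp [h1]

theorem IsRowHom.biCoeff_sum (h : IsRowHom u v Ψ) (f : ℤ × ℤ →₀ ℤ) (i j : ℤ) :
    biCoeff i j (Ψ (f.sum fun i n => (n : K) * u ^ i.1 * v ^ i.2)) = f (i, j) := by
  rw [Finsupp.sum, map_sum, map_sum]
  simp only [mul_assoc, h.biCoeff_monomial]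
  have e : ∀ x : ℤ × ℤ, (i = x.1 ∧ j = x.2) ↔ (i, j) = x := fun x => by
    rw [Prod.ext_iff]
  simp only [e]
  rw [Finset.sum_ite_eq]
  split_ifs with h1
  · rfl
  · rw [Finsupp.notMem_support_iff.1 h1, Int.cast_zero]

theorem IsRowHom.biCoeff_greedyElement (h : IsRowHom u v Ψ) (i j : ℤ) :
    biCoeff i j (Ψ (greedyElement b c a u v)) = ∑ q ∈ Finset.range (a.1.toNat + 1),
      ∑ p ∈ Finset.range (a.2.toNat + 1),
        if i = -a.1 + b * p ∧ j = -a.2 + c * q then (greedyCoeff b c a p q : ℚ) else 0 := by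
  rw [greedyElement_eq_sum h.left_ne_zero h.right_ne_zero, map_sum, map_sum]
  refine Finset.sum_congr rfl fun q _ => ?_
  rw [map_sum, map_sum]
  refine Finset.sum_congr rfl fun p _ => ?_
  have := h.biCoeff_monomial (greedyCoeff b c a p q : ℤ) i j (-a.1 + b * p) (-a.2 + c * q)
  simpa only [Int.cast_natCast] using this

theorem IsRowHom.biCoeff_greedyElement_self (h : IsRowHom u v Ψ) (hb : 0 < b) (hc : 0 < c) :
    biCoeff (-a.1) (-a.2) (Ψ (greedyElement b c a u v)) = 1 := by
  rw [h.biCoeff_greedyElement, Finset.sum_eq_single 0, Finset.sum_eq_single 0]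
  · simp [greedyCoeff_zero_zero hb hc]
  · intro p _ hp
    rw [if_neg]
    rintro ⟨h1, -⟩
    have : 0 < (b : ℤ) * p := by
      have := Nat.pos_of_ne_zero hp
      positivity
    omega
  · simp
  · intro q _ hq
    refine Finset.sum_eq_zero fun p _ => if_neg ?_
    rintro ⟨-, h1⟩
    have : 0 < (c : ℤ) * q := by
      have := Nat.pos_of_ne_zero hq
      positivity
    omega
  · simp

theorem IsRowHom.exists_of_biCoeff_ne_zero (h : IsRowHom u v Ψ) {i j : ℤ}
    (hne : biCoeff i j (Ψ (greedyElement b c a u v)) ≠ 0) :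
    ∃ p q : ℕ, q ≤ a.1.toNat ∧ p ≤ a.2.toNat ∧ i = -a.1 + b * p ∧ j = -a.2 + c * q := by
  rw [h.biCoeff_greedyElement] at hne
  obtain ⟨q, hq, hne⟩ := Finset.exists_ne_zero_of_sum_ne_zero hne
  obtain ⟨p, hp, hne⟩ := Finset.exists_ne_zero_of_sum_ne_zero hne
  rw [Finset.mem_range] at hp hq
  refine ⟨p, q, by omega, by omega, ?_⟩
  by_contra hcon
  exact hne (if_neg hcon)

/-- The rows of the Laurent expansion of a greedy element. -/
theorem IsRowHom.row_greedyElement (h : IsRowHom u v Ψ) (hb : 0 < b) (hc : 0 < c) {q : ℕ}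
    (hq : q ≤ a.1.toNat) : (Ψ (greedyElement b c a u v)).coeff (-(a.2 - c * q)) =
      (1 + HahnSeries.single 1 1 ^ b) ^ (a.2 - c * q).toNat *
        (HahnSeries.single (-a.1) 1 *
          Polynomial.aeval (HahnSeries.single 1 1 ^ b) (greedyRow b c a q)) := by
  have haev : ∀ P : Polynomial ℕ, Ψ (Polynomial.aeval (u ^ b) P) =
      HahnSeries.C (Polynomial.aeval (HahnSeries.single 1 1 ^ b) P) := by
    intro P
    induction P using Polynomial.induction_on' with
    | add P Q hP hQ => rw [map_add, RingHom.map_add, hP, hQ, map_add, RingHom.map_add]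
    | monomial n r =>
      rw [Polynomial.aeval_monomial, Polynomial.aeval_monomial, eq_natCast, eq_natCast,
        RingHom.map_mul, RingHom.map_mul, map_natCast, map_natCast, RingHom.map_pow,
        RingHom.map_pow, RingHom.map_pow, RingHom.map_pow, h.map_left]
  have hrow : ∀ q' : ℕ, Ψ (u ^ (-a.1) * v ^ (-(a.2 - c * q')) *
      (1 + u ^ b) ^ (a.2 - c * q').toNat * Polynomial.aeval (u ^ b) (greedyRow b c a q')) =
      HahnSeries.single (-(a.2 - c * q')) ((1 + HahnSeries.single 1 1 ^ b) ^ (a.2 - c * q').toNat *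
        (HahnSeries.single (-a.1) 1 *
          Polynomial.aeval (HahnSeries.single 1 1 ^ b) (greedyRow b c a q'))) := by
    intro q'
    have h1 : Ψ (1 + u ^ b) = HahnSeries.C (1 + HahnSeries.single 1 1 ^ b) := by
      rw [RingHom.map_add, RingHom.map_one, RingHom.map_pow, h.map_left, RingHom.map_add,
        RingHom.map_one, RingHom.map_pow]
    rw [show ∀ A B C D : K, A * B * C * D = (C * (A * D)) * B by intros; ring, RingHom.map_mul,
      RingHom.map_mul, RingHom.map_mul, RingHom.map_pow, haev, h1, h.map_left_zpow,
      h.map_right_zpow, ← RingHom.map_pow, ← RingHom.map_mul, ← RingHom.map_mul, HahnSeries.C_apply,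
      HahnSeries.single_mul_single, zero_add, mul_one]
  rw [greedyElement_eq_rows hb hc h.right_ne_zero, map_sum, HahnSeries.coeff_sum,
    Finset.sum_eq_single q]
  · rw [hrow, HahnSeries.coeff_single_same]
  · intro q' _ hne
    rw [hrow, HahnSeries.coeff_single_of_ne]
    intro e
    have h2 : (c : ℤ) * q = c * q' := by omega
    have h3 := mul_left_cancel₀ (by exact_mod_cast hc.ne') h2
    exact hne (by exact_mod_cast h3.symm)
  · intro h1
    exact absurd (Finset.mem_range.2 (by omega)) h1

theorem exists_of_coeff_aeval_ne_zero {P : Polynomial ℕ} {i j : ℤ}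
    (h : (HahnSeries.single i 1 * Polynomial.aeval
      ((HahnSeries.single 1 1 : LaurentSeries ℚ) ^ b) P).coeff j ≠ 0) :
    ∃ p : ℕ, j = i + b * p ∧ P.coeff p ≠ 0 := by
  induction P using Polynomial.induction_on' with
  | add P Q hP hQ =>
    rw [map_add, mul_add, HahnSeries.coeff_add] at h
    by_cases h1 : (HahnSeries.single i 1 * Polynomial.aeval
      ((HahnSeries.single 1 1 : LaurentSeries ℚ) ^ b) P).coeff j = 0
    · rw [h1, zero_add] at h
      obtain ⟨p, e, hp⟩ := hQ h
      exact ⟨p, e, by rw [Polynomial.coeff_add]; omega⟩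
    · obtain ⟨p, e, hp⟩ := hP h1
      exact ⟨p, e, by rw [Polynomial.coeff_add]; omega⟩
  | monomial n r =>
    rw [Polynomial.aeval_monomial, eq_natCast, ← map_natCast (HahnSeries.C (Γ := ℤ) (R := ℚ)),
      HahnSeries.C_apply, HahnSeries.single_pow, HahnSeries.single_pow,
      HahnSeries.single_mul_single, HahnSeries.single_mul_single] at h
    have hj : j = i + b * n := by
      by_contra hne
      exact h (HahnSeries.coeff_single_of_ne (by simpa [mul_comm] using hne))
    refine ⟨n, hj, ?_⟩
    rw [Polynomial.coeff_monomial_same]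
    rintro rfl
    simp at h

theorem coeff_one_add_mul (g : LaurentSeries ℚ) (b : ℕ) (i : ℤ) :
    ((1 + HahnSeries.single 1 1 ^ b) * g).coeff i = g.coeff i + g.coeff (i - b) := by
  rw [add_mul, one_mul, HahnSeries.coeff_add, HahnSeries.single_pow, HahnSeries.coeff_single_mul]
  simp

theorem coeff_one_add_pow_mul_nonneg {g : LaurentSeries ℚ} (hg : ∀ i, 0 ≤ g.coeff i) (b N : ℕ)
    (i : ℤ) : g.coeff i ≤ ((1 + HahnSeries.single 1 1 ^ b) ^ N * g).coeff i := by
  induction N generalizing i with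
  | zero => simp
  | succ N ih =>
    rw [pow_succ', mul_assoc, coeff_one_add_mul]
    have := ih i
    have := (hg (i - b)).trans (ih (i - b))
    linarith

theorem coeff_one_add_pow_mul_eq_zero {g : LaurentSeries ℚ} {b : ℕ} {i : ℤ}
    (hg : ∀ k : ℕ, g.coeff (i - b * k) = 0) (N : ℕ) :
    ((1 + HahnSeries.single 1 1 ^ b) ^ N * g).coeff i = 0 := by
  induction N generalizing i with
  | zero => simpa using hg 0
  | succ N ih =>
    rw [pow_succ', mul_assoc, coeff_one_add_mul, ih hg, ih, add_zero]
    intro k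
    have := hg (k + 1)
    rwa [show i - b * ((k + 1 : ℕ) : ℤ) = i - b - b * k by push_cast; ring] at this

theorem one_add_single_ne_zero (hb : 0 < b) :
    (1 + HahnSeries.single 1 1 ^ b : LaurentSeries ℚ) ≠ 0 := by
  intro h
  have h1 := coeff_one_add_mul 1 b 0
  rw [h, zero_mul] at h1
  have h2 : (1 : LaurentSeries ℚ).coeff 0 = 1 := by simp
  have h3 : (1 : LaurentSeries ℚ).coeff (0 - b) = 0 := by
    rw [HahnSeries.coeff_one, if_neg (by omega)]
  rw [h2, h3] at h1
  simp at h1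

/-- Rows of elements that have non-negative coefficients after mutation. -/
theorem IsRowHom.exists_row_of_isNonnegLaurent (h : IsRowHom u v Ψ) (hw : w * v = u ^ b + 1)
    {x : K} (hx : IsNonnegLaurent u w x) (N : ℕ) : ∃ g : LaurentSeries ℚ, (∀ i, 0 ≤ g.coeff i) ∧
      (Ψ x).coeff (-N) = (1 + HahnSeries.single 1 1 ^ b) ^ N * g := by
  refine hx.induction (p := fun x => ∃ g : LaurentSeries ℚ, (∀ i, 0 ≤ g.coeff i) ∧
      (Ψ x).coeff (-N) = (1 + HahnSeries.single 1 1 ^ b) ^ N * g)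
    ⟨0, by simp, by simp⟩ ?_ ?_
  · rintro x y ⟨g, hg, e⟩ ⟨g', hg', e'⟩
    exact ⟨g + g', fun i => add_nonneg (hg i) (hg' i), by
      rw [map_add, HahnSeries.coeff_add, e, e', mul_add]⟩
  · intro i k
    rw [h.map_mutated_monomial hw]
    rcases eq_or_ne (-(N : ℤ)) (-k) with e | hne
    · obtain rfl : k = N := by omega
      refine ⟨HahnSeries.single i 1, fun j => ?_, by
        rw [HahnSeries.coeff_single_same, zpow_natCast]⟩
      rw [HahnSeries.coeff_single]
      split_ifs <;> simp
    · exact ⟨0, by simp, by rw [HahnSeries.coeff_single_of_ne hne, mul_zero]⟩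

/-- In a decomposition of a greedy element, the support of a summand has another point in the same
row if it has one where the coefficient after mutation vanishes. -/
theorem IsRowHom.exists_smaller (h : IsRowHom u v Ψ) (hb : 0 < b) (hc : 0 < c)
    (hw : w * v = u ^ b + 1) {y y' : K} (hyy : greedyElement b c a u v = y + y')
    (hy : IsNonnegLaurent u v y)
    (hyw : IsNonnegLaurent u w y) (hyw' : IsNonnegLaurent u w y') {p q : ℕ}
    (hq : q ≤ a.1.toNat) (hD : greedyQuot b c a p q = 0)
    (hpos : 0 < biCoeff (-a.1 + b * p) (-a.2 + c * q) (Ψ y')) :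
    ∃ p' < p, 0 < biCoeff (-a.1 + b * p') (-a.2 + c * q) (Ψ y') := by
  have hnonneg : ∀ {x : K}, IsNonnegLaurent u v x → ∀ i j, 0 ≤ biCoeff i j (Ψ x) := by
    rintro _ ⟨f, hf, rfl⟩ i j
    rw [h.biCoeff_sum]
    exact_mod_cast hf _
  have hrow := h.row_greedyElement (a := a) hb hc hq
  set ρ : LaurentSeries ℚ := HahnSeries.single (-a.1) 1 *
    Polynomial.aeval (HahnSeries.single 1 1 ^ b) (greedyRow b c a q) with hρ
  have hρ0 : ρ.coeff (-a.1 + b * p) = 0 := by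
    by_contra hne
    obtain ⟨p', e, hp'⟩ := exists_of_coeff_aeval_ne_zero hne
    have h3 := mul_left_cancel₀ (by exact_mod_cast hb.ne') (add_left_cancel e)
    rw [coeff_greedyRow hb hc, ← (by exact_mod_cast h3 : p = p')] at hp'
    exact hp' hD
  have hsum : ∀ i j, biCoeff i j (Ψ (greedyElement b c a u v)) =
      biCoeff i j (Ψ y) + biCoeff i j (Ψ y') := fun i j => by rw [hyy, map_add, map_add]
  have hrowcoeff : ∀ (x : K) (i : ℤ), biCoeff i (-a.2 + c * q) (Ψ x) =
      ((Ψ x).coeff (-(a.2 - c * q))).coeff i := fun x i => by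
    rw [show -(a.2 - c * q) = -a.2 + c * q by ring]; rfl
  rcases le_or_gt a.2 (c * q) with hle | hgt
  -- Here the power of 1 + u^b is trivial and the row is ρ itself, so there is no room for a
  -- positive coefficient at p.
  · exfalso
    rw [show (a.2 - c * q).toNat = 0 by omega, pow_zero, one_mul] at hrow
    have h1 := hsum (-a.1 + b * p) (-a.2 + c * q)
    rw [hrowcoeff, hrow, hρ0] at h1
    have := hnonneg hy (-a.1 + b * p) (-a.2 + c * q)
    linarith
  · obtain ⟨N, hN⟩ : ∃ N : ℕ, a.2 - c * q = N := ⟨(a.2 - c * q).toNat, by omega⟩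
    rw [hN, Int.toNat_natCast] at hrow
    rw [hN] at hrowcoeff
    obtain ⟨g, hg, eg⟩ := h.exists_row_of_isNonnegLaurent hw hyw N
    obtain ⟨g', hg', eg'⟩ := h.exists_row_of_isNonnegLaurent hw hyw' N
    rw [hyy, map_add, HahnSeries.coeff_add, eg, eg', ← mul_add] at hrow
    have hgg := mul_left_cancel₀ (pow_ne_zero N (one_add_single_ne_zero hb)) hrow
    -- After cancelling (1+u^b)^N, two non-negative rows add up to ρ, which vanishes at p. A
    -- positive coefficient of y' there must therefore come from a smaller exponent of g'.
    have h0 : g'.coeff (-a.1 + b * p) = 0 := by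
      have h1 := congrArg (fun f => HahnSeries.coeff f (-a.1 + b * p)) hgg
      simp only [HahnSeries.coeff_add, hρ0] at h1
      have := hg (-a.1 + b * p)
      have := hg' (-a.1 + b * p)
      linarith
    have hex : ∃ k : ℕ, g'.coeff (-a.1 + b * p - b * k) ≠ 0 := by
      by_contra! hcon
      rw [hrowcoeff, eg', coeff_one_add_pow_mul_eq_zero hcon] at hpos
      exact lt_irrefl _ hpos
    obtain ⟨k, hk⟩ := hex
    have hkpos : 0 < biCoeff (-a.1 + b * p - b * k) (-a.2 + c * q) (Ψ y') := by
      rw [hrowcoeff, eg']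
      exact ((hg' _).lt_of_ne hk.symm).trans_le (coeff_one_add_pow_mul_nonneg hg' b N _)
    have hz : biCoeff (-a.1 + b * p - b * k) (-a.2 + c * q) (Ψ (greedyElement b c a u v)) ≠ 0 := by
      rw [hsum]
      have := hnonneg hy (-a.1 + b * p - b * k) (-a.2 + c * q)
      linarith
    -- Both summands are non-negative, so this point lies in the support of the greedy element;
    -- hence p - k is again a natural number.
    obtain ⟨p', q', -, -, e, -⟩ := h.exists_of_biCoeff_ne_zero hz
    have h3 : (b : ℤ) * (p - k) = b * p' := by linarith
    have h4 := mul_left_cancel₀ (by exact_mod_cast hb.ne') h3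
    have hk0 : k ≠ 0 := by
      rintro rfl
      apply hk
      simpa using h0
    refine ⟨p', by omega, ?_⟩
    rw [← e]
    exact hkpos

end

section

variable {K : Type*} [Field K] {u v w u' : K} {b c : ℕ} {a : ℤ × ℤ}
  {Ψ Ψ' : K →+* LaurentSeries (LaurentSeries ℚ)}

theorem IsNonnegLaurent.swap {x : K} (hx : IsNonnegLaurent u v x) : IsNonnegLaurent v u x := by
  refine hx.induction isNonnegLaurent_zero (fun _ _ => IsNonnegLaurent.add) fun i j => ?_
  simpa [mul_comm] using isNonnegLaurent_monomial (u := v) (v := u) 1 j i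

theorem IsNonnegLaurent.biCoeff_swap (h : IsRowHom u v Ψ) (h' : IsRowHom v u Ψ') {x : K}
    (hx : IsNonnegLaurent u v x) (i j : ℤ) : biCoeff j i (Ψ' x) = biCoeff i j (Ψ x) := by
  refine hx.induction (p := fun x => biCoeff j i (Ψ' x) = biCoeff i j (Ψ x)) (by simp)
    (fun x y hx hy => by rw [map_add, map_add, hx, hy, map_add, map_add]) fun k l => ?_
  have h1 := h.biCoeff_monomial 1 i j k l
  have h2 := h'.biCoeff_monomial 1 j i l k
  rw [Int.cast_one, one_mul] at h1 h2
  rw [h1, mul_comm, h2]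
  simp only [and_comm]

theorem IsNonnegLaurent.biCoeff_nonneg (h : IsRowHom u v Ψ) {x : K}
    (hx : IsNonnegLaurent u v x) (i j : ℤ) : 0 ≤ biCoeff i j (Ψ x) := by
  obtain ⟨f, hf, rfl⟩ := hx
  rw [h.biCoeff_sum]
  exact_mod_cast hf _

theorem IsNonnegLaurent.eq_zero (h : IsRowHom u v Ψ) {x : K} (hx : IsNonnegLaurent u v x)
    (h0 : ∀ i j, biCoeff i j (Ψ x) = 0) : x = 0 := by
  obtain ⟨f, hf, rfl⟩ := hx
  have : f = 0 := by
    ext ⟨i, j⟩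
    have := h0 i j
    rw [h.biCoeff_sum] at this
    exact_mod_cast this
  simp [this]

theorem eq_of_add_natCast_mul_eq {p p' : ℕ} {i : ℤ} (hb : 0 < b)
    (e : i + (b : ℤ) * p = i + b * p') : p = p' := by
  have h3 := mul_left_cancel₀ (by exact_mod_cast hb.ne') (add_left_cancel e)
  exact_mod_cast h3

/-- A summand of a greedy element that does not contain its lowest monomial vanishes. -/
theorem IsRowHom.eq_zero_of_biCoeff_eq_zero (h : IsRowHom u v Ψ) (h' : IsRowHom v u Ψ')
    (hb : 0 < b) (hc : 0 < c) (hw : w * v = u ^ b + 1) (hu' : u' * u = v ^ c + 1) {y y' : K}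
    (hyy : greedyElement b c a u v = y + y')
    (hy : IsNonnegLaurent u v y) (hy' : IsNonnegLaurent u v y')
    (hyw : IsNonnegLaurent u w y) (hyw' : IsNonnegLaurent u w y')
    (hyu : IsNonnegLaurent v u' y) (hyu' : IsNonnegLaurent v u' y')
    (h0 : biCoeff (-a.1) (-a.2) (Ψ y') = 0) : y' = 0 := by
  have hsupp : ∀ i j, 0 < biCoeff i j (Ψ y') →
      biCoeff i j (Ψ (greedyElement b c a u v)) ≠ 0 := by
    intro i j hpos
    rw [hyy, map_add, map_add]
    exact (add_pos_of_nonneg_of_pos (hy.biCoeff_nonneg h i j) hpos).ne'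
  -- Infinite descent: at every support point other than the origin the row quotient or the column
  -- quotient vanishes, and a smaller point of the same row or column appears.
  have key : ∀ n p q : ℕ, p + q = n →
      ¬ 0 < biCoeff (-a.1 + b * p) (-a.2 + c * q) (Ψ y') := by
    intro n
    induction n using Nat.strong_induction_on with
    | _ n ih =>
      intro p q hn hpos
      obtain ⟨p', q', hq', hp', e1, e2⟩ := h.exists_of_biCoeff_ne_zero (hsupp _ _ hpos)
      obtain rfl := eq_of_add_natCast_mul_eq hb e1
      obtain rfl := eq_of_add_natCast_mul_eq hc e2
      have hpq : (p, q) ≠ (0, 0) := by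
        rintro e
        obtain ⟨rfl, rfl⟩ := Prod.mk.inj e
        simp [h0] at hpos
      rcases greedyQuot_eq_zero_or (a := a) hb hc hpq with hD | hE
      · obtain ⟨p', hlt, hpos'⟩ := h.exists_smaller hb hc hw hyy hy hyw hyw' hq' hD hpos
        exact ih (p' + q) (by omega) p' q rfl hpos'
      · rw [greedyElement_swap hb hc] at hyy
        rw [← hy'.biCoeff_swap h h'] at hpos
        obtain ⟨q', hlt, hpos'⟩ := h'.exists_smaller (a := a.swap) hc hb hu' hyy hy.swap hyu hyu'
          hp' hE hpos
        refine ih (p + q') (by omega) p q' rfl ?_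
        rw [← hy'.biCoeff_swap h h']
        exact hpos'
  refine hy'.eq_zero h fun i j => ?_
  by_contra hne
  have hpos := (hy'.biCoeff_nonneg h i j).lt_of_ne' hne
  obtain ⟨p, q, -, -, rfl, rfl⟩ := h.exists_of_biCoeff_ne_zero (hsupp _ _ hpos)
  exact key _ p q rfl hpos

/-- The lowest coefficient 1 is a sum of two non-negative integers, so one summand lacks the lowest
monomial. -/
theorem IsRowHom.eq_zero_or_eq_zero (h : IsRowHom u v Ψ) (h' : IsRowHom v u Ψ')
    (hb : 0 < b) (hc : 0 < c) (hw : w * v = u ^ b + 1) (hu' : u' * u = v ^ c + 1) {y y' : K}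
    (hyy : greedyElement b c a u v = y + y')
    (hy : IsNonnegLaurent u v y) (hy' : IsNonnegLaurent u v y')
    (hyw : IsNonnegLaurent u w y) (hyw' : IsNonnegLaurent u w y')
    (hyu : IsNonnegLaurent v u' y) (hyu' : IsNonnegLaurent v u' y') : y = 0 ∨ y' = 0 := by
  by_cases h0 : biCoeff (-a.1) (-a.2) (Ψ y') = 0
  · exact .inr (h.eq_zero_of_biCoeff_eq_zero h' hb hc hw hu' hyy hy hy' hyw hyw' hyu hyu' h0)
  refine .inl (h.eq_zero_of_biCoeff_eq_zero h' hb hc hw hu' (hyy.trans (add_comm _ _)) hy' hy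
    hyw' hyw hyu' hyu ?_)
  have h1 := h.biCoeff_greedyElement_self (a := a) hb hc
  rw [hyy, map_add, map_add] at h1
  obtain ⟨f, hf, rfl⟩ := hy
  obtain ⟨g, hg, rfl⟩ := hy'
  rw [h.biCoeff_sum] at h0
  rw [h.biCoeff_sum, h.biCoeff_sum] at h1
  rw [h.biCoeff_sum]
  norm_cast at h0 h1 ⊢
  have := hf (-a.1, -a.2)
  have := hg (-a.1, -a.2)
  omega

/-- In a relation take a with a₁ + a₂ maximal. No other element involved contains the monomial
u^(-a₁)v^(-a₂), because the exponents only grow from the lowest monomial. -/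
theorem IsRowHom.linearIndependent_greedyElement (h : IsRowHom u v Ψ) (hb : 0 < b) (hc : 0 < c) :
    LinearIndependent ℤ fun a => greedyElement b c a u v := by
  rw [linearIndependent_iff]
  intro l hl
  by_contra hne
  obtain ⟨a, ha, hmax⟩ := l.support.exists_max_image (fun a => a.1 + a.2)
    (Finsupp.support_nonempty_iff.2 hne)
  have h1 := congrArg (fun x => biCoeff (-a.1) (-a.2) (Ψ x)) hl
  simp only [Finsupp.linearCombination_apply, Finsupp.sum, map_sum, map_zsmul, map_zero] at h1
  rw [Finset.sum_eq_single a, h.biCoeff_greedyElement_self hb hc] at h1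
  · rw [Finsupp.mem_support_iff] at ha
    simp at h1
    exact ha h1
  · intro i hi hia
    rw [smul_eq_zero]
    refine .inr ?_
    by_contra hne'
    obtain ⟨p, q, -, -, e1, e2⟩ := h.exists_of_biCoeff_ne_zero hne'
    have h2 := hmax i hi
    have h3 : 0 ≤ (b : ℤ) * p := by positivity
    have h4 : 0 ≤ (c : ℤ) * q := by positivity
    exact hia (Prod.ext (by omega) (by omega))
  · exact fun hna => absurd ha hna

theorem mutated_pow_mul (hv : v ≠ 0) (hw : w * v = u ^ b + 1) (N : ℕ) :
    w ^ N = (1 + u ^ b) ^ N * v ^ (-(N : ℤ)) := by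
  rw [add_comm, ← hw, mul_pow, zpow_neg, zpow_natCast, mul_assoc,
    mul_inv_cancel₀ (pow_ne_zero _ hv), mul_one]

/-- The elements that are Laurent polynomials at three consecutive clusters are polynomials in
four consecutive cluster variables. -/
theorem le_toIntSubmodule (h : IsRowHom u v Ψ) (h' : IsRowHom v u Ψ') (hc : 0 < c)
    (hw : w * v = u ^ b + 1) (hu' : u' * u = v ^ c + 1) {U : Submodule ℤ K} {A : Subring K}
    (hU₀ : U ≤ monomialSpan univ univ u w) (hU₁ : U ≤ monomialSpan univ univ u v)
    (hU₂ : U ≤ monomialSpan univ univ v u') (hAU : ∀ x ∈ A, x ∈ U)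
    (huA : u ∈ A) (hvA : v ∈ A) (hwA : w ∈ A) (hu'A : u' ∈ A) :
    U ≤ A.toAddSubgroup.toIntSubmodule := by
  have hu0 := h.left_ne_zero
  have hv0 := h.right_ne_zero
  have hmem : ∀ x ∈ A, x ∈ A.toAddSubgroup.toIntSubmodule ⊓ U := fun x hx => ⟨hx, hAU x hx⟩
  refine le_of_standard h h' hc hw hu' hU₀ hU₁ hU₂ (fun i N => ?_) (fun j N => ?_)
    (fun i j => (hmem _ (mul_mem (pow_mem huA i) (pow_mem hvA j))).1)
  · have e := mutated_pow_mul hv0 hw (N + 1)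
    push_cast at e
    obtain ⟨n, rfl | rfl⟩ := Int.eq_nat_or_neg i
    · refine ⟨w ^ (N + 1) * u ^ n, hmem _ (mul_mem (pow_mem hwA _) (pow_mem huA _)), ?_⟩
      rw [e, zpow_natCast]
      convert zero_mem (monomialSpan univ (Ici (-(N : ℤ))) u v) using 1
      ring
    -- For i = -n the power u'^n = (1+v^c)^n u^(-n) replaces u^(-n): the constant term of (1+v^c)^n
    -- is 1, and its other terms only raise the exponent of v.
    · refine ⟨w ^ (N + 1) * u' ^ n, hmem _ (mul_mem (pow_mem hwA _) (pow_mem hu'A _)), ?_⟩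
      rw [e, mutated_pow_mul hu0 hu' n]
      rw [show ∀ A B C D : K, A * B * (C * D) - A * D * B = A * ((D * B) * (C - 1)) by
        intros; ring]
      refine mul_mem_monomialSpan hu0 hv0 (I := univ) (J := {0}) (I' := univ)
        (J' := Ici (-(N : ℤ))) (by simp) (by simp)
        (monomialSpan_mono (subset_univ _) le_rfl (one_add_pow_mem hu0 hv0 b _)) ?_
      refine mul_mem_monomialSpan hu0 hv0 (I := univ) (J := {-(N + 1 : ℤ)}) (I' := {0})
        (J' := Ici 1) (by simp) (fun j hj j' hj' => ?_) (monomial_mem (mem_univ _) rfl) ?_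
      · simp only [mem_Ici, mem_singleton_iff] at *
        omega
      · rw [monomialSpan_swap]
        exact one_add_pow_sub_one_mem hv0 hu0 hc n
  · have e := mutated_pow_mul hu0 hu' (N + 1)
    push_cast at e
    rw [mul_right_comm, ← e]
    exact hmem _ (mul_mem (pow_mem hu'A _) (pow_mem hvA _))

/-- The elements that are Laurent polynomials at three consecutive clusters are combinations of
greedy elements. -/
theorem le_span_greedyElement (h : IsRowHom u v Ψ) (h' : IsRowHom v u Ψ') (hb : 0 < b)
    (hc : 0 < c) (hw : w * v = u ^ b + 1) (hu' : u' * u = v ^ c + 1) {U : Submodule ℤ K}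
    (hU₀ : U ≤ monomialSpan univ univ u w) (hU₁ : U ≤ monomialSpan univ univ u v)
    (hU₂ : U ≤ monomialSpan univ univ v u') (hmem : ∀ a, greedyElement b c a u v ∈ U) :
    U ≤ Submodule.span ℤ (range fun a => greedyElement b c a u v) := by
  have hu0 := h.left_ne_zero
  have hv0 := h.right_ne_zero
  have hspan : ∀ a, greedyElement b c a u v ∈
      Submodule.span ℤ (range fun a => greedyElement b c a u v) := fun a =>
    Submodule.subset_span (mem_range_self a)
  refine le_of_standard h h' hc hw hu' hU₀ hU₁ hU₂ (fun i N => ?_) (fun j N => ?_)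
    (fun i j => ?_)
  · exact ⟨_, ⟨hspan _, hmem _⟩, greedyElement_sub_mem hb hc hu0 hv0 i N⟩
  -- With second coordinate at most 0 the greedy element consists of a single column, exactly the
  -- element required.
  · have e : greedyElement b c (N + 1, -(j : ℤ)) u v =
        (1 + v ^ c) ^ (N + 1) * v ^ j * u ^ (-(N + 1 : ℤ)) := by
      rw [greedyElement_swap hb hc, greedyElement_of_nonpos hc hb hu0 (by simp)]
      simp only [Prod.fst_swap, Prod.snd_swap, neg_neg, zpow_natCast]
      rw [show (N + 1 : ℤ).toNat = N + 1 by omega]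
    rw [← e]
    exact ⟨hspan _, hmem _⟩
  · rw [← greedyElement_neg hb hc hv0]
    exact hspan _

end

/-! ### Greedy elements at all clusters -/

variable {b c : ℕ}

theorem exchangeExp_pos (hb : 0 < b) (hc : 0 < c) (m : ℤ) : 0 < exchangeExp b c m := by
  unfold exchangeExp
  split_ifs <;> assumption

theorem exchangeExp_add_two (b c : ℕ) (m : ℤ) :
    exchangeExp b c (m + 1 + 1) = exchangeExp b c m := by
  unfold exchangeExp
  have : Odd (m + 1 + 1) ↔ Odd m := by rw [Int.odd_iff, Int.odd_iff]; omega
  simp only [this]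

/-- The greedy element at `a` with respect to the cluster `{x_m, x_{m+1}}`. -/
def greedyAt (b c : ℕ) (m : ℤ) (a : ℤ × ℤ) : AmbientField :=
  greedyElement (exchangeExp b c m) (exchangeExp b c (m + 1)) a (clusterVar b c m)
    (clusterVar b c (m + 1))

/-- Mutation replaces x_{m+2} by x_m; the swap then restores the order of the cluster. -/
theorem greedyAt_succ (hb : 0 < b) (hc : 0 < c) (m : ℤ) (a : ℤ × ℤ) : greedyAt b c (m + 1) a =
    greedyAt b c m (exchangeExp b c m * a.1.toNat - a.2, a.1) := by
  have h := clusterVar_exchange b c (m + 1)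
  rw [add_sub_cancel_right] at h
  have hb' := exchangeExp_pos hb hc (m + 1)
  have hc' := exchangeExp_pos hb hc m
  rw [greedyAt, exchangeExp_add_two, greedyElement_mutate hb' hc' (clusterVar_ne_zero b c _)
    (clusterVar_ne_zero b c _) h, greedyElement_swap hb' hc', greedyAt]
  rfl

theorem range_greedyAt_succ (hb : 0 < b) (hc : 0 < c) (m : ℤ) :
    range (greedyAt b c (m + 1)) = range (greedyAt b c m) := by
  ext x
  constructor
  · rintro ⟨a, rfl⟩
    exact ⟨_, (greedyAt_succ hb hc m a).symm⟩
  · rintro ⟨a, rfl⟩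
    -- The change of points is piecewise linear and invertible; this is the preimage of a.
    refine ⟨(a.2, exchangeExp b c m * a.2.toNat - a.1), ?_⟩
    rw [greedyAt_succ hb hc]
    simp

theorem range_greedyAt (hb : 0 < b) (hc : 0 < c) (m : ℤ) :
    range (greedyAt b c m) = range (greedyAt b c 1) := by
  induction m using Int.inductionOn' (b := 1) with
  | zero => rfl
  | succ k _ ih => rw [range_greedyAt_succ hb hc, ih]
  | pred k _ ih => rw [← range_greedyAt_succ hb hc, sub_add_cancel, ih]

theorem exists_greedyAt_eq (hb : 0 < b) (hc : 0 < c) (m k : ℤ) (a : ℤ × ℤ) :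
    ∃ a', greedyAt b c m a' = greedyAt b c k a := by
  have : greedyAt b c k a ∈ range (greedyAt b c m) := by
    rw [range_greedyAt hb hc m, ← range_greedyAt hb hc k]
    exact mem_range_self a
  exact this

theorem greedyAt_neg (hb : 0 < b) (hc : 0 < c) (m : ℤ) (d₁ d₂ : ℕ) :
    greedyAt b c m (-(d₁ : ℤ), -(d₂ : ℤ)) = clusterVar b c m ^ d₁ * clusterVar b c (m + 1) ^ d₂ :=
  greedyElement_neg (exchangeExp_pos hb hc _) (exchangeExp_pos hb hc _)
    (clusterVar_ne_zero b c _) d₁ d₂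

/-- Greedy elements are Laurent polynomials at all clusters. -/
theorem greedyAt_mem_monomialSpan (hb : 0 < b) (hc : 0 < c) (m k : ℤ) (a : ℤ × ℤ) :
    greedyAt b c k a ∈ monomialSpan univ univ (clusterVar b c m) (clusterVar b c (m + 1)) := by
  obtain ⟨a', e⟩ := exists_greedyAt_eq hb hc m k a
  rw [← e]
  exact greedyElement_mem (clusterVar_ne_zero b c _) (clusterVar_ne_zero b c _)

theorem isNonnegLaurent_greedyAt (hb : 0 < b) (hc : 0 < c) (m k : ℤ) (a : ℤ × ℤ) :
    IsNonnegLaurent (clusterVar b c m) (clusterVar b c (m + 1)) (greedyAt b c k a) := by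
  obtain ⟨a', e⟩ := exists_greedyAt_eq hb hc m k a
  rw [← e]
  exact isNonnegLaurent_greedyElement (clusterVar_ne_zero b c _) (clusterVar_ne_zero b c _)

/-- The Laurent phenomenon. -/
theorem mem_monomialSpan_of_mem_clusterAlgebra (hb : 0 < b) (hc : 0 < c) (m : ℤ)
    {x : AmbientField} (hx : x ∈ clusterAlgebra b c) :
    x ∈ monomialSpan univ univ (clusterVar b c m) (clusterVar b c (m + 1)) := by
  induction hx using Subring.closure_induction with
  | mem x hx =>
    obtain ⟨k, rfl⟩ := hx
    -- The cluster variable x_k is the greedy element at (-1, 0) of its own cluster.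
    have := greedyAt_mem_monomialSpan hb hc m k (-((1 : ℕ) : ℤ), -((0 : ℕ) : ℤ))
    rwa [greedyAt_neg hb hc, pow_one, pow_zero, mul_one] at this
  | zero => exact zero_mem _
  | one => exact one_mem_monomialSpan (mem_univ _) (mem_univ _)
  | add x y _ _ hx hy => exact add_mem hx hy
  | neg x _ hx => exact neg_mem hx
  | mul x y _ _ hx hy =>
    exact mul_mem_monomialSpan (clusterVar_ne_zero b c _) (clusterVar_ne_zero b c _)
      (by simp) (by simp) hx hy

theorem exists_isRowHom_clusterVar (b c : ℕ) :
    ∃ Ψ, IsRowHom (clusterVar b c 1) (clusterVar b c 2) Ψ := by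
  rw [clusterVar_one, clusterVar_two]
  exact exists_isRowHom

theorem exists_isRowHom_clusterVar_swap (b c : ℕ) :
    ∃ Ψ, IsRowHom (clusterVar b c 2) (clusterVar b c 1) Ψ := by
  rw [clusterVar_one, clusterVar_two]
  exact exists_isRowHom_swap

theorem clusterVar_zero_mul (b c : ℕ) :
    clusterVar b c 0 * clusterVar b c 2 = clusterVar b c 1 ^ b + 1 := by
  simpa using clusterVar_exchange b c 1

theorem clusterVar_three_mul (b c : ℕ) :
    clusterVar b c 3 * clusterVar b c 1 = clusterVar b c 2 ^ c + 1 := by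
  have := clusterVar_exchange b c 2
  rw [if_neg (by decide)] at this
  rw [mul_comm]
  exact this

theorem greedyAt_one (b c : ℕ) (a : ℤ × ℤ) :
    greedyAt b c 1 a = greedyElement b c a (clusterVar b c 1) (clusterVar b c 2) := by
  rw [greedyAt, show (1 + 1 : ℤ) = 2 by norm_num, exchangeExp, exchangeExp, if_pos (by decide),
    if_neg (by decide)]

/-- The elements that are Laurent polynomials at the three clusters around `{x₁, x₂}`. -/
def laurentIntersection (b c : ℕ) : Submodule ℤ AmbientField :=
  monomialSpan univ univ (clusterVar b c 1) (clusterVar b c 0) ⊓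
    monomialSpan univ univ (clusterVar b c 1) (clusterVar b c 2) ⊓
      monomialSpan univ univ (clusterVar b c 2) (clusterVar b c 3)

theorem mem_laurentIntersection {x : AmbientField} (hx : ∀ m : ℤ,
    x ∈ monomialSpan univ univ (clusterVar b c m) (clusterVar b c (m + 1))) :
    x ∈ laurentIntersection b c :=
  ⟨⟨by rw [monomialSpan_swap]; exact hx 0, hx 1⟩, hx 2⟩

/-- By the Laurent phenomenon the cluster algebra lies in the intersection, so elements built from
x₀, x₁, x₂, x₃ serve in the row reduction. This is also how greedy elements are seen to lie in the
cluster algebra. -/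
theorem laurentIntersection_le_clusterAlgebra (hb : 0 < b) (hc : 0 < c) {x : AmbientField}
    (hx : x ∈ laurentIntersection b c) : x ∈ clusterAlgebra b c := by
  obtain ⟨Ψ, h⟩ := exists_isRowHom_clusterVar b c
  obtain ⟨Ψ', h'⟩ := exists_isRowHom_clusterVar_swap b c
  have hvar : ∀ m, clusterVar b c m ∈ clusterAlgebra b c := fun m =>
    Subring.subset_closure (mem_range_self m)
  exact le_toIntSubmodule h h' hc (clusterVar_zero_mul b c) (clusterVar_three_mul b c)
    (inf_le_left.trans inf_le_left) (inf_le_left.trans inf_le_right) inf_le_right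
    (fun x hx => mem_laurentIntersection fun m =>
      mem_monomialSpan_of_mem_clusterAlgebra hb hc m hx)
    (hvar 1) (hvar 2) (hvar 0) (hvar 3) hx

theorem greedyAt_mem_clusterAlgebra (hb : 0 < b) (hc : 0 < c) (m : ℤ) (a : ℤ × ℤ) :
    greedyAt b c m a ∈ clusterAlgebra b c :=
  laurentIntersection_le_clusterAlgebra hb hc <| mem_laurentIntersection fun k =>
    greedyAt_mem_monomialSpan hb hc k m a

theorem mem_span_greedyAt (hb : 0 < b) (hc : 0 < c) {x : AmbientField}
    (hx : x ∈ clusterAlgebra b c) : x ∈ Submodule.span ℤ (range (greedyAt b c 1)) := by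
  obtain ⟨Ψ, h⟩ := exists_isRowHom_clusterVar b c
  obtain ⟨Ψ', h'⟩ := exists_isRowHom_clusterVar_swap b c
  rw [show greedyAt b c 1 = fun a => greedyElement b c a (clusterVar b c 1) (clusterVar b c 2)
    from funext (greedyAt_one b c)]
  refine le_span_greedyElement h h' hb hc (clusterVar_zero_mul b c) (clusterVar_three_mul b c)
    (inf_le_left.trans inf_le_left) (inf_le_left.trans inf_le_right) inf_le_right
    (fun a => ?_) (mem_laurentIntersection fun m =>
      mem_monomialSpan_of_mem_clusterAlgebra hb hc m hx)
  rw [← greedyAt_one]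
  exact mem_laurentIntersection fun k => greedyAt_mem_monomialSpan hb hc k 1 a

theorem isPointedExpansion_greedyAt (hb : 0 < b) (hc : 0 < c) (m : ℤ) (a : ℤ × ℤ) :
    IsPointedExpansion b c m a (greedyAt b c m a)
      (greedyFinsupp _ _ (exchangeExp_pos hb hc m) (exchangeExp_pos hb hc (m + 1)) a) := by
  refine ⟨?_, ?_⟩
  · simp [greedyFinsupp, greedyCoeff_zero_zero (exchangeExp_pos hb hc m)
      (exchangeExp_pos hb hc (m + 1))]
  · rw [greedyAt, greedyElement, Finset.sum_comm, ← Finset.sum_product', greedyFinsupp,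
      Finsupp.onFinset_sum _ (by simp)]
    simp

/-- An element is greedy exactly if it is the constructed one. -/
theorem isGreedy_iff (hb : 0 < b) (hc : 0 < c) {m : ℤ} {a : ℤ × ℤ} {x : clusterAlgebra b c} :
    IsGreedy b c m a x ↔ (x : AmbientField) = greedyAt b c m a := by
  have hb' := exchangeExp_pos hb hc m
  have hc' := exchangeExp_pos hb hc (m + 1)
  have hg := isPointedExpansion_greedyAt hb hc m a
  constructor
  · rintro ⟨f, ⟨hf0, hx⟩, hf⟩
    rw [hx, hg.2, GreedyRecurrence.unique hf (greedyRecurrence_greedyFinsupp hb' hc')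
      (hf0.trans hg.1.symm)]
  · intro hx
    exact ⟨_, hx ▸ hg, greedyRecurrence_greedyFinsupp hb' hc'⟩

theorem IsPositiveAt.isNonnegLaurent {m : ℤ} {x : clusterAlgebra b c} (hx : IsPositiveAt b c m x) :
    IsNonnegLaurent (clusterVar b c m) (clusterVar b c (m + 1)) (x : AmbientField) := by
  obtain ⟨-, f, hf, hpos⟩ := hx
  refine ⟨f, fun i => ?_, hf⟩
  by_cases hi : i ∈ f.support
  · exact (hpos i hi).le
  · rw [Finsupp.notMem_support_iff.1 hi]

theorem isPositiveAt_of_isNonnegLaurent {m : ℤ} {x : clusterAlgebra b c} (h0 : x ≠ 0)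
    (hx : IsNonnegLaurent (clusterVar b c m) (clusterVar b c (m + 1)) (x : AmbientField)) :
    IsPositiveAt b c m x := by
  obtain ⟨f, hf, e⟩ := hx
  exact ⟨h0, f, e, fun i hi => (hf i).lt_of_ne' (Finsupp.mem_support_iff.1 hi)⟩

/-- Positivity comes from being greedy at every cluster. Against a decomposition, the positivity of
the summands is needed only at {x₀,x₁}, {x₁,x₂} and {x₂,x₃}. -/
theorem isIndecomposablePositive_of_eq_greedyAt (hb : 0 < b) (hc : 0 < c) {a : ℤ × ℤ}
    {x : clusterAlgebra b c} (hx : (x : AmbientField) = greedyAt b c 1 a) :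
    IsIndecomposablePositive b c x := by
  obtain ⟨Ψ, h⟩ := exists_isRowHom_clusterVar b c
  obtain ⟨Ψ', h'⟩ := exists_isRowHom_clusterVar_swap b c
  refine ⟨fun m => isPositiveAt_of_isNonnegLaurent ?_ ?_, ?_⟩
  · rintro rfl
    have h1 := h.biCoeff_greedyElement_self (a := a) hb hc
    rw [← greedyAt_one, ← hx] at h1
    simp at h1
  · rw [hx]
    exact isNonnegLaurent_greedyAt hb hc m 1 a
  · rintro ⟨y, z, hy, hz, hyz⟩
    have e : greedyElement b c a (clusterVar b c 1) (clusterVar b c 2) = (y : AmbientField) + z := by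
      rw [← greedyAt_one, ← hx, hyz]
      rfl
    rcases h.eq_zero_or_eq_zero h' hb hc (clusterVar_zero_mul b c) (clusterVar_three_mul b c) e
      (hy 1).isNonnegLaurent (hz 1).isNonnegLaurent (hy 0).isNonnegLaurent.swap
      (hz 0).isNonnegLaurent.swap (hy 2).isNonnegLaurent (hz 2).isNonnegLaurent with h0 | h0
    · exact (hy 1).1 (Subtype.ext h0)
    · exact (hz 1).1 (Subtype.ext h0)

end RankTwoCluster

end

theorem theorem1p7 (b c : ℕ) (hb : 0 < b) (hc : 0 < c) :
    ∃ g : ℤ × ℤ → RankTwoCluster.clusterAlgebra b c,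
      (∀ a : ℤ × ℤ, RankTwoCluster.IsGreedy b c 1 a (g a) ∧
        ∀ x : RankTwoCluster.clusterAlgebra b c, RankTwoCluster.IsGreedy b c 1 a x → x = g a) ∧
      (∀ a : ℤ × ℤ, RankTwoCluster.IsIndecomposablePositive b c (g a)) ∧
      LinearIndependent ℤ g ∧
      Submodule.span ℤ (Set.range g) = ⊤ ∧
      (∀ m : ℤ, {x : RankTwoCluster.clusterAlgebra b c |
        ∃ a : ℤ × ℤ, RankTwoCluster.IsGreedy b c m a x} = Set.range g) ∧
      (∀ x : RankTwoCluster.AmbientField, RankTwoCluster.IsClusterMonomial b c x →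
        ∃ a : ℤ × ℤ, x = (g a : RankTwoCluster.AmbientField)) := by
  open RankTwoCluster in
  let g : ℤ × ℤ → clusterAlgebra b c := fun a =>
    ⟨greedyAt b c 1 a, greedyAt_mem_clusterAlgebra hb hc 1 a⟩
  let f : clusterAlgebra b c →ₗ[ℤ] AmbientField :=
    (clusterAlgebra b c).subtype.toAddMonoidHom.toIntLinearMap
  have hfg : f ∘ g = greedyAt b c 1 := rfl
  refine ⟨g, fun a => ⟨(isGreedy_iff hb hc).2 rfl, fun x hx =>
    Subtype.ext ((isGreedy_iff hb hc).1 hx)⟩,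
    fun a => isIndecomposablePositive_of_eq_greedyAt hb hc rfl, ?_, ?_, fun m => ?_, ?_⟩
  · obtain ⟨Ψ, h⟩ := exists_isRowHom_clusterVar b c
    refine LinearIndependent.of_comp f ?_
    rw [hfg, show greedyAt b c 1 = fun a =>
      greedyElement b c a (clusterVar b c 1) (clusterVar b c 2) from funext (greedyAt_one b c)]
    exact h.linearIndependent_greedyElement hb hc
  · refine eq_top_iff.2 fun x _ => ?_
    -- The span is known inside the field; it is pulled back along the injective inclusion `f`.
    have hx := mem_span_greedyAt hb hc x.2
    rw [← hfg, Set.range_comp, ← Submodule.map_span] at hx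
    obtain ⟨y, hy, e⟩ := hx
    rwa [show y = x from Subtype.ext e] at hy
  · ext x
    constructor
    · rintro ⟨a, ha⟩
      obtain ⟨a', e⟩ := exists_greedyAt_eq hb hc 1 m a
      exact ⟨a', Subtype.ext (e.trans ((isGreedy_iff hb hc).1 ha).symm)⟩
    · rintro ⟨a, rfl⟩
      obtain ⟨a', e⟩ := exists_greedyAt_eq hb hc m 1 a
      exact ⟨a', (isGreedy_iff hb hc).2 e.symm⟩
  · rintro x ⟨m, d₁, d₂, rfl⟩
    obtain ⟨a, e⟩ := exists_greedyAt_eq hb hc 1 m (-(d₁ : ℤ), -(d₂ : ℤ))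
    exact ⟨a, by rw [← greedyAt_neg hb hc, ← e]⟩
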